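/- Let $L>0$, $\beta>0$, $\lambda\in\mathbb{R}$, let $\mathbb{T}_L=\mathbb{R}/L\mathbb{Z}$ and $E=H^1(\mathbb{T}_L,\mathbb{C})$ with the norm $\|u\|^2=\int_0^L(|\partial_xu|^2+|u|^2)\,dx$ and the distance $\mathrm{d}$ that it induces. Let $G=\mathbb{R}\times\mathbb{R}$ act on $E$ by $(\Phi_{a,\gamma}u)(x)=e^{i\gamma}u(x-a)$, and write $\mathcal{O}_u=\{\Phi_gu : g\in G\}$. A dynamical system on $E$ is a separately continuous map $\mathbb{R}\times E\to E$, $(t,u)\mapsto\Phi_t(u)$, with $\Phi_0=\mathrm{Id}$ and $\Phi_t\circ\Phi_s=\Phi_{t+s}$; it has $G$ as an invariance group if $\Phi_g\circ\Phi_t=\Phi_t\circ\Phi_g$ for all $g\in G$, $t\in\mathbb{R}$. For such a system, $u\in E$ is a relative equilibrium if $\Phi_t(u)\in\mathcal{O}_u$ for all $t\in\mathbb{R}$, and $u$ is orbitally stable if for every $\epsilon>0$ there is $\delta>0$ such that for all $v\in E$ $$\mathrm{d}(v,u)\le\delta\ \Longrightarrow\ \forall t\in\mathbb{R},\quad \inf_{t'\in\mathbb{R}}\mathrm{d}\big(\Phi_t(v),\mathcal{O}_{\Phi_{t'}(u)}\big)\le\epsilon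 .$$ (1) The cubic nonlinear Schrödinger equation $$i\partial_tu+\beta\partial_{xx}^2u+\lambda|u|^2u=0$$ on $\mathbb{T}_L$ has, for each initial datum in $E$, exactly one global solution in $C(\mathbb{R},E)$ (the equation being understood, at every time, in the sense of distributions in $x$), and these solutions form a dynamical system on $E$ with invariance group $G$. For every $\alpha\in\mathbb{R}$ with $\beta\left(\frac{2\pi}{L}\right)^2-2\lambda|\alpha|^2>0$ and every $k\in\frac{2\pi}{L}\mathbb{Z}$, every $u$ in the $G$-orbit $\{\alpha e^{i\gamma}e^{-ik(x-a)} : (a,\gamma)\in G\}$ of the plane wave $\alpha e^{-ikx}$ is an orbitally stable relative equilibrium of this system. (The condition on $\alpha$ covers the defocusing case $\lambda<0$, and the focusing case when $0<2\lambda\alpha^2<\beta(2\pi/L)^2$.) (2) For every $k\in\frac{2\pi}{L}\mathbb{Z}$, the same holds for the equation $$i\partial_tU+\beta\partial_{xx}^2U-2i\beta k\,\partial_xU+\lambda|U|^2U-\beta k^2U=0,$$ satisfied by $U(t,x)=e^{ikx}u(t,x)$: it has for each initial datum in $E$ exactly one global solution in $C(\mathbb{R},E)$, these solutions form a dynamical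 system with invariance group $G$, and for every $\alpha\in\mathbb{R}$ with $\beta\left(\frac{2\pi}{L}\right)^2-2\lambda|\alpha|^2>0$ every $U$ in the $G$-orbit $\{\alpha e^{i\gamma} : \gamma\in\mathbb{R}\}$ of the constant function $\alpha$ is an orbitally stable relative equilibrium. -/

import Mathlib

open MeasureTheory
open scoped ContDiff

noncomputable section

/-! ## Dynamical systems with symmetry -/

namespace DynSys

/-- A (global) dynamical system on `E`: a separately continuous map `ℝ × E → E` with the
group property. -/
structure IsDynamicalSystem {E : Type*} [TopologicalSpace E] (Φ : ℝ → E → E) : Prop where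
  continuous_time : ∀ u, Continuous fun t => Φ t u
  continuous_space : ∀ t, Continuous (Φ t)
  zero : ∀ u, Φ 0 u = u
  comp : ∀ t s u, Φ t (Φ s u) = Φ (t + s) u

/-- `G` is an invariance group of the dynamics: every `g` commutes with every `Φ t`. -/
def IsInvarianceGroup (G : Type*) {E : Type*} [AddGroup G] [AddAction G E]
    (Φ : ℝ → E → E) : Prop :=
  ∀ (g : G) (t : ℝ) (u : E), g +ᵥ Φ t u = Φ t (g +ᵥ u)

/-- `u` is a `G`-relative equilibrium: its trajectory stays in its group orbit. -/
def IsRelativeEquilibrium (G : Type*) {E : Type*} [AddGroup G] [AddAction G E]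
    (Φ : ℝ → E → E) (u : E) : Prop :=
  ∀ t : ℝ, Φ t u ∈ AddAction.orbit G u

/-- Orbital stability of `u`: trajectories starting near `u` stay, for all times, near the set
`{g +ᵥ Φ t' u | g ∈ G, t' ∈ ℝ}`. -/
def IsOrbitallyStable (G : Type*) {E : Type*} [PseudoMetricSpace E] [AddGroup G] [AddAction G E]
    (Φ : ℝ → E → E) (u : E) : Prop :=
  ∀ ε : ℝ, 0 < ε → ∃ δ : ℝ, 0 < δ ∧ ∀ v : E, dist v u ≤ δ →
    ∀ t : ℝ, ⨅ t' : ℝ, Metric.infDist (Φ t v) (AddAction.orbit G (Φ t' u)) ≤ ε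

/-- `Φ` is the solution map of a Cauchy problem, the solutions on `ℝ` being described by `Sol`:
for every datum `u₀`, the curve `t ↦ Φ t u₀` is the one and only solution with value `u₀` at
time `0`. -/
def IsSolutionFlow {E : Type*} (Sol : (ℝ → E) → Prop) (Φ : ℝ → E → E) : Prop :=
  ∀ (u₀ : E) (u : ℝ → E), (Sol u ∧ u 0 = u₀) ↔ u = fun t => Φ t u₀

end DynSys

/-! ## The Sobolev space `H¹` of the torus `ℝ / Lℤ` -/

namespace Torus

/-- Test functions: smooth functions on the torus. -/
def IsSmooth {L : ℝ} (φ : AddCircle L → ℂ) : Prop :=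
  ContDiff ℝ ∞ fun x : ℝ => φ (x : AddCircle L)

/-- The derivative of a (smooth) function on the torus. -/
def circleDeriv {L : ℝ} (φ : AddCircle L → ℂ) (x : AddCircle L) : ℂ :=
  deriv (fun s : ℝ => φ (x + (s : AddCircle L))) 0

theorem circleDeriv_coe {L : ℝ} (φ : AddCircle L → ℂ) (x : ℝ) :
    circleDeriv φ (x : AddCircle L) = deriv (fun y : ℝ => φ (y : AddCircle L)) x := by
  have h := deriv_comp_const_add (f := fun y : ℝ => φ (y : AddCircle L)) x 0
  simpa [circleDeriv] using h

theorem continuous_of_comp_coe {L : ℝ} {φ : AddCircle L → ℂ}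
    (h : Continuous fun x : ℝ => φ (x : AddCircle L)) : Continuous φ :=
  (QuotientAddGroup.isQuotientMap_mk (N := AddSubgroup.zmultiples L)).continuous_iff.2 h

theorem IsSmooth.continuous {L : ℝ} {φ : AddCircle L → ℂ} (h : IsSmooth φ) : Continuous φ :=
  continuous_of_comp_coe (ContDiff.continuous (𝕜 := ℝ) h)

theorem IsSmooth.continuous_circleDeriv {L : ℝ} {φ : AddCircle L → ℂ} (h : IsSmooth φ) :
    Continuous (circleDeriv φ) := by
  refine continuous_of_comp_coe ?_
  simp only [circleDeriv_coe]
  exact ContDiff.continuous_deriv h (by simp)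

theorem IsSmooth.translate {L : ℝ} {φ : AddCircle L → ℂ} (h : IsSmooth φ) (a : ℝ) :
    IsSmooth fun x => φ (x + (a : AddCircle L)) := by
  have h1 : ContDiff ℝ ∞ fun x : ℝ => x + a := contDiff_id.add contDiff_const
  simpa [IsSmooth, Function.comp_def] using ContDiff.comp (𝕜 := ℝ) h h1

theorem isSmooth_const_mul_fourier {L : ℝ} (α : ℂ) (n : ℤ) :
    IsSmooth fun x : AddCircle L => α * fourier n x := by
  simp only [IsSmooth, fourier_coe_apply]
  have h : ContDiff ℝ ∞ fun x : ℝ => (x : ℂ) := Complex.ofRealCLM.contDiff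
  exact contDiff_const.mul ((contDiff_const.mul h).div_const _).cexp

theorem const_mul_fourier_eq {L : ℝ} (α : ℝ) (n : ℤ) (x : ℝ) :
    (α : ℂ) * fourier (-n) (x : AddCircle L)
      = α * Complex.exp (- Complex.I * (2 * Real.pi / L * n) * x) := by
  rw [fourier_coe_apply]
  congr 2
  push_cast
  ring

variable {L : ℝ} [Fact (0 < L)]

/-- `L²` of the torus, for Lebesgue measure of total mass `L`. -/
abbrev L2 (L : ℝ) [Fact (0 < L)] : Type := Lp ℂ 2 (volume : Measure (AddCircle L))

theorem memLp_of_continuous {φ : AddCircle L → ℂ} (h : Continuous φ) :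
    MemLp φ 2 (volume : Measure (AddCircle L)) :=
  (memLp_top_of_bound h.aestronglyMeasurable _
    (Filter.Eventually.of_forall fun x =>
      (BoundedContinuousFunction.mkOfCompact ⟨φ, h⟩).norm_coe_le_norm x)).mono_exponent le_top

theorem integrable_mul (u : L2 L) {φ : AddCircle L → ℂ} (h : Continuous φ) :
    Integrable fun x => u x * φ x :=
  (Lp.memLp u).integrable_mul (memLp_of_continuous h)

/-- `v` is the weak derivative of `u`: `∫ u φ' = - ∫ v φ` for all test functions `φ`. -/
def HasWeakDeriv (u v : L2 L) : Prop :=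
  ∀ φ : AddCircle L → ℂ, IsSmooth φ → ∫ x, u x * circleDeriv φ x = - ∫ x, v x * φ x

theorem HasWeakDeriv.add {u v u' v' : L2 L} (h : HasWeakDeriv u v) (h' : HasWeakDeriv u' v') :
    HasWeakDeriv (u + u') (v + v') := by
  intro φ hφ
  have e1 : ∫ x, (u + u') x * circleDeriv φ x
      = (∫ x, u x * circleDeriv φ x) + ∫ x, u' x * circleDeriv φ x := by
    rw [← integral_add (integrable_mul u hφ.continuous_circleDeriv)
      (integrable_mul u' hφ.continuous_circleDeriv)]
    refine integral_congr_ae ?_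
    filter_upwards [Lp.coeFn_add u u'] with x hx
    rw [hx, Pi.add_apply, add_mul]
  have e2 : ∫ x, (v + v') x * φ x = (∫ x, v x * φ x) + ∫ x, v' x * φ x := by
    rw [← integral_add (integrable_mul v hφ.continuous) (integrable_mul v' hφ.continuous)]
    refine integral_congr_ae ?_
    filter_upwards [Lp.coeFn_add v v'] with x hx
    rw [hx, Pi.add_apply, add_mul]
  rw [e1, e2, h φ hφ, h' φ hφ, neg_add]

theorem HasWeakDeriv.smul {u v : L2 L} (c : ℂ) (h : HasWeakDeriv u v) :
    HasWeakDeriv (c • u) (c • v) := by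
  have key : ∀ (w : L2 L) (ψ : AddCircle L → ℂ),
      ∫ x, (c • w) x * ψ x = c * ∫ x, w x * ψ x := by
    intro w ψ
    rw [← integral_const_mul]
    refine integral_congr_ae ?_
    filter_upwards [Lp.coeFn_smul c w] with x hx
    rw [hx, Pi.smul_apply, smul_eq_mul, mul_assoc]
  intro φ hφ
  rw [key, key, h φ hφ, mul_neg]

theorem HasWeakDeriv.zero : HasWeakDeriv (0 : L2 L) 0 := by
  have h : ∀ ψ : AddCircle L → ℂ, ∫ x, (0 : L2 L) x * ψ x = 0 := by
    intro ψ
    rw [← integral_zero (AddCircle L) ℂ]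
    refine integral_congr_ae ?_
    filter_upwards [Lp.coeFn_zero ℂ 2 (volume : Measure (AddCircle L))] with x hx
    rw [hx, Pi.zero_apply, zero_mul]
  intro φ _
  rw [h, h, neg_zero]

/-- The space of pairs `(u, ∂ₓu)` in `L² × L²`, with the Hilbert norm
`‖(u, ∂ₓu)‖² = ‖u‖² + ‖∂ₓu‖²`. -/
def sobolev (L : ℝ) [Fact (0 < L)] : Submodule ℂ (WithLp 2 (L2 L × L2 L)) where
  carrier := {w | HasWeakDeriv w.fst w.snd}
  add_mem' h h' := HasWeakDeriv.add h h'
  zero_mem' := HasWeakDeriv.zero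
  smul_mem' c _ h := HasWeakDeriv.smul c h

/-- The Sobolev space `H¹` of the torus: an element is a function `u ∈ L²` together with its
(unique) weak derivative `∂ₓu ∈ L²`. -/
abbrev H1 (L : ℝ) [Fact (0 < L)] : Type := sobolev L

/-- The function `u ∈ L²` underlying an element of `H¹`. -/
def H1.val (u : H1 L) : L2 L := (u : WithLp 2 (L2 L × L2 L)).fst

/-- The weak derivative `∂ₓu ∈ L²` of an element of `H¹`. -/
def H1.dx (u : H1 L) : L2 L := (u : WithLp 2 (L2 L × L2 L)).snd

/-- A smooth function as an element of `H¹`. -/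
def H1.ofSmooth (φ : AddCircle L → ℂ) (hφ : IsSmooth φ) : H1 L :=
  ⟨WithLp.toLp 2 ((memLp_of_continuous hφ.continuous).toLp φ,
      (memLp_of_continuous hφ.continuous_circleDeriv).toLp (circleDeriv φ)), by
    intro ψ hψ
    change ∫ x, (memLp_of_continuous hφ.continuous).toLp φ x * circleDeriv ψ x
      = - ∫ x, (memLp_of_continuous hφ.continuous_circleDeriv).toLp (circleDeriv φ) x * ψ x
    have e1 : ∫ x, (memLp_of_continuous hφ.continuous).toLp φ x * circleDeriv ψ x
        = ∫ x, φ x * circleDeriv ψ x := by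
      refine integral_congr_ae ?_
      filter_upwards [(memLp_of_continuous hφ.continuous).coeFn_toLp] with x hx
      rw [hx]
    have e2 : ∫ x, (memLp_of_continuous hφ.continuous_circleDeriv).toLp (circleDeriv φ) x * ψ x
        = ∫ x, circleDeriv φ x * ψ x := by
      refine integral_congr_ae ?_
      filter_upwards [(memLp_of_continuous hφ.continuous_circleDeriv).coeFn_toLp] with x hx
      rw [hx]
    rw [e1, e2, ← AddCircle.intervalIntegral_preimage L 0,
      ← AddCircle.intervalIntegral_preimage L 0]
    simp only [circleDeriv_coe]
    have dφ : ∀ x : ℝ, HasDerivAt (fun y : ℝ => φ (y : AddCircle L))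
        (deriv (fun y : ℝ => φ (y : AddCircle L)) x) x := fun x =>
      ((ContDiff.differentiable (𝕜 := ℝ) hφ (by simp)) x).hasDerivAt
    have dψ : ∀ x : ℝ, HasDerivAt (fun y : ℝ => ψ (y : AddCircle L))
        (deriv (fun y : ℝ => ψ (y : AddCircle L)) x) x := fun x =>
      ((ContDiff.differentiable (𝕜 := ℝ) hψ (by simp)) x).hasDerivAt
    rw [intervalIntegral.integral_mul_deriv_eq_deriv_mul (fun x _ => dφ x) (fun x _ => dψ x)
      ((ContDiff.continuous_deriv hφ (by simp)).intervalIntegrable _ _)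
      ((ContDiff.continuous_deriv hψ (by simp)).intervalIntegrable _ _)]
    have hL : (L : AddCircle L) = 0 := AddCircle.coe_period L
    simp [hL]⟩

/-! ### Translations and phase rotations -/

theorem measurePreserving_sub (a : ℝ) :
    MeasurePreserving (fun x : AddCircle L => x - (a : AddCircle L)) volume volume :=
  measurePreserving_sub_right volume (a : AddCircle L)

/-- `(a, γ)` acts on `u ∈ L²` by `x ↦ e^{iγ} u(x - a)`. -/
def L2.act (g : ℝ × ℝ) (u : L2 L) : L2 L :=
  Complex.exp (Complex.I * g.2) • Lp.compMeasurePreserving _ (measurePreserving_sub g.1) u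

theorem L2.coeFn_act (g : ℝ × ℝ) (u : L2 L) :
    L2.act g u =ᵐ[volume]
      fun x => Complex.exp (Complex.I * g.2) * u (x - (g.1 : AddCircle L)) := by
  filter_upwards [Lp.coeFn_smul (Complex.exp (Complex.I * g.2))
      (Lp.compMeasurePreserving _ (measurePreserving_sub g.1) u),
    Lp.coeFn_compMeasurePreserving u (measurePreserving_sub g.1)] with x h1 h2
  rw [L2.act, h1, Pi.smul_apply, h2, smul_eq_mul, Function.comp_apply]

theorem L2.act_zero (u : L2 L) : L2.act 0 u = u := by
  refine Lp.ext ?_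
  filter_upwards [L2.coeFn_act 0 u] with x hx
  simpa using hx

theorem L2.act_add (g h : ℝ × ℝ) (u : L2 L) : L2.act (g + h) u = L2.act g (L2.act h u) := by
  refine Lp.ext ?_
  filter_upwards [L2.coeFn_act (g + h) u, L2.coeFn_act g (L2.act h u),
    (measurePreserving_sub g.1).quasiMeasurePreserving.ae (L2.coeFn_act h u)] with x h1 h2 h3
  rw [h1, h2, h3, ← mul_assoc, ← Complex.exp_add]
  congr 2
  · simp only [Prod.snd_add]; push_cast; ring
  · simp only [Prod.fst_add]; rw [AddCircle.coe_add]; abel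

theorem HasWeakDeriv.act (g : ℝ × ℝ) {u v : L2 L} (h : HasWeakDeriv u v) :
    HasWeakDeriv (L2.act g u) (L2.act g v) := by
  have key : ∀ (w : L2 L) (ψ : AddCircle L → ℂ),
      ∫ x, L2.act g w x * ψ x
        = Complex.exp (Complex.I * g.2) * ∫ x, w x * ψ (x + (g.1 : AddCircle L)) := by
    intro w ψ
    rw [← integral_const_mul,
      ← integral_sub_right_eq_self (fun x : AddCircle L =>
        Complex.exp (Complex.I * g.2) * (w x * ψ (x + (g.1 : AddCircle L)))) (g.1 : AddCircle L)]
    refine integral_congr_ae ?_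
    filter_upwards [L2.coeFn_act g w] with x hx
    rw [hx, sub_add_cancel, mul_assoc]
  intro φ hφ
  have hd : ∀ x : AddCircle L, circleDeriv φ (x + (g.1 : AddCircle L))
      = circleDeriv (fun y => φ (y + (g.1 : AddCircle L))) x := by
    intro x
    simp only [circleDeriv, add_right_comm]
  rw [key, key]
  simp only [hd]
  rw [h _ (hφ.translate g.1), mul_neg]

/-- The action of the group `ℝ × ℝ` on `H¹`: `((a, γ) +ᵥ u)(x) = e^{iγ} u(x - a)`. -/
instance H1.instAddAction : AddAction (ℝ × ℝ) (H1 L) where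
  vadd g u := ⟨WithLp.toLp 2 (L2.act g u.val, L2.act g u.dx), HasWeakDeriv.act g u.2⟩
  zero_vadd u := by
    refine Subtype.ext ?_
    change WithLp.toLp 2 (L2.act 0 u.val, L2.act 0 u.dx) = u.1
    rw [L2.act_zero, L2.act_zero]
    rfl
  add_vadd g h u := by
    refine Subtype.ext ?_
    change WithLp.toLp 2 (L2.act (g + h) u.val, L2.act (g + h) u.dx)
      = WithLp.toLp 2 (L2.act g (L2.act h u.val), L2.act g (L2.act h u.dx))
    rw [L2.act_add, L2.act_add]

/-! ### The equations and the plane waves -/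

/-- `u ∈ C(ℝ, H¹)` solves `i ∂ₜu + β ∂ₓₓu + λ |u|² u = 0` on the torus: the equation, solved for
`∂ₜu`, holds at every time when paired with any test function. -/
def IsNLSSolution (L : ℝ) [Fact (0 < L)] (β lam : ℝ) (u : ℝ → H1 L) : Prop :=
  Continuous u ∧
  ∀ φ : AddCircle L → ℂ, IsSmooth φ → ∀ t : ℝ,
    HasDerivAt (fun s : ℝ => ∫ x, (u s).val x * φ x)
      (Complex.I * (- β * (∫ x, (u t).dx x * circleDeriv φ x)
        + lam * ∫ x, (‖(u t).val x‖ ^ 2 : ℝ) * (u t).val x * φ x)) t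

/-- `U ∈ C(ℝ, H¹)` solves `i ∂ₜU + β ∂ₓₓU - 2 i β k ∂ₓU + λ |U|² U - β k² U = 0` on the torus, in
the same sense. -/
def IsModulatedNLSSolution (L : ℝ) [Fact (0 < L)] (β lam k : ℝ) (U : ℝ → H1 L) : Prop :=
  Continuous U ∧
  ∀ φ : AddCircle L → ℂ, IsSmooth φ → ∀ t : ℝ,
    HasDerivAt (fun s : ℝ => ∫ x, (U s).val x * φ x)
      (Complex.I * (- β * (∫ x, (U t).dx x * circleDeriv φ x)
        - 2 * Complex.I * β * k * (∫ x, (U t).dx x * φ x)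
        + lam * (∫ x, (‖(U t).val x‖ ^ 2 : ℝ) * (U t).val x * φ x)
        - β * k ^ 2 * ∫ x, (U t).val x * φ x)) t

/-- The plane wave profile `x ↦ α e^{-ikx}` in `H¹`, with `k = 2πn / L`. -/
def planeWave (L : ℝ) [Fact (0 < L)] (α : ℝ) (n : ℤ) : H1 L :=
  H1.ofSmooth (fun x => α * fourier (-n) x) (isSmooth_const_mul_fourier α (-n))

end Torus

end

/-! Write S(t) = e^{iβt∂ₓ²}. In the interaction picture v(t) = S(-t)u(t) the equation is an ordinary
differential equation in H¹. Its field is Lipschitz on balls, uniformly in time, since H¹ is an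
algebra and S(t) an isometry. Its solutions are exactly the distributional ones
(`isNLSSolution_iff_isMild`). Mass and energy are conserved, and since sup|u|² ≤ c_A (A²∫|u|² +
∫|∂ₓu|²) with c_A → 0 as A → ∞, they bound the H¹ norm whatever the sign of λ
(`exists_bound_of_energy_eq`). This gives a global flow, locally Lipschitz in the datum.

Energy conservation is proved directly at H¹ regularity. The increment of ∫|u|⁴ is a pairing of u(s)
- u(t) with a curve that is continuous in H¹, and such a pairing is differentiable
(`hasDerivAt_inner_free`); no smoother solutions are needed.

Multiplication by e^{2πimx/L} conjugates the flow to itself up to a motion in G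
(`IsMildFlow.apply_boost`) and permutes the plane waves of given amplitude, so stability need only
be shown for constants. Let m be the mean of |u|². Since mass is conserved, so is β/2∫|∂ₓu|² -
λ/4∫(|u|² - m)². By Wirtinger's inequality with sharp constant, near the constants of modulus |α|
the second integral is at most about 4α²(L/2π)²∫|∂ₓu|², so the condition on α is precisely what
makes this quantity comparable to ∫|∂ₓu|² (`exists_relEnergy_bounds`). A continuity argument keeps
∂ₓu small for all time, and conservation of mass then keeps u close to some αe^{iγ}.

The modulated equation is the conjugate of the original one by e^{ikx}, so everything is transported
to it. -/

noncomputable section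
-- Global solutions of ordinary differential equations in Banach spaces
namespace GlobalODE
open Filter Topology Set
open scoped NNReal

set_option linter.unusedSectionVars false
variable {E : Type*} [NormedAddCommGroup E] [NormedSpace ℝ E]

/-- A bounded vector field, Lipschitz in space and continuous in time, has global solutions. -/
theorem exists_global_of_bounded [CompleteSpace E] {F : ℝ → E → E} {K B : ℝ≥0}
    (hF : ∀ x, Continuous fun t => F t x) (hK : ∀ t, LipschitzWith K (F t))
    (hB : ∀ t x, ‖F t x‖ ≤ B) (x₀ : E) :
    ∃ v : ℝ → E, v 0 = x₀ ∧ ∀ t, HasDerivAt v (F t (v t)) t := by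
  have hloc : ∀ n : ℕ, ∃ v : ℝ → E, v 0 = x₀ ∧
      ∀ t ∈ Ioo (-(n + 1 : ℝ)) (n + 1), HasDerivAt v (F t (v t)) t := by
    intro n
    have h0 : (0 : ℝ) ∈ Icc (-(n + 1 : ℝ)) (n + 1) := ⟨by linarith [n.cast_nonneg (α := ℝ)],
      by positivity⟩
    -- In time `n + 1` a solution of speed at most `B` travels at most `B * (n + 1)`, so a ball of
    -- that radius serves for the whole interval.
    have hPL : IsPicardLindelof F (⟨0, h0⟩ : Icc (-(n + 1 : ℝ)) (n + 1)) x₀ (B * (n + 1)) 0 B K :=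
      { lipschitzOnWith := fun t _ => (hK t).lipschitzOnWith
        continuousOn := fun x _ => (hF x).continuousOn
        norm_le := fun t _ x _ => hB t x
        mul_max_le := by simp }
    obtain ⟨v, hv0, hv⟩ := hPL.exists_eq_forall_mem_Icc_hasDerivWithinAt₀
    exact ⟨v, hv0, fun t ht =>
      (hv t (Ioo_subset_Icc_self ht)).hasDerivAt (Icc_mem_nhds ht.1 ht.2)⟩
  choose w hw0 hw using hloc
  have hmono : ∀ m n : ℕ, m ≤ n → EqOn (w m) (w n) (Ioo (-(m + 1 : ℝ)) (m + 1)) := by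
    intro m n hmn
    have hmn' : (m : ℝ) ≤ n := by exact_mod_cast hmn
    refine ODE_solution_unique_of_mem_Ioo (v := F) (K := K) (s := fun _ => univ) (t₀ := 0)
      (fun t _ => (hK t).lipschitzOnWith) ⟨by linarith [m.cast_nonneg (α := ℝ)], by positivity⟩
      (fun t ht => ⟨hw m t ht, trivial⟩)
      (fun t ht => ⟨hw n t ⟨by linarith [ht.1], by linarith [ht.2]⟩, trivial⟩) ?_
    rw [hw0, hw0]
  have hagree : ∀ (m n : ℕ) (t : ℝ), |t| < m + 1 → |t| < n + 1 → w m t = w n t := by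
    intro m n t hm hn
    rcases le_total m n with h | h
    · exact hmono m n h (abs_lt.1 hm)
    · exact (hmono n m h (abs_lt.1 hn)).symm
  have hfl : ∀ t : ℝ, |t| < (⌊|t|⌋₊ : ℝ) + 1 := fun t => Nat.lt_floor_add_one _
  -- The solutions on growing intervals agree on overlaps, so near each time the glued curve
  -- coincides with a single one of them.
  refine ⟨fun t => w ⌊|t|⌋₊ t, hw0 _, fun t => ?_⟩
  have ht : |t| < ((⌊|t|⌋₊ + 1 : ℕ) : ℝ) + 1 := by
    push_cast
    linarith [hfl t]
  have h1 := hw (⌊|t|⌋₊ + 1) t (abs_lt.1 ht)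
  simp only
  rw [hagree _ (⌊|t|⌋₊ + 1) t (hfl t) ht]
  refine h1.congr_of_eventuallyEq ?_
  filter_upwards [(continuous_abs.tendsto t).eventually (gt_mem_nhds ht)] with s hs
  exact hagree _ _ s (hfl s) hs

/-- The radial cutoff, equal to `1` on the ball of radius `R` and to `0` outside the ball of
radius `R + 1`. -/
def cutoff (R : ℝ) (x : E) : ℝ := max 0 (min 1 (R + 1 - ‖x‖))

theorem cutoff_nonneg (R : ℝ) (x : E) : 0 ≤ cutoff R x := le_max_left _ _

theorem cutoff_le_one (R : ℝ) (x : E) : cutoff R x ≤ 1 := max_le zero_le_one (min_le_left _ _)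

theorem cutoff_eq_one {R : ℝ} {x : E} (h : ‖x‖ ≤ R) : cutoff R x = 1 := by
  rw [cutoff, min_eq_left (by linarith), max_eq_right zero_le_one]

theorem cutoff_eq_zero {R : ℝ} {x : E} (h : R + 1 ≤ ‖x‖) : cutoff R x = 0 := by
  rw [cutoff, max_eq_left ((min_le_right _ _).trans (by linarith))]

theorem abs_cutoff_sub_le (R : ℝ) (x y : E) : |cutoff R x - cutoff R y| ≤ ‖x - y‖ := by
  have h1 : |cutoff R x - cutoff R y| ≤ |(R + 1 - ‖x‖) - (R + 1 - ‖y‖)| := by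
    have h2 := abs_max_sub_max_le_max 0 (min 1 (R + 1 - ‖x‖)) 0 (min 1 (R + 1 - ‖y‖))
    have h3 := abs_min_sub_min_le_max 1 (R + 1 - ‖x‖) 1 (R + 1 - ‖y‖)
    rw [sub_self, abs_zero, max_eq_right (abs_nonneg (min 1 (R + 1 - ‖x‖) - _))] at h2
    rw [sub_self, abs_zero, max_eq_right (abs_nonneg (R + 1 - ‖x‖ - _))] at h3
    exact h2.trans h3
  refine h1.trans ?_
  rw [show (R + 1 - ‖x‖) - (R + 1 - ‖y‖) = ‖y‖ - ‖x‖ by ring, norm_sub_rev]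
  exact abs_norm_sub_norm_le _ _

/-- The variation of the cutoff contributes K(R + 1), its slope being at most 1 and `f` at most K(R
+ 1) on the ball; the variation of `f` contributes K. If only one point lies in the ball, symmetry
lets it be the first. -/
theorem cutoff_smul_lipschitz {R : ℝ} (hR : 0 ≤ R) {f : E → E} {K : ℝ≥0} (h0 : f 0 = 0)
    (hf : ∀ x y, ‖x‖ ≤ R + 1 → ‖y‖ ≤ R + 1 → ‖f x - f y‖ ≤ K * ‖x - y‖) :
    LipschitzWith (K * ⟨R + 2, by linarith⟩) fun x => cutoff R x • f x := by
  have hb : ∀ x, ‖x‖ ≤ R + 1 → ‖f x‖ ≤ K * (R + 1) := by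
    intro x hx
    have := hf x 0 hx (by simpa using by linarith)
    rw [h0, sub_zero, sub_zero] at this
    exact this.trans (by gcongr)
  have key : ∀ x y, ‖x‖ ≤ R + 1 →
      ‖cutoff R x • f x - cutoff R y • f y‖ ≤ K * (R + 2) * ‖x - y‖ := by
    intro x y hx
    have e : cutoff R x • f x - cutoff R y • f y
        = (cutoff R x - cutoff R y) • f x + cutoff R y • (f x - f y) := by
      rw [sub_smul, smul_sub]; abel
    have h1 : ‖(cutoff R x - cutoff R y) • f x‖ ≤ ‖x - y‖ * (K * (R + 1)) := by
      rw [norm_smul, Real.norm_eq_abs]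
      exact mul_le_mul (abs_cutoff_sub_le R x y) (hb x hx) (norm_nonneg _) (norm_nonneg _)
    have h2 : ‖cutoff R y • (f x - f y)‖ ≤ K * ‖x - y‖ := by
      rw [norm_smul, Real.norm_of_nonneg (cutoff_nonneg R y)]
      rcases le_total ‖y‖ (R + 1) with hy | hy
      · calc _ ≤ 1 * ‖f x - f y‖ := by gcongr; exact cutoff_le_one R y
          _ ≤ _ := by rw [one_mul]; exact hf x y hx hy
      · rw [cutoff_eq_zero hy, zero_mul]
        positivity
    rw [e]
    refine (norm_add_le _ _).trans ((add_le_add h1 h2).trans (le_of_eq ?_))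
    ring
  refine LipschitzWith.of_dist_le_mul fun x y => ?_
  rw [dist_eq_norm, dist_eq_norm]
  change _ ≤ (K : ℝ) * (R + 2) * _
  rcases le_total ‖x‖ (R + 1) with hx | hx
  · exact key x y hx
  · rcases le_total ‖y‖ (R + 1) with hy | hy
    · rw [norm_sub_rev, norm_sub_rev x y]
      exact key y x hy
    · rw [cutoff_eq_zero hx, cutoff_eq_zero hy]
      simp only [zero_smul, sub_zero, norm_zero]
      positivity

theorem norm_cutoff_smul_le {R : ℝ} {f : E → E} {K : ℝ≥0} (hR : 0 ≤ R) (h0 : f 0 = 0)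
    (hf : ∀ x y, ‖x‖ ≤ R + 1 → ‖y‖ ≤ R + 1 → ‖f x - f y‖ ≤ K * ‖x - y‖) (x : E) :
    ‖cutoff R x • f x‖ ≤ K * (R + 1) := by
  rcases le_total ‖x‖ (R + 1) with hx | hx
  · have := hf x 0 hx (by simpa using by linarith)
    rw [h0, sub_zero, sub_zero] at this
    rw [norm_smul, Real.norm_of_nonneg (cutoff_nonneg R x)]
    calc _ ≤ 1 * ‖f x‖ := by gcongr; exact cutoff_le_one R x
      _ ≤ _ := by rw [one_mul]; exact this.trans (by gcongr)
  · rw [cutoff_eq_zero hx, zero_smul, norm_zero]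
    positivity

/-- A continuity argument: if `g ≤ R + 1` on the segment from `0` to `t` forces `g t ≤ R`, then
`g ≤ R` everywhere. -/
theorem le_of_bootstrap {g : ℝ → ℝ} (hg : Continuous g) {R R' : ℝ} (hR : R < R') (h0 : g 0 ≤ R)
    (h : ∀ t, (∀ s ∈ uIcc 0 t, g s ≤ R') → g t ≤ R) (t : ℝ) : g t ≤ R := by
  by_contra! ht
  -- At the point `s` closest to 0 where `g` reaches the level `r`, one has `g ≤ R'` on the whole
  -- segment from 0 to `s`. The hypothesis then gives `g s ≤ R < r`, a contradiction.
  set r := min (g t) R' with hr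
  have hRr : R < r := lt_min ht hR
  have hcomp : IsCompact (uIcc 0 t ∩ {s | r ≤ g s}) :=
    isCompact_uIcc.inter_right (isClosed_le continuous_const hg)
  obtain ⟨s, ⟨hs, hsr⟩, hmin⟩ := hcomp.exists_isMinOn ⟨t, right_mem_uIcc, hr.le.trans (min_le_left _ _)⟩
    (continuous_abs.continuousOn)
  have hmin' : ∀ τ ∈ uIcc 0 t, r ≤ g τ → |s| ≤ |τ| := fun τ h1 h2 => hmin ⟨h1, h2⟩
  have hsub : uIcc 0 s ⊆ uIcc 0 t := uIcc_subset_uIcc_left hs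
  have hlt : ∀ τ ∈ uIcc 0 s, τ = s ∨ |τ| < |s| := by
    intro τ hτ
    rcases le_total 0 s with h1 | h1
    · rw [uIcc_of_le h1] at hτ
      rw [abs_of_nonneg h1, abs_of_nonneg hτ.1]
      exact hτ.2.eq_or_lt
    · rw [uIcc_of_ge h1] at hτ
      rw [abs_of_nonpos h1, abs_of_nonpos hτ.2]
      rcases hτ.1.eq_or_lt with h2 | h2
      · exact Or.inl h2.symm
      · exact Or.inr (by linarith)
  have hgs : g s = r := by
    have hiv := intermediate_value_uIcc (a := 0) (b := s) hg.continuousOn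
    have hmem : r ∈ uIcc (g 0) (g s) := by
      rw [uIcc_of_le (h0.trans (hRr.le.trans hsr))]
      exact ⟨h0.trans hRr.le, hsr⟩
    obtain ⟨τ, hτ, hgτ⟩ := hiv hmem
    rcases hlt τ hτ with h1 | h1
    · rw [← h1, hgτ]
    · exact absurd (hmin' τ (hsub hτ) hgτ.ge) (not_le.2 h1)
  have := h s fun τ hτ => by
    rcases hlt τ hτ with h1 | h1
    · rw [h1, hgs]
      exact min_le_right _ _
    · by_contra! h2
      exact absurd (hmin' τ (hsub hτ) ((min_le_right _ _).trans h2.le)) (not_le.2 h1)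
  linarith

/-- Global existence for a vector field which is Lipschitz on balls uniformly in time, under an a
priori bound. -/
theorem exists_global_of_bound [CompleteSpace E] {F : ℝ → E → E}
    (hF : ∀ x, Continuous fun t => F t x) (h0 : ∀ t, F t 0 = 0)
    (hlip : ∀ R : ℝ, ∃ K : ℝ≥0, ∀ t x y, ‖x‖ ≤ R → ‖y‖ ≤ R → ‖F t x - F t y‖ ≤ K * ‖x - y‖)
    {x₀ : E} {R : ℝ} (hx₀ : ‖x₀‖ ≤ R)
    (hbound : ∀ (v : ℝ → E) (t : ℝ), v 0 = x₀ →
      (∀ s ∈ uIcc 0 t, HasDerivAt v (F s (v s)) s) → ‖v t‖ ≤ R) :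
    ∃ v : ℝ → E, v 0 = x₀ ∧ ∀ t, HasDerivAt v (F t (v t)) t := by
  have hR : 0 ≤ R := (norm_nonneg _).trans hx₀
  -- The cutoff is 1 up to radius R + 1 and vanishes from R + 2 on. The margin between R and R + 1
  -- is what the continuity argument uses to show that the solution never feels the cutoff.
  obtain ⟨K, hK⟩ := hlip (R + 1 + 1)
  obtain ⟨v, hv0, hv⟩ := exists_global_of_bounded (F := fun t x => cutoff (R + 1) x • F t x)
    (B := K * ⟨R + 1 + 1, by linarith⟩) (fun x => (hF x).const_smul (cutoff (R + 1) x))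
    (fun t => cutoff_smul_lipschitz (by linarith) (h0 t) (hK t))
    (fun t x => norm_cutoff_smul_le (by linarith) (h0 t) (hK t) x) x₀
  have hcont : Continuous fun t => ‖v t‖ :=
    (continuous_iff_continuousAt.2 fun t => (hv t).continuousAt).norm
  have hle := le_of_bootstrap hcont (lt_add_one R) (by rwa [hv0]) fun t ht =>
    hbound v t hv0 fun s hs => by
      have := hv s
      rwa [cutoff_eq_one (ht s hs), one_smul] at this
  refine ⟨v, hv0, fun t => ?_⟩
  have := hv t
  rwa [cutoff_eq_one ((hle t).trans (by linarith)), one_smul] at this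

/-- Two global solutions which stay in a set where the vector field is Lipschitz separate at most
exponentially. -/
theorem dist_le_of_global {F : ℝ → E → E} {K : ℝ≥0} {s : Set E}
    (hK : ∀ t, LipschitzOnWith K (F t) s) {v w : ℝ → E} (hv : ∀ t, HasDerivAt v (F t (v t)) t)
    (hw : ∀ t, HasDerivAt w (F t (w t)) t) (hvs : ∀ t, v t ∈ s) (hws : ∀ t, w t ∈ s) (t : ℝ) :
    dist (v t) (w t) ≤ dist (v 0) (w 0) * Real.exp (K * |t|) := by
  have key : ∀ {F : ℝ → E → E} {v w : ℝ → E}, (∀ t, LipschitzOnWith K (F t) s) →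
      (∀ t, HasDerivAt v (F t (v t)) t) → (∀ t, HasDerivAt w (F t (w t)) t) →
      (∀ t, v t ∈ s) → (∀ t, w t ∈ s) → ∀ t, 0 ≤ t →
      dist (v t) (w t) ≤ dist (v 0) (w 0) * Real.exp (K * |t|) := by
    intro F v w hK hv hw hvs hws t ht
    have := dist_le_of_trajectories_ODE_of_mem (v := F) (s := fun _ => s) (a := 0) (b := t)
      (fun t _ => hK t) (HasDerivAt.continuousOn fun t _ => hv t)
      (fun t _ => (hv t).hasDerivWithinAt) (fun t _ => hvs t)
      (HasDerivAt.continuousOn fun t _ => hw t)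
      (fun t _ => (hw t).hasDerivWithinAt) (fun t _ => hws t) le_rfl t ⟨ht, le_rfl⟩
    rwa [sub_zero, ← congrArg (fun r : ℝ => (K : ℝ) * r) (abs_of_nonneg ht)] at this
  rcases le_total 0 t with ht | ht
  · exact key hK hv hw hvs hws t ht
  -- Negative times reduce to positive ones by time reversal, which replaces the field F(t, x) by
  -- -F(-t, x).
  · have hneg : ∀ {v : ℝ → E}, (∀ t, HasDerivAt v (F t (v t)) t) →
        ∀ t, HasDerivAt (fun τ => v (-τ)) (-F (-t) (v (-t))) t := by
      intro v hv t
      have := (hv (-t)).scomp t (hasDerivAt_neg t)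
      rw [neg_one_smul] at this
      exact this
    have := key (F := fun t x => -F (-t) x) (v := fun τ => v (-τ)) (w := fun τ => w (-τ))
      (fun t => LipschitzOnWith.of_dist_le_mul fun x hx y hy => by
        rw [dist_neg_neg]
        exact (hK (-t)).dist_le_mul x hx y hy)
      (hneg hv) (hneg hw) (fun t => hvs _) (fun t => hws _) (-t) (by linarith)
    simpa using this

end GlobalODE
end

noncomputable section
-- Fourier series in L² and a coefficient criterion for weak derivatives
namespace Torus
open ComplexConjugate Filter Topology
set_option linter.unusedSectionVars false
variable {L : ℝ} [Fact (0 < L)]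

/-- The wave number `2πn / L`. -/
def waveNumber (L : ℝ) (n : ℤ) : ℝ := 2 * Real.pi / L * n

/-- The exponential `e^{2πinx/L}` as an element of `L²`. -/
def wave (L : ℝ) [Fact (0 < L)] (n : ℤ) : L2 L :=
  (memLp_of_continuous (fourier n).continuous).toLp (fourier n)

/-- The (unnormalized) Fourier coefficient `∫ u(x) e^{-2πinx/L} dx`. -/
def fc (u : L2 L) (n : ℤ) : ℂ := ∫ x, u x * fourier (-n) x

theorem inner_toLp (u : L2 L) {φ : AddCircle L → ℂ} (h : Continuous φ) :
    inner ℂ ((memLp_of_continuous h).toLp φ) u = ∫ x, u x * conj (φ x) := by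
  rw [L2.inner_def]
  refine integral_congr_ae ?_
  filter_upwards [(memLp_of_continuous h).coeFn_toLp] with x hx
  rw [hx, RCLike.inner_apply]

theorem fc_eq_inner (u : L2 L) (n : ℤ) : fc u n = inner ℂ (wave L n) u := by
  rw [wave, inner_toLp u (fourier n).continuous, fc]
  simp only [fourier_neg]

theorem period_pos (L : ℝ) [h : Fact (0 < L)] : 0 < L := h.out

/-- The exponentials are orthonormal for the Haar probability measure; Lebesgue measure here has
total mass L, which is the factor that appears. -/
theorem inner_wave (m n : ℤ) : inner ℂ (wave L m) (wave L n) = if m = n then (L : ℂ) else 0 := by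
  have h0 := period_pos L
  have h1 := orthonormal_iff_ite.1 (orthonormal_fourier (T := L)) m n
  rw [L2.inner_def] at h1
  have h2 : ∫ x, inner ℂ (fourierLp 2 m x) (fourierLp 2 n x) ∂(AddCircle.haarAddCircle (T := L))
      = ∫ x, fourier n x * conj (fourier m x) ∂(AddCircle.haarAddCircle (T := L)) := by
    refine integral_congr_ae ?_
    filter_upwards [coeFn_fourierLp (T := L) 2 m, coeFn_fourierLp (T := L) 2 n] with x hx hy
    rw [hx, hy, RCLike.inner_apply]
  have h3 : inner ℂ (wave L m) (wave L n)
      = ∫ x : AddCircle L, fourier n x * conj (fourier m x) := by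
    rw [wave, inner_toLp _ (fourier m).continuous]
    refine integral_congr_ae ?_
    filter_upwards [(memLp_of_continuous (fourier n : C(AddCircle L, ℂ)).continuous).coeFn_toLp]
      with x hx
    rw [wave, hx]
  rw [h2, AddCircle.integral_haarAddCircle] at h1
  rw [h3]
  rw [inv_smul_eq_iff₀ h0.ne'] at h1
  rw [h1]
  split_ifs <;> simp

/-- Trigonometric polynomials are dense in the continuous functions, and these are dense in L². -/
theorem span_wave_closure_eq_top :
    (Submodule.span ℂ (Set.range (wave L))).topologicalClosure = ⊤ := by
  have h := (ContinuousMap.toLp_denseRange ℂ (volume : Measure (AddCircle L)) ℂ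
    (p := 2) (by simp)).topologicalClosure_map_submodule span_fourier_closure_eq_top
  have e := Submodule.map_span
    (ContinuousMap.toLp 2 (volume : Measure (AddCircle L)) ℂ : C(AddCircle L, ℂ) →L[ℂ] _).toLinearMap
    (Set.range (@fourier L))
  rw [← Set.range_comp] at e
  exact (congrArg Submodule.topologicalClosure e).symm.trans h

theorem sqrt_inv_mul_self : ((Real.sqrt L)⁻¹ : ℂ) * ((Real.sqrt L)⁻¹ : ℂ) = (L : ℂ)⁻¹ := by
  rw [← mul_inv, ← Complex.ofReal_mul, Real.mul_self_sqrt (period_pos L).le]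

/-- The normalized exponentials, multiplied by phases. -/
def phaseWave (L : ℝ) [Fact (0 < L)] (θ : ℤ → ℝ) (n : ℤ) : L2 L :=
  (Complex.exp (Complex.I * θ n) * (Real.sqrt L : ℂ)⁻¹) • wave L n

theorem orthonormal_phaseWave (θ : ℤ → ℝ) : Orthonormal ℂ (phaseWave L θ) := by
  have h0 : (L : ℂ) ≠ 0 := by exact_mod_cast (period_pos L).ne'
  rw [orthonormal_iff_ite]
  intro m n
  rw [phaseWave, phaseWave, inner_smul_left, inner_smul_right, inner_wave]
  split_ifs with h
  · subst h
    have h1 : conj (Complex.exp (Complex.I * θ m)) * Complex.exp (Complex.I * θ m) = 1 := by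
      rw [← Complex.exp_conj, ← Complex.exp_add]
      simp
    rw [map_mul, map_inv₀, Complex.conj_ofReal]
    calc _ = (conj (Complex.exp (Complex.I * θ m)) * Complex.exp (Complex.I * θ m))
          * ((Real.sqrt L : ℂ)⁻¹ * (Real.sqrt L : ℂ)⁻¹) * L := by ring
      _ = 1 := by rw [h1, sqrt_inv_mul_self, one_mul, inv_mul_cancel₀ h0]
  · simp

/-- The normalized exponentials, multiplied by phases, form a Hilbert basis of `L²`. -/
def phaseBasis (L : ℝ) [Fact (0 < L)] (θ : ℤ → ℝ) : HilbertBasis ℤ ℂ (L2 L) :=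
  HilbertBasis.mk (orthonormal_phaseWave θ) (by
    have h2 : (Real.sqrt L : ℂ) ≠ 0 := by
      simpa using (Real.sqrt_pos.2 (period_pos L)).ne'
    have h3 : Submodule.span ℂ (Set.range (wave L)) ≤
        Submodule.span ℂ (Set.range (phaseWave L θ)) := by
      rw [Submodule.span_le]
      rintro _ ⟨n, rfl⟩
      have : wave L n = (Complex.exp (Complex.I * θ n) * (Real.sqrt L : ℂ)⁻¹)⁻¹
          • phaseWave L θ n := by
        rw [phaseWave, smul_smul, inv_mul_cancel₀, one_smul]
        exact mul_ne_zero (Complex.exp_ne_zero _) (inv_ne_zero h2)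
      rw [this]
      exact Submodule.smul_mem _ _ (Submodule.subset_span ⟨n, rfl⟩)
    rw [← span_wave_closure_eq_top (L := L)]
    exact Submodule.topologicalClosure_mono h3)

theorem phaseBasis_repr (θ : ℤ → ℝ) (u : L2 L) (n : ℤ) :
    (phaseBasis L θ).repr u n
      = Complex.exp (-(Complex.I * θ n)) * (Real.sqrt L : ℂ)⁻¹ * fc u n := by
  rw [HilbertBasis.repr_apply_apply, phaseBasis, HilbertBasis.coe_mk, phaseWave, inner_smul_left,
    fc_eq_inner, map_mul, ← Complex.exp_conj]
  simp

/-- The Fourier multiplier with symbol `e^{iθₙ}`. -/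
def multiplier (L : ℝ) [Fact (0 < L)] (θ : ℤ → ℝ) : L2 L ≃ₗᵢ[ℂ] L2 L :=
  -- Keeping the coordinates while replacing the plain basis by the phased one multiplies the n-th
  -- coefficient by e^{iθₙ}; unitarity is then automatic.
  (phaseBasis L 0).repr.trans (phaseBasis L θ).repr.symm

theorem fc_multiplier (θ : ℤ → ℝ) (u : L2 L) (n : ℤ) :
    fc (multiplier L θ u) n = Complex.exp (Complex.I * θ n) * fc u n := by
  have h2 : (Real.sqrt L : ℂ) ≠ 0 := by
    simpa using (Real.sqrt_pos.2 (period_pos L)).ne'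
  have h1 : (phaseBasis L θ).repr (multiplier L θ u) = (phaseBasis L 0).repr u := by
    simp [multiplier]
  have h := congrArg (fun f => f n) h1
  simp only [phaseBasis_repr] at h
  rw [Complex.exp_neg] at h
  have h3 := Complex.exp_ne_zero (Complex.I * θ n)
  field_simp at h
  simpa using h

theorem hasSum_wave (u : L2 L) : HasSum (fun n => ((L : ℂ)⁻¹ * fc u n) • wave L n) u := by
  have e : (fun n => ((L : ℂ)⁻¹ * fc u n) • wave L n)
      = fun n => (phaseBasis L 0).repr u n • phaseBasis L 0 n := by
    ext1 n
    rw [phaseBasis_repr, phaseBasis, HilbertBasis.coe_mk, phaseWave, smul_smul,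
      ← sqrt_inv_mul_self]
    congr 1
    simp
    ring
  rw [e]
  exact (phaseBasis L 0).hasSum_repr u

theorem hasSum_inner_fc (u v : L2 L) :
    HasSum (fun n => conj (fc u n) * fc v n) (L * inner ℂ u v) := by
  have h := (hasSum_wave v).mapL (innerSL ℂ u) |>.mul_left (L : ℂ)
  have h0 : (L : ℂ) ≠ 0 := by exact_mod_cast (period_pos L).ne'
  have e : (fun n => conj (fc u n) * fc v n)
      = fun n => (L : ℂ) * innerSL ℂ u (((L : ℂ)⁻¹ * fc v n) • wave L n) := by
    ext1 n
    rw [innerSL_apply_apply, inner_smul_right, ← inner_conj_symm u, ← fc_eq_inner]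
    field_simp
  rw [e]
  exact h

theorem hasSum_sq_fc (u : L2 L) : HasSum (fun n => ‖fc u n‖ ^ 2) (L * ‖u‖ ^ 2) := by
  have h := hasSum_inner_fc u u
  rw [inner_self_eq_norm_sq_to_K] at h
  have h2 := Complex.hasSum_re h
  simp only [Complex.coe_algebraMap] at h2
  convert h2 using 1
  · ext n
    rw [← Complex.normSq_eq_conj_mul_self, Complex.ofReal_re, Complex.normSq_eq_norm_sq]
  · rw [← Complex.ofReal_pow, ← Complex.ofReal_mul, Complex.ofReal_re]

theorem fc_injective {u v : L2 L} (h : ∀ n, fc u n = fc v n) : u = v := by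
  have h1 := hasSum_wave u
  simp only [h] at h1
  exact h1.unique (hasSum_wave v)

/-- The Fourier coefficient as a continuous functional. -/
def fcL (n : ℤ) : L2 L →L[ℂ] ℂ := innerSL ℂ (wave L n)

theorem fcL_apply (n : ℤ) (u : L2 L) : fcL n u = fc u n := by
  rw [fcL, innerSL_apply_apply, fc_eq_inner]

theorem fc_add (u v : L2 L) (n : ℤ) : fc (u + v) n = fc u n + fc v n := by
  simp only [← fcL_apply, map_add]

theorem fc_smul (c : ℂ) (u : L2 L) (n : ℤ) : fc (c • u) n = c * fc u n := by
  simp only [← fcL_apply, map_smul, smul_eq_mul]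

theorem fc_wave (m n : ℤ) : fc (wave L m) n = if n = m then (L : ℂ) else 0 := by
  rw [fc_eq_inner, inner_wave]

theorem isSmooth_fourier (n : ℤ) : IsSmooth (fourier n : AddCircle L → ℂ) := by
  have h := isSmooth_const_mul_fourier (L := L) 1 n
  simp only [one_mul] at h
  exact h

theorem circleDeriv_fourier (n : ℤ) (x : AddCircle L) :
    circleDeriv (fourier n) x = Complex.I * waveNumber L n * fourier n x := by
  induction x using QuotientAddGroup.induction_on with
  | H x =>
    have := (hasDerivAt_fourier L n x).deriv
    change circleDeriv (fourier n) (x : AddCircle L) = _ * fourier n (x : AddCircle L)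
    rw [circleDeriv_coe, this, waveNumber]
    push_cast
    ring

theorem HasWeakDeriv.fc_eq {u v : L2 L} (h : HasWeakDeriv u v) (n : ℤ) :
    fc v n = Complex.I * waveNumber L n * fc u n := by
  have h1 := h _ (isSmooth_fourier (-n))
  rw [fc, ← neg_eq_iff_eq_neg.2 h1, fc, ← integral_const_mul, ← integral_neg]
  congr 1
  ext x
  rw [circleDeriv_fourier, waveNumber, waveNumber]
  push_cast
  ring

theorem isSmooth_conj {φ : AddCircle L → ℂ} (h : IsSmooth φ) : IsSmooth fun x => conj (φ x) :=
  ContDiff.comp (𝕜 := ℝ) Complex.conjCLE.contDiff h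

theorem circleDeriv_conj (φ : AddCircle L → ℂ) (x : AddCircle L) :
    circleDeriv (fun y => conj (φ y)) x = conj (circleDeriv φ x) := by
  simp only [circleDeriv]
  exact deriv.star (f := fun s : ℝ => φ (x + (s : AddCircle L))) (x := 0)

theorem integral_mul_eq_inner (u : L2 L) {φ : AddCircle L → ℂ} (h : Continuous φ) :
    ∫ x, u x * φ x
      = inner ℂ ((memLp_of_continuous (Complex.continuous_conj.comp h)).toLp
          (fun x => conj (φ x))) u := by
  have := inner_toLp u (φ := fun x => conj (φ x)) (Complex.continuous_conj.comp h)
  simp only [Complex.conj_conj] at this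
  exact this.symm

/-- By Parseval both pairings become sums over coefficients. The conjugate of a test function lies
in H¹, so the coefficients of its derivative are known, and the two sums agree term by term up to
sign. -/
theorem hasWeakDeriv_of_fc {u v : L2 L}
    (h : ∀ n, fc v n = Complex.I * waveNumber L n * fc u n) : HasWeakDeriv u v := by
  intro φ hφ
  have h0 : (L : ℂ) ≠ 0 := by exact_mod_cast (period_pos L).ne'
  rw [integral_mul_eq_inner _ hφ.continuous_circleDeriv, integral_mul_eq_inner _ hφ.continuous]
  have hw := (H1.ofSmooth _ (isSmooth_conj hφ)).2
  have hc := HasWeakDeriv.fc_eq hw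
  have e : (memLp_of_continuous (Complex.continuous_conj.comp hφ.continuous_circleDeriv)).toLp
      (fun x => conj (circleDeriv φ x)) = (H1.ofSmooth _ (isSmooth_conj hφ)).dx := by
    refine MemLp.toLp_congr _ (memLp_of_continuous (isSmooth_conj hφ).continuous_circleDeriv)
      (Eventually.of_forall fun x => ?_)
    exact (circleDeriv_conj φ x).symm
  rw [e]
  change inner ℂ (H1.ofSmooth _ (isSmooth_conj hφ)).dx u
    = - inner ℂ (H1.ofSmooth _ (isSmooth_conj hφ)).val v
  have h1 := hasSum_inner_fc (H1.ofSmooth _ (isSmooth_conj hφ)).dx u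
  have h2 := (hasSum_inner_fc (H1.ofSmooth _ (isSmooth_conj hφ)).val v).neg
  have e2 : (fun n => conj (fc (H1.ofSmooth _ (isSmooth_conj hφ)).dx n) * fc u n)
      = fun n => -(conj (fc (H1.ofSmooth _ (isSmooth_conj hφ)).val n) * fc v n) := by
    ext1 n
    have : fc (H1.ofSmooth _ (isSmooth_conj hφ)).dx n = _ := hc n
    rw [this, h]
    change conj (_ * fc (H1.ofSmooth _ (isSmooth_conj hφ)).val n) * _ = _
    simp only [map_mul, Complex.conj_I, Complex.conj_ofReal]
    ring
  rw [e2] at h1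
  have h3 := h1.unique h2
  rw [← mul_neg] at h3
  exact mul_left_cancel₀ h0 h3

theorem hasWeakDeriv_iff_fc {u v : L2 L} :
    HasWeakDeriv u v ↔ ∀ n, fc v n = Complex.I * waveNumber L n * fc u n :=
  ⟨HasWeakDeriv.fc_eq, hasWeakDeriv_of_fc⟩

/-- By the coefficient criterion, H¹ is cut out of L² × L² by countably many closed linear
conditions. Completeness of H¹ follows. -/
theorem isClosed_sobolev : IsClosed (sobolev L : Set (WithLp 2 (L2 L × L2 L))) := by
  have e : (sobolev L : Set (WithLp 2 (L2 L × L2 L)))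
      = ⋂ n : ℤ, {w | fcL n (WithLp.sndL 2 ℂ (L2 L) (L2 L) w)
          = Complex.I * waveNumber L n * fcL n (WithLp.fstL 2 ℂ (L2 L) (L2 L) w)} := by
    ext w
    simp only [Set.mem_iInter, Set.mem_ofPred_eq, fcL_apply]
    exact hasWeakDeriv_iff_fc
  rw [e]
  refine isClosed_iInter fun n => isClosed_eq ?_ ?_ <;> fun_prop

instance H1.instCompleteSpace : CompleteSpace (H1 L) :=
  isClosed_sobolev.completeSpace_coe

/-! ### Calculus in H¹ and density of trigonometric polynomials -/

namespace H1

instance instNormedAddCommGroup : NormedAddCommGroup (H1 L) := inferInstance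

instance instNormedSpaceComplex : NormedSpace ℂ (H1 L) := inferInstance

instance instNormedSpaceReal : NormedSpace ℝ (H1 L) := inferInstance

instance instModuleComplex : Module ℂ (H1 L) := inferInstance

instance instModuleReal : Module ℝ (H1 L) := inferInstance

/-- `H1.val` as a continuous linear map. -/
def valL : H1 L →L[ℂ] L2 L := WithLp.fstL 2 ℂ (L2 L) (L2 L) ∘L (sobolev L).subtypeL

/-- `H1.dx` as a continuous linear map. -/
def dxL : H1 L →L[ℂ] L2 L := WithLp.sndL 2 ℂ (L2 L) (L2 L) ∘L (sobolev L).subtypeL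

theorem valL_apply (u : H1 L) : valL u = u.val := rfl

theorem dxL_apply (u : H1 L) : dxL u = u.dx := rfl

theorem continuous_val : Continuous (H1.val : H1 L → L2 L) := valL.continuous

theorem continuous_dx : Continuous (H1.dx : H1 L → L2 L) := dxL.continuous

@[simp] theorem val_add (u v : H1 L) : (u + v).val = u.val + v.val := rfl

@[simp] theorem dx_add (u v : H1 L) : (u + v).dx = u.dx + v.dx := rfl

@[simp] theorem val_sub (u v : H1 L) : (u - v).val = u.val - v.val := rfl

@[simp] theorem dx_sub (u v : H1 L) : (u - v).dx = u.dx - v.dx := rfl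

@[simp] theorem val_smul (c : ℂ) (u : H1 L) : (c • u).val = c • u.val := rfl

@[simp] theorem dx_smul (c : ℂ) (u : H1 L) : (c • u).dx = c • u.dx := rfl

/-- An element of `H¹` from a function and its weak derivative. -/
def mk (u v : L2 L) (h : HasWeakDeriv u v) : H1 L := ⟨WithLp.toLp 2 (u, v), h⟩

@[simp] theorem val_mk {u v : L2 L} (h : HasWeakDeriv u v) : (mk u v h).val = u := rfl

@[simp] theorem dx_mk {u v : L2 L} (h : HasWeakDeriv u v) : (mk u v h).dx = v := rfl

theorem hasWeakDeriv (u : H1 L) : HasWeakDeriv u.val u.dx := u.2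

theorem fc_dx (u : H1 L) (n : ℤ) : fc u.dx n = Complex.I * waveNumber L n * fc u.val n :=
  u.hasWeakDeriv.fc_eq n

theorem ext_val {u v : H1 L} (h : u.val = v.val) : u = v := by
  have h2 : u.dx = v.dx := fc_injective fun n => by rw [fc_dx, fc_dx, h]
  refine Subtype.ext ?_
  have : ∀ w : WithLp 2 (L2 L × L2 L), w = WithLp.toLp 2 (w.fst, w.snd) := fun w => rfl
  rw [this u.1, this v.1]
  exact congrArg₂ (fun a b => WithLp.toLp 2 (a, b)) h h2

theorem ext_fc {u v : H1 L} (h : ∀ n, fc u.val n = fc v.val n) : u = v :=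
  ext_val (fc_injective h)

theorem norm_sq (u : H1 L) : ‖u‖ ^ 2 = ‖u.val‖ ^ 2 + ‖u.dx‖ ^ 2 :=
  WithLp.prod_norm_sq_eq_of_L2 u.1

theorem norm_val_le (u : H1 L) : ‖u.val‖ ≤ ‖u‖ := WithLp.norm_fst_le (p := 2) _ u.1

theorem norm_dx_le (u : H1 L) : ‖u.dx‖ ≤ ‖u‖ := WithLp.norm_snd_le (p := 2) _ u.1

theorem norm_le_add (u : H1 L) : ‖u‖ ≤ ‖u.val‖ + ‖u.dx‖ := by
  refine le_of_sq_le_sq ?_ (by positivity)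
  rw [norm_sq]
  nlinarith [norm_nonneg u.val, norm_nonneg u.dx]

theorem isEmbedding_val_dx :
    IsInducing fun u : H1 L => (u.val, u.dx) :=
  (WithLp.homeomorphProd 2 (L2 L) (L2 L)).isInducing.comp IsInducing.subtypeVal

/-- The exponential `e^{2πinx/L}` as an element of `H¹`. -/
def expo (L : ℝ) [Fact (0 < L)] (n : ℤ) : H1 L := ofSmooth (fourier n) (isSmooth_fourier n)

@[simp] theorem val_expo (n : ℤ) : (expo L n).val = wave L n := rfl

theorem dx_expo (n : ℤ) : (expo L n).dx = (Complex.I * waveNumber L n) • wave L n := by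
  refine fc_injective fun m => ?_
  rw [fc_dx, val_expo, fc_smul, fc_wave]
  split_ifs with h
  · rw [h]
  · simp

/-- The topology of H¹ is induced by the pair (function, derivative), and the Fourier series of both
components converge in L². -/
theorem hasSum_expo (u : H1 L) :
    HasSum (fun n => ((L : ℂ)⁻¹ * fc u.val n) • expo L n) u := by
  have h2 : HasSum (fun n => (((L : ℂ)⁻¹ * fc u.val n) • expo L n).dx) u.dx := by
    have := hasSum_wave u.dx
    simp only [fc_dx] at this
    simp only [dx_smul, dx_expo, smul_smul]
    convert this using 3
    ring
  have h := (hasSum_wave u.val).prodMk h2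
  have hi := isEmbedding_val_dx (L := L)
  unfold HasSum at h ⊢
  rw [hi.tendsto_nhds_iff]
  convert h using 2 with s
  exact Prod.ext
    ((map_sum (valL (L := L)) _ s).trans (by rw [Prod.fst_sum]; rfl))
    ((map_sum (dxL (L := L)) _ s).trans (by rw [Prod.snd_sum]; rfl))

/-- This reduces the product rule and the weak form of the free equation to a computation on
exponentials. -/
theorem clm_ext {F : Type*} [NormedAddCommGroup F] [NormedSpace ℂ F] {f g : H1 L →L[ℂ] F}
    (h : ∀ n, f (expo L n) = g (expo L n)) : f = g := by
  ext u
  have h1 := (hasSum_expo u).mapL f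
  have h2 := (hasSum_expo u).mapL g
  simp only [map_smul, h] at h1 h2
  exact h1.unique h2

end H1

/-! ### The Sobolev embedding -/

/-- The constant `∑ₙ 1 / (A² + (2πn/L)²)`. -/
def embConst (L A : ℝ) : ℝ := ∑' n : ℤ, 1 / (A ^ 2 + waveNumber L n ^ 2)

theorem summable_embConst {A : ℝ} (hA : 0 < A) :
    Summable fun n : ℤ => 1 / (A ^ 2 + waveNumber L n ^ 2) := by
  have hk : 0 < 2 * Real.pi / L := div_pos Real.two_pi_pos (period_pos L)
  have h1 : Summable fun n : ℤ => ((2 * Real.pi / L) ^ 2)⁻¹ * (1 / (n : ℝ) ^ 2) :=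
    (Real.summable_one_div_int_pow.2 (by norm_num)).mul_left _
  refine Summable.of_norm_bounded_eventually h1 ?_
  have : ∀ᶠ n : ℤ in cofinite, n ≠ 0 := (Set.finite_singleton (0 : ℤ)).compl_mem_cofinite
  filter_upwards [this] with n hn
  have hn' : (n : ℝ) ≠ 0 := by exact_mod_cast hn
  rw [Real.norm_of_nonneg (by positivity), waveNumber, mul_pow, ← one_div, one_div_mul_one_div]
  refine one_div_le_one_div_of_le (by positivity) ?_
  nlinarith [sq_nonneg A]

theorem embConst_nonneg (A : ℝ) : 0 ≤ embConst L A := tsum_nonneg fun n => by positivity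

/-- Dominated convergence, with the series at A = 1 as majorant. The decay makes the sup norm cost
an arbitrarily small multiple of the derivative, which yields global solutions in the focusing case
without smallness of the data. -/
theorem tendsto_embConst : Tendsto (embConst L) atTop (𝓝 0) := by
  have h : Tendsto (embConst L) atTop (𝓝 (∑' _ : ℤ, (0 : ℝ))) := by
    refine tendsto_tsum_of_dominated_convergence (summable_embConst (L := L) one_pos) ?_ ?_
    · intro n
      simp only [one_div]
      exact (tendsto_atTop_add_const_right _ _ (tendsto_pow_atTop two_ne_zero)).inv_tendsto_atTop
    · filter_upwards [eventually_ge_atTop 1] with A hA n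
      rw [Real.norm_of_nonneg (by positivity)]
      refine one_div_le_one_div_of_le (by positivity) ?_
      nlinarith
  simpa using h

namespace H1

theorem hasSum_weighted (u : H1 L) (A : ℝ) :
    HasSum (fun n => (A ^ 2 + waveNumber L n ^ 2) * ‖fc u.val n‖ ^ 2)
      (L * (A ^ 2 * ‖u.val‖ ^ 2 + ‖u.dx‖ ^ 2)) := by
  have h := ((hasSum_sq_fc u.val).mul_left (A ^ 2)).add (hasSum_sq_fc u.dx)
  have e : (fun n => (A ^ 2 + waveNumber L n ^ 2) * ‖fc u.val n‖ ^ 2)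
      = fun n => A ^ 2 * ‖fc u.val n‖ ^ 2 + ‖fc u.dx n‖ ^ 2 := by
    ext n
    rw [fc_dx, norm_mul, norm_mul, Complex.norm_I, Complex.norm_real, mul_pow, mul_pow,
      Real.norm_eq_abs, sq_abs]
    ring
  rw [e, mul_add, mul_left_comm]
  exact h

/-- Cauchy–Schwarz with the weights A² + (2πn/L)² and their inverses. -/
theorem sum_norm_fc_le (u : H1 L) {A : ℝ} (hA : 0 < A) (s : Finset ℤ) :
    ∑ n ∈ s, ‖fc u.val n‖
      ≤ Real.sqrt (embConst L A * (L * (A ^ 2 * ‖u.val‖ ^ 2 + ‖u.dx‖ ^ 2))) := by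
  refine Real.le_sqrt_of_sq_le ?_
  refine (Finset.sum_sq_le_sum_mul_sum_of_sq_le_mul s
    (f := fun n => 1 / (A ^ 2 + waveNumber L n ^ 2))
    (g := fun n => (A ^ 2 + waveNumber L n ^ 2) * ‖fc u.val n‖ ^ 2)
    (fun n _ => by positivity) (fun n _ => by positivity) fun n _ => ?_).trans ?_
  · have : A ^ 2 + waveNumber L n ^ 2 ≠ 0 := by positivity
    refine le_of_eq ?_
    field_simp
  · refine mul_le_mul ((summable_embConst hA).sum_le_tsum _ fun n _ => by positivity)
      (sum_le_hasSum _ (fun n _ => by positivity) (hasSum_weighted u A))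
      (Finset.sum_nonneg fun n _ => by positivity) (embConst_nonneg A)

theorem summable_norm_fc (u : H1 L) : Summable fun n => ‖fc u.val n‖ :=
  summable_of_sum_le (fun _ => norm_nonneg _) (sum_norm_fc_le u one_pos)

theorem norm_term (u : H1 L) (n : ℤ) :
    ‖((L : ℂ)⁻¹ * fc u.val n) • (fourier n : C(AddCircle L, ℂ))‖ = L⁻¹ * ‖fc u.val n‖ := by
  rw [norm_smul, fourier_norm, norm_mul, norm_inv, Complex.norm_real,
    Real.norm_of_nonneg (period_pos L).le, mul_one]

theorem summable_term (u : H1 L) :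
    Summable fun n => ((L : ℂ)⁻¹ * fc u.val n) • (fourier n : C(AddCircle L, ℂ)) := by
  refine Summable.of_norm ?_
  simp only [norm_term]
  exact (summable_norm_fc u).mul_left _

theorem norm_tsum_term_le (u : H1 L) {A : ℝ} (hA : 0 < A) :
    ‖∑' n, ((L : ℂ)⁻¹ * fc u.val n) • (fourier n : C(AddCircle L, ℂ))‖
      ≤ L⁻¹ * Real.sqrt (embConst L A * (L * (A ^ 2 * ‖u.val‖ ^ 2 + ‖u.dx‖ ^ 2))) := by
  have h0 := period_pos L
  have h1 : Summable fun n => ‖((L : ℂ)⁻¹ * fc u.val n) • (fourier n : C(AddCircle L, ℂ))‖ := by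
    simp only [norm_term]
    exact (summable_norm_fc u).mul_left _
  refine (norm_tsum_le_tsum_norm h1).trans ?_
  simp only [norm_term]
  rw [tsum_mul_left]
  gcongr
  exact (summable_norm_fc u).tsum_le_of_sum_le (sum_norm_fc_le u hA)

/-- The Sobolev embedding of `H¹` into the continuous functions. -/
def toC : H1 L →L[ℂ] C(AddCircle L, ℂ) :=
  LinearMap.mkContinuous
    { toFun := fun u => ∑' n, ((L : ℂ)⁻¹ * fc u.val n) • (fourier n : C(AddCircle L, ℂ))
      map_add' := fun u v => by
        rw [← (summable_term u).tsum_add (summable_term v)]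
        congr 1
        ext1 n
        rw [val_add, fc_add, mul_add, add_smul]
      map_smul' := fun c u => by
        rw [RingHom.id_apply, ← (summable_term u).tsum_const_smul]
        congr 1
        ext1 n
        rw [val_smul, fc_smul, smul_smul]
        congr 1
        ring }
    (L⁻¹ * Real.sqrt (embConst L 1 * L))
    (fun u => by
      refine (norm_tsum_term_le u one_pos).trans_eq ?_
      rw [one_pow, one_mul, ← norm_sq, ← mul_assoc, Real.sqrt_mul' _ (sq_nonneg _),
        Real.sqrt_sq (norm_nonneg u), mul_assoc])

theorem hasSum_toC (u : H1 L) :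
    HasSum (fun n => ((L : ℂ)⁻¹ * fc u.val n) • (fourier n : C(AddCircle L, ℂ))) (toC u) :=
  (summable_term u).hasSum

theorem norm_toC_sq_le (u : H1 L) {A : ℝ} (hA : 0 < A) :
    ‖toC u‖ ^ 2 ≤ embConst L A / L * (A ^ 2 * ‖u.val‖ ^ 2 + ‖u.dx‖ ^ 2) := by
  have h0 := period_pos L
  have h := pow_le_pow_left₀ (norm_nonneg _) (norm_tsum_term_le u hA) 2
  refine h.trans_eq ?_
  have := embConst_nonneg (L := L) A
  rw [mul_pow, Real.sq_sqrt (by positivity)]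
  field_simp

theorem toLp_toC (u : H1 L) :
    ContinuousMap.toLp 2 (volume : Measure (AddCircle L)) ℂ (toC u) = u.val := by
  have h := (hasSum_toC u).mapL (ContinuousMap.toLp 2 (volume : Measure (AddCircle L)) ℂ)
  simp only [map_smul] at h
  exact h.unique (hasSum_wave u.val)

theorem val_ae (u : H1 L) : u.val =ᵐ[volume] toC u := by
  have h := ContinuousMap.coeFn_toLp (p := 2) (𝕜 := ℂ) (volume : Measure (AddCircle L)) (toC u)
  rwa [toLp_toC] at h

theorem toC_injective : Function.Injective (toC : H1 L → C(AddCircle L, ℂ)) := by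
  intro u v h
  refine ext_val ?_
  rw [← toLp_toC, ← toLp_toC, h]

/-- Continuous functions that agree almost everywhere are equal, as the measure charges every
nonempty open set. Pointwise formulas for the operations on H¹ are obtained this way. -/
theorem toC_eq_of_ae {u : H1 L} {f : C(AddCircle L, ℂ)} (h : u.val =ᵐ[volume] f) : toC u = f := by
  have := (Continuous.ae_eq_iff_eq volume (toC u).continuous f.continuous).1
    ((val_ae u).symm.trans h)
  exact DFunLike.coe_injective this

theorem toC_expo (n : ℤ) : toC (expo L n) = fourier n :=
  toC_eq_of_ae (memLp_of_continuous (fourier n).continuous).coeFn_toLp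

theorem toC_ofSmooth {φ : AddCircle L → ℂ} (h : IsSmooth φ) (x : AddCircle L) :
    toC (ofSmooth φ h) x = φ x := by
  have := toC_eq_of_ae (u := ofSmooth φ h) (f := ⟨φ, h.continuous⟩)
    (memLp_of_continuous h.continuous).coeFn_toLp
  rw [this]
  rfl

theorem fc_eq_toC (u : H1 L) (n : ℤ) : fc u.val n = ∫ x, toC u x * fourier (-n) x := by
  refine integral_congr_ae ?_
  filter_upwards [val_ae u] with x hx
  rw [hx]

theorem inner_val (u v : H1 L) : inner ℂ u.val v.val = ∫ x, toC v x * conj (toC u x) := by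
  rw [L2.inner_def]
  refine integral_congr_ae ?_
  filter_upwards [val_ae u, val_ae v] with x hx hy
  rw [hx, hy, RCLike.inner_apply]

end H1

/-! ### H¹ as an algebra, conjugation and the cubic nonlinearity -/

theorem memLp_mul (f : C(AddCircle L, ℂ)) (g : L2 L) :
    MemLp (fun x => f x * g x) 2 (volume : Measure (AddCircle L)) :=
  (Lp.memLp g).of_le_mul (c := ‖f‖)
    (f.continuous.aestronglyMeasurable.mul (Lp.aestronglyMeasurable g))
    (Eventually.of_forall fun x => by
      rw [norm_mul]
      exact mul_le_mul_of_nonneg_right (f.norm_coe_le_norm x) (norm_nonneg _))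

/-- Multiplication of a square-integrable function by a continuous function. -/
def cmul : C(AddCircle L, ℂ) →L[ℂ] L2 L →L[ℂ] L2 L :=
  LinearMap.mkContinuous₂
    (LinearMap.mk₂ ℂ (fun f g => (memLp_mul f g).toLp _)
      (fun f f' g => by
        refine Lp.ext ?_
        filter_upwards [(memLp_mul (f + f') g).coeFn_toLp, (memLp_mul f g).coeFn_toLp,
          (memLp_mul f' g).coeFn_toLp,
          Lp.coeFn_add ((memLp_mul f g).toLp _) ((memLp_mul f' g).toLp _)] with x h1 h2 h3 h4
        rw [h1, h4, Pi.add_apply, h2, h3, ContinuousMap.add_apply, add_mul])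
      (fun c f g => by
        refine Lp.ext ?_
        filter_upwards [(memLp_mul (c • f) g).coeFn_toLp, (memLp_mul f g).coeFn_toLp,
          Lp.coeFn_smul c ((memLp_mul f g).toLp _)] with x h1 h2 h3
        rw [h1, h3, Pi.smul_apply, h2, ContinuousMap.smul_apply, smul_mul_assoc])
      (fun f g g' => by
        refine Lp.ext ?_
        filter_upwards [(memLp_mul f (g + g')).coeFn_toLp, (memLp_mul f g).coeFn_toLp,
          (memLp_mul f g').coeFn_toLp, Lp.coeFn_add g g',
          Lp.coeFn_add ((memLp_mul f g).toLp _) ((memLp_mul f g').toLp _)] with x h1 h2 h3 h4 h5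
        rw [h1, h5, Pi.add_apply, h2, h3, h4, Pi.add_apply, mul_add])
      (fun c f g => by
        refine Lp.ext ?_
        filter_upwards [(memLp_mul f (c • g)).coeFn_toLp, (memLp_mul f g).coeFn_toLp,
          Lp.coeFn_smul c g, Lp.coeFn_smul c ((memLp_mul f g).toLp _)] with x h1 h2 h3 h4
        rw [h1, h4, Pi.smul_apply, h2, h3, Pi.smul_apply, mul_smul_comm]))
    1
    (fun f g => by
      rw [one_mul]
      refine Lp.norm_le_mul_norm_of_ae_le_mul ?_
      filter_upwards [(memLp_mul f g).coeFn_toLp] with x hx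
      rw [LinearMap.mk₂_apply, hx, norm_mul]
      exact mul_le_mul_of_nonneg_right (f.norm_coe_le_norm x) (norm_nonneg _))

theorem coeFn_cmul (f : C(AddCircle L, ℂ)) (g : L2 L) :
    cmul f g =ᵐ[volume] fun x => f x * g x :=
  (memLp_mul f g).coeFn_toLp

theorem norm_cmul_le (f : C(AddCircle L, ℂ)) (g : L2 L) : ‖cmul f g‖ ≤ ‖f‖ * ‖g‖ := by
  refine Lp.norm_le_mul_norm_of_ae_le_mul ?_
  filter_upwards [coeFn_cmul f g] with x hx
  rw [hx, norm_mul]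
  exact mul_le_mul_of_nonneg_right (f.norm_coe_le_norm x) (norm_nonneg _)

theorem waveNumber_sub (m n : ℤ) : waveNumber L (m - n) = waveNumber L m - waveNumber L n := by
  simp only [waveNumber]; push_cast; ring

theorem waveNumber_neg (n : ℤ) : waveNumber L (-n) = -waveNumber L n := by
  simp only [waveNumber]; push_cast; ring

theorem fc_cmul_fourier (m n : ℤ) (w : L2 L) : fc (cmul (fourier m) w) n = fc w (n - m) := by
  refine integral_congr_ae ?_
  filter_upwards [coeFn_cmul (fourier m) w] with x hx
  rw [hx, show -(n - m) = m + -n by ring, fourier_add]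
  ring

theorem cmul_wave (u : H1 L) (m : ℤ) :
    cmul (H1.toC u) (wave L m) = cmul (fourier m) u.val := by
  refine Lp.ext ?_
  filter_upwards [coeFn_cmul (H1.toC u) (wave L m), coeFn_cmul (fourier m) u.val, H1.val_ae u,
    (memLp_of_continuous (fourier m : C(AddCircle L, ℂ)).continuous).coeFn_toLp] with x h1 h2 h3 h4
  rw [h1, h2, h3, wave, h4, mul_comm]

/-- For fixed `u` both sides of the coefficient criterion are continuous and linear in `v`, so `v`
may be taken to be an exponential. Multiplication by an exponential shifts Fourier coefficients, and
the claim becomes additivity of wave numbers. -/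
theorem hasWeakDeriv_mul (u v : H1 L) :
    HasWeakDeriv (cmul (H1.toC u) v.val) (cmul (H1.toC u) v.dx + cmul (H1.toC v) u.dx) := by
  refine hasWeakDeriv_of_fc fun n => ?_
  have h : fcL n ∘L (cmul (H1.toC u) ∘L H1.dxL + (cmul.flip u.dx) ∘L H1.toC)
      = (Complex.I * waveNumber L n) • (fcL n ∘L cmul (H1.toC u) ∘L H1.valL) := by
    refine H1.clm_ext fun m => ?_
    simp only [ContinuousLinearMap.comp_apply, add_apply,
      smul_apply, ContinuousLinearMap.flip_apply, fcL_apply, H1.dxL_apply,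
      H1.valL_apply, H1.dx_expo, H1.val_expo, H1.toC_expo, map_smul, cmul_wave, fc_add, fc_smul,
      fc_cmul_fourier, H1.fc_dx, waveNumber_sub, smul_eq_mul]
    push_cast
    ring
  have h2 := DFunLike.congr_fun h v
  simp only [ContinuousLinearMap.comp_apply, add_apply, smul_apply, fcL_apply, map_add,
    ContinuousLinearMap.flip_apply, smul_eq_mul] at h2
  rw [fc_add]
  exact h2

namespace H1

/-- The algebra structure of `H¹`: pointwise multiplication. -/
def mul : H1 L →L[ℂ] H1 L →L[ℂ] H1 L :=
  LinearMap.mkContinuous₂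
    (LinearMap.mk₂ ℂ (fun u v => mk _ _ (hasWeakDeriv_mul u v))
      (fun u u' v => ext_val (by simp))
      (fun c u v => ext_val (by simp))
      (fun u v v' => ext_val (by simp))
      (fun c u v => ext_val (by simp)))
    -- One factor for the product in L² and two for the terms of the Leibniz rule, each pairing a
    -- sup norm with an L² norm.
    (3 * ‖(toC : H1 L →L[ℂ] C(AddCircle L, ℂ))‖)
    (fun u v => by
      have hu := (toC (L := L)).le_opNorm u
      have hv := (toC (L := L)).le_opNorm v
      have h0 := norm_nonneg (toC (L := L))
      refine (norm_le_add _).trans ?_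
      rw [LinearMap.mk₂_apply, val_mk, dx_mk]
      have h1 := norm_cmul_le (toC u) v.val
      have h2 := norm_cmul_le (toC u) v.dx
      have h3 := norm_cmul_le (toC v) u.dx
      have h4 := mul_le_mul hu (norm_val_le v) (norm_nonneg _) (by positivity)
      have h5 := mul_le_mul hu (norm_dx_le v) (norm_nonneg _) (by positivity)
      have h6 := mul_le_mul hv (norm_dx_le u) (norm_nonneg _) (by positivity)
      have h7 := norm_add_le (cmul (toC u) v.dx) (cmul (toC v) u.dx)
      linarith)

theorem val_mul (u v : H1 L) : (mul u v).val = cmul (toC u) v.val := rfl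

theorem toC_mul (u v : H1 L) : toC (mul u v) = toC u * toC v := by
  refine toC_eq_of_ae ?_
  filter_upwards [coeFn_cmul (toC u) v.val, val_ae v] with x h1 h2
  rw [val_mul, h1, h2, ContinuousMap.mul_apply]

end H1

/-- Complex conjugation on `L²`. -/
def L2.conj : L2 L →L[ℝ] L2 L :=
  ContinuousLinearMap.compLpL 2 volume (Complex.conjCLE : ℂ →L[ℝ] ℂ)

theorem L2.coeFn_conj (u : L2 L) : L2.conj u =ᵐ[volume] fun x => starRingEnd ℂ (u x) :=
  ContinuousLinearMap.coeFn_compLpL (Complex.conjCLE : ℂ →L[ℝ] ℂ) u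

theorem L2.norm_conj_le (u : L2 L) : ‖L2.conj u‖ ≤ ‖u‖ := by
  refine Lp.norm_le_norm_of_ae_le ?_
  filter_upwards [L2.coeFn_conj u] with x hx
  rw [hx, RCLike.norm_conj]

theorem fc_conj (u : L2 L) (n : ℤ) : fc (L2.conj u) n = starRingEnd ℂ (fc u (-n)) := by
  rw [fc, fc, ← integral_conj]
  refine integral_congr_ae ?_
  filter_upwards [L2.coeFn_conj u] with x hx
  rw [hx, map_mul, ← fourier_neg, neg_neg]

theorem hasWeakDeriv_conj (u : H1 L) : HasWeakDeriv (L2.conj u.val) (L2.conj u.dx) := by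
  refine hasWeakDeriv_of_fc fun n => ?_
  rw [fc_conj, fc_conj, H1.fc_dx, waveNumber_neg]
  simp

namespace H1

/-- Complex conjugation on `H¹`. -/
def cj : H1 L →L[ℝ] H1 L :=
  LinearMap.mkContinuous
    { toFun := fun u => mk _ _ (hasWeakDeriv_conj u)
      map_add' := fun u v => ext_val (by simp)
      map_smul' := fun c u => ext_val (L2.conj.map_smul c u.val) }
    1
    (fun u => by
      rw [one_mul]
      refine le_of_sq_le_sq ?_ (norm_nonneg _)
      rw [norm_sq, norm_sq]
      exact add_le_add (pow_le_pow_left₀ (norm_nonneg _) (L2.norm_conj_le _) 2)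
        (pow_le_pow_left₀ (norm_nonneg _) (L2.norm_conj_le _) 2))

theorem val_cj (u : H1 L) : (cj u).val = L2.conj u.val := rfl

theorem norm_cj_le (u : H1 L) : ‖cj u‖ ≤ ‖u‖ := by
  refine le_of_sq_le_sq ?_ (norm_nonneg _)
  rw [norm_sq, norm_sq]
  exact add_le_add (pow_le_pow_left₀ (norm_nonneg _) (L2.norm_conj_le _) 2)
    (pow_le_pow_left₀ (norm_nonneg _) (L2.norm_conj_le _) 2)

theorem toC_cj (u : H1 L) (x : AddCircle L) : toC (cj u) x = conj (toC u x) := by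
  have : toC (cj u) = ⟨fun x => conj (toC u x), Complex.continuous_conj.comp (toC u).continuous⟩ := by
    refine toC_eq_of_ae ?_
    filter_upwards [L2.coeFn_conj u.val, val_ae u] with x h1 h2
    rw [val_cj, h1, h2]
    rfl
  rw [this]
  rfl

theorem ext_toC {u v : H1 L} (h : ∀ x, toC u x = toC v x) : u = v :=
  toC_injective (ContinuousMap.ext h)

/-- The cubic nonlinearity `|u|² u`. -/
def cubic (u : H1 L) : H1 L := mul (mul u (cj u)) u

theorem toC_cubic (u : H1 L) (x : AddCircle L) :
    toC (cubic u) x = (‖toC u x‖ ^ 2 : ℝ) * toC u x := by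
  rw [cubic, toC_mul, toC_mul, ContinuousMap.mul_apply, ContinuousMap.mul_apply, toC_cj,
    Complex.mul_conj, Complex.normSq_eq_norm_sq]

theorem continuous_mul {X : Type*} [TopologicalSpace X] {f g : X → H1 L} (hf : Continuous f)
    (hg : Continuous g) : Continuous fun x => mul (f x) (g x) :=
  ((mul (L := L)).continuous.comp hf).clm_apply hg

theorem continuous_cubic : Continuous (cubic : H1 L → H1 L) :=
  continuous_mul (continuous_mul continuous_id cj.continuous) continuous_id

theorem exists_norm_mul_le (L : ℝ) [Fact (0 < L)] :
    ∃ C : ℝ, 0 ≤ C ∧ ∀ u v : H1 L, ‖mul u v‖ ≤ C * ‖u‖ * ‖v‖ :=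
  ⟨‖(mul : H1 L →L[ℂ] H1 L →L[ℂ] H1 L)‖, ContinuousLinearMap.opNorm_nonneg _, fun u v => mul.le_opNorm₂ u v⟩

theorem cubic_sub_cubic (u v : H1 L) : cubic u - cubic v
    = mul (mul u (cj u)) (u - v) + mul (mul u (cj (u - v)) + mul (u - v) (cj v)) v := by
  simp only [cubic, map_sub, map_add, sub_apply, add_apply]
  abel

theorem exists_cubic_lipschitz (R : ℝ) : ∃ K : NNReal, ∀ u v : H1 L, ‖u‖ ≤ R → ‖v‖ ≤ R →
    ‖cubic u - cubic v‖ ≤ K * ‖u - v‖ := by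
  obtain ⟨C, hC0, norm_mul_le⟩ := exists_norm_mul_le L
  refine ⟨⟨3 * C ^ 2 * R ^ 2, by positivity⟩, fun u v hu hv => ?_⟩
  have hR : 0 ≤ R := (norm_nonneg u).trans hu
  change _ ≤ 3 * C ^ 2 * R ^ 2 * ‖u - v‖
  have b : ∀ (x y z : H1 L) (a b c : ℝ), ‖x‖ ≤ a → ‖y‖ ≤ b → ‖z‖ ≤ c →
      ‖mul (mul x y) z‖ ≤ C ^ 2 * (a * b * c) := by
    intro x y z a b c hx hy hz
    have ha := (norm_nonneg _).trans hx
    have hb := (norm_nonneg _).trans hy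
    calc _ ≤ C * ‖mul x y‖ * ‖z‖ := norm_mul_le _ _
      _ ≤ C * (C * ‖x‖ * ‖y‖) * ‖z‖ := by gcongr; exact norm_mul_le _ _
      _ ≤ C * (C * a * b) * c := by gcongr
      _ = _ := by ring
  rw [cubic_sub_cubic, map_add, add_apply]
  have h1 := b u (cj u) (u - v) R R _ hu ((norm_cj_le u).trans hu) le_rfl
  have h2 := b u (cj (u - v)) v R _ R hu (norm_cj_le _) hv
  have h3 := b (u - v) (cj v) v _ R R le_rfl ((norm_cj_le v).trans hv) hv
  refine (norm_add_le _ _).trans ((add_le_add h1 ((norm_add_le _ _).trans (add_le_add h2 h3))).trans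
    (le_of_eq ?_))
  ring

/-! ### Fourier multipliers, the group action and boosts -/

theorem hasWeakDeriv_multiplier (θ : ℤ → ℝ) (u : H1 L) :
    HasWeakDeriv (multiplier L θ u.val) (multiplier L θ u.dx) := by
  refine hasWeakDeriv_of_fc fun n => ?_
  rw [fc_multiplier, fc_multiplier, fc_dx]
  ring

/-- The Fourier multiplier with symbol `e^{iθₙ}` on `H¹`. -/
def diag (L : ℝ) [Fact (0 < L)] (θ : ℤ → ℝ) : H1 L →ₗᵢ[ℂ] H1 L where
  toFun u := mk _ _ (hasWeakDeriv_multiplier θ u)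
  map_add' u v := ext_val (by simp)
  map_smul' c u := ext_val (by simp)
  norm_map' u := by
    change ‖mk _ _ (hasWeakDeriv_multiplier θ u)‖ = ‖u‖
    rw [← sq_eq_sq₀ (norm_nonneg _) (norm_nonneg _), norm_sq, norm_sq]
    simp

theorem fc_diag (θ : ℤ → ℝ) (u : H1 L) (n : ℤ) :
    fc (diag L θ u).val n = Complex.exp (Complex.I * θ n) * fc u.val n := fc_multiplier θ _ n

theorem diag_diag (θ θ' : ℤ → ℝ) (u : H1 L) : diag L θ (diag L θ' u) = diag L (θ + θ') u := by
  refine ext_fc fun n => ?_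
  rw [fc_diag, fc_diag, fc_diag, ← mul_assoc, ← Complex.exp_add, Pi.add_apply]
  push_cast
  rw [mul_add]

theorem diag_zero (u : H1 L) : diag L 0 u = u := by
  refine ext_fc fun n => ?_
  simp [fc_diag]

theorem val_vadd (g : ℝ × ℝ) (u : H1 L) : (g +ᵥ u).val = L2.act g u.val := rfl

theorem toC_vadd (g : ℝ × ℝ) (u : H1 L) (x : AddCircle L) :
    toC (g +ᵥ u) x = Complex.exp (Complex.I * g.2) * toC u (x - (g.1 : AddCircle L)) := by
  have : toC (g +ᵥ u) = ⟨fun x => Complex.exp (Complex.I * g.2) * toC u (x - (g.1 : AddCircle L)),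
      continuous_const.mul ((toC u).continuous.comp (continuous_id.sub continuous_const))⟩ := by
    refine toC_eq_of_ae ?_
    filter_upwards [L2.coeFn_act g u.val,
      (measurePreserving_sub g.1).quasiMeasurePreserving.ae (val_ae u)] with x h1 h2
    rw [val_vadd, h1, h2]
    rfl
  rw [this]
  rfl

theorem fc_vadd (g : ℝ × ℝ) (u : H1 L) (n : ℤ) : fc (g +ᵥ u).val n
    = Complex.exp (Complex.I * (g.2 - waveNumber L n * g.1 : ℝ)) * fc u.val n := by
  rw [fc_eq_toC, fc_eq_toC, ← integral_const_mul]
  rw [← integral_add_right_eq_self _ (g.1 : AddCircle L)]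
  refine integral_congr_ae (Eventually.of_forall fun x => ?_)
  simp only [toC_vadd, add_sub_cancel_right]
  have : fourier (-n) (x + (g.1 : AddCircle L))
      = fourier (-n) x * Complex.exp (Complex.I * (-(waveNumber L n * g.1) : ℝ)) := by
    rw [fourier_apply, fourier_apply, smul_add, AddCircle.toCircle_add, Circle.coe_mul,
      ← fourier_apply, ← fourier_apply, fourier_coe_apply]
    congr 2
    rw [waveNumber]
    push_cast
    ring
  rw [this, show (g.2 - waveNumber L n * g.1 : ℝ) = g.2 + (-(waveNumber L n * g.1)) by ring,
    Complex.ofReal_add, mul_add, Complex.exp_add]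
  ring

/-- Seen as a Fourier multiplier, each group element is a linear isometry and commutes with the free
evolution. -/
theorem vadd_eq_diag (g : ℝ × ℝ) (u : H1 L) :
    g +ᵥ u = diag L (fun n => g.2 - waveNumber L n * g.1) u :=
  ext_fc fun n => by rw [fc_vadd, fc_diag]

theorem cubic_vadd (g : ℝ × ℝ) (u : H1 L) : cubic (g +ᵥ u) = g +ᵥ cubic u := by
  refine ext_toC fun x => ?_
  rw [toC_cubic, toC_vadd, toC_vadd, toC_cubic, norm_mul, Complex.norm_exp]
  simp
  ring

theorem vadd_smul (g : ℝ × ℝ) (c : ℂ) (u : H1 L) : g +ᵥ (c • u) = c • (g +ᵥ u) := by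
  rw [vadd_eq_diag, vadd_eq_diag, map_smul]

/-- Multiplication by `e^{2πimx/L}`. -/
def boost (L : ℝ) [Fact (0 < L)] (m : ℤ) : H1 L →L[ℂ] H1 L := mul (expo L m)

theorem val_boost (m : ℤ) (u : H1 L) : (boost L m u).val = cmul (fourier m) u.val := by
  rw [boost, val_mul, toC_expo]

theorem fc_boost (m n : ℤ) (u : H1 L) : fc (boost L m u).val n = fc u.val (n - m) := by
  rw [val_boost, fc_cmul_fourier]

theorem toC_boost (m : ℤ) (u : H1 L) (x : AddCircle L) :
    toC (boost L m u) x = fourier m x * toC u x := by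
  rw [boost, toC_mul, toC_expo, ContinuousMap.mul_apply]

theorem norm_fourier_apply (m : ℤ) (x : AddCircle L) : ‖(fourier m x : ℂ)‖ = 1 := by
  rw [fourier_apply, Circle.norm_coe]

theorem cubic_boost (m : ℤ) (u : H1 L) : cubic (boost L m u) = boost L m (cubic u) := by
  refine ext_toC fun x => ?_
  rw [toC_cubic, toC_boost, toC_boost, toC_cubic, norm_mul, norm_fourier_apply]
  push_cast
  ring

theorem boost_boost (m n : ℤ) (u : H1 L) : boost L m (boost L n u) = boost L (m + n) u := by
  refine ext_fc fun j => ?_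
  rw [fc_boost, fc_boost, fc_boost, sub_sub]

theorem boost_zero (u : H1 L) : boost L 0 u = u := by
  refine ext_fc fun j => ?_
  rw [fc_boost, sub_zero]

/-- Boosts normalize the action of G: moving a translation by `a` across the factor e^{ikx} costs
the phase ka. -/
theorem boost_vadd (m : ℤ) (g : ℝ × ℝ) (u : H1 L) :
    boost L m (g +ᵥ u) = (g.1, g.2 + waveNumber L m * g.1) +ᵥ boost L m u := by
  refine ext_fc fun n => ?_
  rw [fc_boost, fc_vadd, fc_vadd, fc_boost, waveNumber_sub]
  congr 4
  simp only
  ring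

theorem boost_planeWave (m n : ℤ) (α : ℝ) :
    boost L m (planeWave L α n) = planeWave L α (n - m) := by
  refine ext_toC fun x => ?_
  rw [toC_boost, planeWave, planeWave, toC_ofSmooth, toC_ofSmooth,
    show -(n - m) = m + -n by ring, fourier_add]
  ring

end H1

/-! ### The free Schrödinger group and its weak differentiability -/

/-- The free Schrödinger group `e^{iβt∂ₓ²}`. -/
def free (L : ℝ) [Fact (0 < L)] (β t : ℝ) : H1 L →ₗᵢ[ℂ] H1 L :=
  H1.diag L fun n => -(β * waveNumber L n ^ 2 * t)

theorem free_free (β s t : ℝ) (u : H1 L) : free L β s (free L β t u) = free L β (s + t) u := by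
  rw [free, free, free, H1.diag_diag]
  congr 2
  ext n
  simp only [Pi.add_apply]
  ring

theorem free_zero (β : ℝ) (u : H1 L) : free L β 0 u = u := by
  rw [free]
  simpa using! H1.diag_zero u

theorem free_neg_free (β t : ℝ) (u : H1 L) : free L β (-t) (free L β t u) = u := by
  rw [free_free, neg_add_cancel, free_zero]

theorem free_free_neg (β t : ℝ) (u : H1 L) : free L β t (free L β (-t) u) = u := by
  rw [free_free, add_neg_cancel, free_zero]

theorem free_vadd (β t : ℝ) (g : ℝ × ℝ) (u : H1 L) : free L β t (g +ᵥ u) = g +ᵥ free L β t u := by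
  rw [H1.vadd_eq_diag, H1.vadd_eq_diag, free, H1.diag_diag, H1.diag_diag, add_comm]

theorem fc_free (β t : ℝ) (u : H1 L) (n : ℤ) : fc (free L β t u).val n
    = Complex.exp (Complex.I * (-(β * waveNumber L n ^ 2 * t) : ℝ)) * fc u.val n :=
  H1.fc_diag _ _ _


theorem free_expo (β t : ℝ) (n : ℤ) : free L β t (H1.expo L n)
    = Complex.exp (-(Complex.I * β * waveNumber L n ^ 2) * t) • H1.expo L n := by
  refine H1.ext_fc fun m => ?_
  rw [fc_free, H1.val_smul, fc_smul, H1.val_expo, fc_wave]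
  split_ifs with h
  · subst h
    congr 2
    push_cast
    ring
  · simp

theorem continuous_free_expo (β : ℝ) (n : ℤ) : Continuous fun t => free L β t (H1.expo L n) := by
  simp only [free_expo]
  have h : Continuous fun t : ℝ => Complex.exp (-(Complex.I * β * waveNumber L n ^ 2) * t) := by
    fun_prop
  exact h.smul continuous_const

/-- The evolutions of the partial Fourier sums are continuous in time and, the group being
isometric, converge uniformly in time. -/
theorem continuous_free_apply (β : ℝ) (u : H1 L) : Continuous fun t => free L β t u := by
  have h : TendstoUniformly
      (fun (s : Finset ℤ) (t : ℝ) =>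
        free L β t (∑ n ∈ s, ((L : ℂ)⁻¹ * fc u.val n) • H1.expo L n))
      (fun t => free L β t u) atTop := by
    rw [Metric.tendstoUniformly_iff]
    intro ε hε
    filter_upwards [Metric.tendsto_nhds.1 (H1.hasSum_expo u) ε hε] with s hs t
    rw [(free L β t).dist_map, dist_comm]
    exact hs
  refine h.continuous (Frequently.of_forall fun s => ?_)
  simp only [map_sum, map_smul]
  exact continuous_finsetSum _ fun n _ =>
    Continuous.smul (continuous_const (y := (L : ℂ)⁻¹ * fc u.val n)) (continuous_free_expo β n)

theorem continuous_free (β : ℝ) : Continuous fun p : ℝ × H1 L => free L β p.1 p.2 :=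
  continuous_prod_of_continuous_lipschitzWith' _ 1
    (fun t => (free L β t).lipschitz) fun u => continuous_free_apply β u

theorem continuous_inner_free (β : ℝ) (f : L2 L) (p : H1 L) :
    Continuous fun s => inner ℂ f (free L β s p).dx :=
  continuous_const.inner (H1.continuous_dx.comp (continuous_free_apply β p))

/-- The functional `p ↦ ∫₀ʰ ⟨f, ∂ₓ S(s) p⟩ ds`. -/
def freeIntegral (β h : ℝ) (f : L2 L) : H1 L →L[ℂ] ℂ :=
  LinearMap.mkContinuous
    { toFun := fun p => ∫ s in (0 : ℝ)..h, inner ℂ f (free L β s p).dx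
      map_add' := fun p p' => by
        simp only [map_add, H1.dx_add, inner_add_right]
        exact intervalIntegral.integral_add
          ((continuous_inner_free β f p).intervalIntegrable _ _)
          ((continuous_inner_free β f p').intervalIntegrable _ _)
      map_smul' := fun c p => by
        simp only [map_smul, H1.dx_smul, inner_smul_right]
        exact intervalIntegral.integral_const_mul _ _ }
    (‖f‖ * |h|)
    (fun p => by
      have := intervalIntegral.norm_integral_le_of_norm_le_const (a := 0) (b := h)
        (f := fun s => inner ℂ f (free L β s p).dx) (C := ‖f‖ * ‖p‖) fun s _ => by
          refine (norm_inner_le_norm _ _).trans ?_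
          gcongr
          exact (H1.norm_dx_le _).trans_eq ((free L β s).norm_map p)
      refine this.trans_eq ?_
      rw [sub_zero]
      ring)

theorem freeIntegral_apply (β h : ℝ) (f : L2 L) (p : H1 L) :
    freeIntegral β h f p = ∫ s in (0 : ℝ)..h, inner ℂ f (free L β s p).dx := rfl

/-- The integrated weak form of ∂ₛS(s)p = iβ∂ₓ²S(s)p, with one derivative moved onto `q`, so that H¹
regularity of both arguments suffices. For `p` an exponential it is the integral of a scalar
exponential. -/
theorem inner_free_sub (β h : ℝ) (q p : H1 L) :
    inner ℂ q.val (free L β h p - p).val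
      = -(Complex.I * β) * ∫ s in (0 : ℝ)..h, inner ℂ q.dx (free L β s p).dx := by
  have key : innerSL ℂ q.val ∘L H1.valL ∘L
      ((free L β h).toContinuousLinearMap - ContinuousLinearMap.id ℂ (H1 L))
      = (-(Complex.I * β)) • freeIntegral β h q.dx := by
    refine H1.clm_ext fun n => ?_
    simp only [ContinuousLinearMap.comp_apply, sub_apply, smul_apply,
      LinearIsometry.coe_toContinuousLinearMap, ContinuousLinearMap.id_apply, H1.valL_apply,
      freeIntegral_apply, free_expo, H1.val_sub, H1.val_smul, H1.val_expo, H1.dx_smul, H1.dx_expo,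
      innerSL_apply_apply, inner_sub_right, inner_smul_right, smul_eq_mul]
    have e1 : inner ℂ q.val (wave L n) = conj (fc q.val n) := by
      rw [fc_eq_inner, inner_conj_symm]
    have e2 : inner ℂ q.dx (wave L n) = -(Complex.I * waveNumber L n) * conj (fc q.val n) := by
      rw [← inner_conj_symm, ← fc_eq_inner, H1.fc_dx]
      simp
    have e3 : ∫ s in (0 : ℝ)..h, -(Complex.I * β * waveNumber L n ^ 2)
        * Complex.exp (-(Complex.I * β * waveNumber L n ^ 2) * s)
        = Complex.exp (-(Complex.I * β * waveNumber L n ^ 2) * h) - 1 := by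
      have := intervalIntegral.integral_eq_sub_of_hasDerivAt (a := 0) (b := h)
        (f := fun s : ℝ => Complex.exp (-(Complex.I * β * waveNumber L n ^ 2) * s))
        (f' := fun s : ℝ => -(Complex.I * β * waveNumber L n ^ 2)
          * Complex.exp (-(Complex.I * β * waveNumber L n ^ 2) * s))
        (fun s _ => by
          have h1 : HasDerivAt (fun s : ℝ => -(Complex.I * β * waveNumber L n ^ 2) * (s : ℂ))
              (-(Complex.I * β * waveNumber L n ^ 2)) s := by
            simpa using (Complex.ofRealCLM.hasDerivAt (x := s)).const_mul
              (-(Complex.I * β * waveNumber L n ^ 2))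
          simpa [mul_comm] using h1.cexp)
        (Continuous.intervalIntegrable (by fun_prop) _ _)
      simpa using this
    rw [intervalIntegral.integral_const_mul] at e3
    rw [e1, e2, intervalIntegral.integral_mul_const]
    calc _ = (Complex.exp (-(Complex.I * β * waveNumber L n ^ 2) * h) - 1)
          * conj (fc q.val n) := by ring
      _ = _ := by
        rw [← e3]
        linear_combination (-(Complex.I * β) * conj (fc q.val n) * waveNumber L n ^ 2
          * (∫ s in (0 : ℝ)..h, Complex.exp (-(Complex.I * β * waveNumber L n ^ 2) * s)))
          * Complex.I_sq
  exact DFunLike.congr_fun key p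

theorem norm_inner_free_sub_le (β h : ℝ) (q p : H1 L) :
    ‖inner ℂ q.val (free L β h p - p).val‖ ≤ |β| * (‖q‖ * ‖p‖ * |h|) := by
  have h1 := intervalIntegral.norm_integral_le_of_norm_le_const (a := 0) (b := h)
    (f := fun s => inner ℂ q.dx (free L β s p).dx) (C := ‖q‖ * ‖p‖) fun s _ =>
      (norm_inner_le_norm _ _).trans (mul_le_mul (H1.norm_dx_le q)
        ((H1.norm_dx_le _).trans_eq ((free L β s).norm_map p)) (norm_nonneg _) (norm_nonneg _))
  rw [inner_free_sub, norm_mul, norm_neg, norm_mul, Complex.norm_I, one_mul, Complex.norm_real,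
    Real.norm_eq_abs]
  rw [sub_zero] at h1
  gcongr

theorem hasDerivAt_inner_free_sub (β : ℝ) (q p : H1 L) :
    HasDerivAt (fun h => inner ℂ q.val (free L β h p - p).val)
      (-(Complex.I * β) * inner ℂ q.dx p.dx) 0 := by
  simp only [inner_free_sub]
  have hc := continuous_inner_free β q.dx p
  have := intervalIntegral.integral_hasDerivAt_right (a := 0) (b := 0)
    (hc.intervalIntegrable _ _) (hc.stronglyMeasurableAtFilter _ _) hc.continuousAt
  rw [free_zero] at this
  exact this.const_mul _

/-- Since `y` vanishes at `t`, the difference quotient is the pairing of `q s` with that of `y`; no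
derivative of `q` enters. -/
theorem hasDerivAt_inner_of_eq_zero {H : Type*} [NormedAddCommGroup H] [InnerProductSpace ℂ H]
    {q y : ℝ → H} {y' : H} {t : ℝ} (hq : ContinuousAt q t) (hy : HasDerivAt y y' t)
    (h0 : y t = 0) : HasDerivAt (fun s => inner ℂ (q s) (y s)) (inner ℂ (q t) y') t := by
  rw [hasDerivAt_iff_tendsto_slope] at hy ⊢
  have h := (hq.tendsto.mono_left nhdsWithin_le_nhds).inner hy (𝕜 := ℂ)
  refine h.congr fun s => ?_
  simp only [slope, h0, vsub_eq_sub, inner_zero_right, sub_zero]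
  rw [← Complex.coe_smul, inner_smul_right]
  rfl

/-- Differentiation of `s ↦ ⟨q(s), S(s) v(s)⟩` at `s = t` after subtraction of the
value at `t` in the second argument; `q` is only assumed to be continuous. -/
theorem hasDerivAt_inner_free {β : ℝ} {q v : ℝ → H1 L} {v' : H1 L} {t : ℝ}
    (hq : ContinuousAt q t) (hv : HasDerivAt v v' t) :
    HasDerivAt (fun s => inner ℂ (q s).val (free L β s (v s) - free L β t (v t)).val)
      (-(Complex.I * β) * inner ℂ (q t).dx (free L β t (v t)).dx
        + inner ℂ (q t).val (free L β t v').val) t := by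
  -- As S(s)v(s) = S(s - t)p(s), the increment S(s - t)p(s) - p(t) splits into p(s) - p(t), the free
  -- increment of p(t), and a remainder; these are `hB`, `hA` and `hR`.
  set p : ℝ → H1 L := fun s => free L β t (v s) with hp
  have hpd : HasDerivAt p (free L β t v') t :=
    ((free L β t).toContinuousLinearMap.restrictScalars ℝ).hasFDerivAt.comp_hasDerivAt t hv
  have hpc : ContinuousAt p t := hpd.continuousAt
  have hB : HasDerivAt (fun s => inner ℂ (q s).val (p s - p t).val)
      (inner ℂ (q t).val (free L β t v').val) t := by
    refine hasDerivAt_inner_of_eq_zero (y := fun s => (p s - p t).val)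
      (H1.continuous_val.continuousAt.comp hq) ?_ ?_
    · exact ((H1.valL (L := L)).restrictScalars ℝ).hasFDerivAt.comp_hasDerivAt t (hpd.sub_const _)
    · rw [sub_self]; rfl
  have hA : HasDerivAt (fun s => inner ℂ (q t).val (free L β (s - t) (p t) - p t).val)
      (-(Complex.I * β) * inner ℂ (q t).dx (p t).dx) t := by
    have h1 := hasDerivAt_inner_free_sub β (q t) (p t)
    rw [← sub_self t] at h1
    exact h1.comp_sub_const t t
  -- In both terms a free increment over time s - t, bounded by a multiple of |s - t|, is paired
  -- with or applied to a difference that tends to 0.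
  have hR : HasDerivAt (fun s => inner ℂ (q s - q t).val (free L β (s - t) (p s) - p s).val
      + inner ℂ (q t).val (free L β (s - t) (p s - p t) - (p s - p t)).val) 0 t := by
    rw [hasDerivAt_iff_isLittleO]
    set ε : ℝ → ℝ := fun s => |β| * (‖q s - q t‖ * ‖p s‖ + ‖q t‖ * ‖p s - p t‖) with hε
    have hε0 : Tendsto ε (𝓝 t) (𝓝 0) := by
      have : ContinuousAt ε t := continuousAt_const.mul
        (((hq.sub continuousAt_const).norm.mul hpc.norm).add
          (continuousAt_const.mul (hpc.sub continuousAt_const).norm))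
      have h2 := this.tendsto
      simpa [hε] using h2
    have hlo := (Asymptotics.isBigO_refl (fun s : ℝ => s - t) (𝓝 t)).mul_isLittleO
      ((Asymptotics.isLittleO_one_iff ℝ).2 hε0)
    simp only [mul_one] at hlo
    refine Asymptotics.IsBigO.trans_isLittleO (Asymptotics.IsBigO.of_bound 1
      (Eventually.of_forall fun s => ?_)) hlo
    have z : ∀ r : H1 L, free L β (t - t) r - r = 0 := fun r => by
      rw [sub_self, free_zero, sub_self]
    have z0 : ∀ f : L2 L, inner ℂ f (0 : H1 L).val = 0 := fun f => inner_zero_right f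
    rw [z, z, z0, z0, add_zero, sub_zero, smul_zero, sub_zero, one_mul, norm_mul,
      Real.norm_eq_abs]
    refine (norm_add_le _ _).trans ((add_le_add (norm_inner_free_sub_le _ _ _ _)
      (norm_inner_free_sub_le _ _ _ _)).trans ((le_of_eq ?_).trans
        (mul_le_mul_of_nonneg_left (le_abs_self _) (abs_nonneg _))))
    rw [hε]
    ring
  have h := (hA.add hR).add hB
  rw [add_zero] at h
  refine h.congr_of_eventuallyEq (Eventually.of_forall fun s => ?_)
  have e : free L β s (v s) = free L β (s - t) (p s) := by
    rw [hp, free_free, sub_add_cancel]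
  simp only [Pi.add_apply, e, hp]
  simp only [H1.val_sub, map_sub, inner_sub_left, inner_sub_right]
  ring

/-! ### Equivalence of distributional and mild solutions -/

/-- The nonlinearity `iλ|u|²u`. -/
def nonlin (lam : ℝ) (u : H1 L) : H1 L := (Complex.I * lam) • H1.cubic u

theorem continuous_nonlin (lam : ℝ) : Continuous (nonlin lam : H1 L → H1 L) :=
  H1.continuous_cubic.const_smul (Complex.I * lam)

/-- Solutions in the interaction picture: `t ↦ S(-t) u(t)` is differentiable in `H¹`, with
derivative `S(-t) (iλ|u(t)|²u(t))`. -/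
def IsMild (L : ℝ) [Fact (0 < L)] (β lam : ℝ) (u : ℝ → H1 L) : Prop :=
  ∀ t, HasDerivAt (fun s => free L β (-s) (u s)) (free L β (-t) (nonlin lam (u t))) t

instance H1.instSecondCountableTopologyEither : SecondCountableTopologyEither ℝ (H1 L) :=
  secondCountableTopologyEither_of_left ℝ (H1 L)

theorem continuous_free_comp {X : Type*} [TopologicalSpace X] (β : ℝ) {f : X → ℝ} {g : X → H1 L}
    (hf : Continuous f) (hg : Continuous g) : Continuous fun x => free L β (f x) (g x) :=
  Continuous.comp (g := fun p : ℝ × H1 L => free L β p.1 p.2) (f := fun x => (f x, g x))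
    (continuous_free β) (hf.prodMk hg)

theorem H1.toC_add_apply (u v : H1 L) (x : AddCircle L) : toC (u + v) x = toC u x + toC v x := by
  rw [map_add, ContinuousMap.add_apply]

theorem H1.toC_sub_apply (u v : H1 L) (x : AddCircle L) : toC (u - v) x = toC u x - toC v x := by
  rw [map_sub, ContinuousMap.sub_apply]

theorem H1.toC_smul_apply (c : ℂ) (u : H1 L) (x : AddCircle L) :
    toC (c • u) x = c * toC u x := by
  rw [map_smul, ContinuousMap.smul_apply, smul_eq_mul]

theorem H1.toC_mul_apply (u v : H1 L) (x : AddCircle L) :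
    toC (mul u v) x = toC u x * toC v x := by
  rw [toC_mul, ContinuousMap.mul_apply]

theorem H1.continuous_iff_continuous_free {β : ℝ} {u : ℝ → H1 L} :
    Continuous (fun s => free L β (-s) (u s)) ↔ Continuous u := by
  refine ⟨fun h => ?_, fun h => continuous_free_comp β continuous_neg h⟩
  have := continuous_free_comp β continuous_id h
  refine this.congr fun s => ?_
  exact free_free_neg β s (u s)

theorem IsMild.continuous {β lam : ℝ} {u : ℝ → H1 L} (h : IsMild L β lam u) : Continuous u :=
  H1.continuous_iff_continuous_free.1 (continuous_iff_continuousAt.2 fun t => (h t).continuousAt)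

/-- Integrating each coefficient gives v(t) = v(0) + ∫₀ᵗ w in H¹. Continuity of `w` in H¹ then
upgrades coefficientwise differentiability to differentiability in norm. -/
theorem hasDerivAt_of_fc {v w : ℝ → H1 L} (hw : Continuous w)
    (h : ∀ n t, HasDerivAt (fun s => fc (v s).val n) (fc (w t).val n) t) (t : ℝ) :
    HasDerivAt v (w t) t := by
  have e : v = fun t => v 0 + ∫ s in (0 : ℝ)..t, w s := by
    ext1 t
    refine H1.ext_fc fun n => ?_
    have h1 := intervalIntegral.integral_eq_sub_of_hasDerivAt (a := 0) (b := t)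
      (fun s _ => h n s) (Continuous.intervalIntegrable (by
        simp only [← fcL_apply]
        exact (fcL n).continuous.comp (H1.continuous_val.comp hw)) _ _)
    have h2 := ((fcL n ∘L H1.valL).restrictScalars ℝ).intervalIntegral_comp_comm
      (hw.intervalIntegrable (μ := volume) 0 t)
    simp only [ContinuousLinearMap.coe_restrictScalars', ContinuousLinearMap.comp_apply,
      H1.valL_apply, fcL_apply] at h2
    rw [H1.val_add, fc_add, ← h2, h1]
    ring
  have h3 := (intervalIntegral.integral_hasDerivAt_right (a := 0) (b := t)
    (hw.intervalIntegrable _ _) (hw.stronglyMeasurableAtFilter _ _) hw.continuousAt).const_add (v 0)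
  rw [e]
  exact h3

theorem integral_cubic (u : H1 L) (φ : AddCircle L → ℂ) :
    ∫ x, (‖u.val x‖ ^ 2 : ℝ) * u.val x * φ x = ∫ x, (H1.cubic u).val x * φ x := by
  refine integral_congr_ae ?_
  filter_upwards [H1.val_ae u, H1.val_ae (H1.cubic u)] with x h1 h2
  rw [h1, h2, H1.toC_cubic]

/-- Tested against an exponential, the equation is a scalar equation for one Fourier coefficient;
the integrating factor e^{iβk²t}, k = 2πn/L, removes its linear term. -/
theorem IsNLSSolution.isMild {β lam : ℝ} {u : ℝ → H1 L} (h : IsNLSSolution L β lam u) :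
    IsMild L β lam u := by
  obtain ⟨hc, hd⟩ := h
  refine hasDerivAt_of_fc
    (continuous_free_comp β continuous_neg ((continuous_nonlin lam).comp hc))
    fun n t => ?_
  have h1 := hd _ (isSmooth_fourier (-n)) t
  rw [integral_cubic] at h1
  have e1 : ∫ x, (u t).dx x * circleDeriv (fourier (-n)) x
      = waveNumber L n ^ 2 * fc (u t).val n := by
    have : ∀ x, (u t).dx x * circleDeriv (fourier (-n)) x
        = -(Complex.I * waveNumber L n) * ((u t).dx x * fourier (-n) x) := fun x => by
      rw [circleDeriv_fourier, waveNumber_neg]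
      push_cast
      ring
    simp only [this]
    rw [integral_const_mul]
    change _ * fc (u t).dx n = _
    rw [H1.fc_dx]
    linear_combination (-(waveNumber L n : ℂ) ^ 2 * fc (u t).val n) * Complex.I_sq
  rw [e1] at h1
  change HasDerivAt (fun s => fc (u s).val n) (Complex.I * (-β * _ + lam * fc _ n)) t at h1
  have h2 : HasDerivAt
      (fun s : ℝ => Complex.exp (Complex.I * β * waveNumber L n ^ 2 * (s : ℂ)))
      (Complex.I * β * waveNumber L n ^ 2
        * Complex.exp (Complex.I * β * waveNumber L n ^ 2 * (t : ℂ))) t := by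
    have h3 : HasDerivAt (fun s : ℝ => Complex.I * β * waveNumber L n ^ 2 * (s : ℂ))
        (Complex.I * β * waveNumber L n ^ 2) t := by
      simpa using (Complex.ofRealCLM.hasDerivAt (x := t)).const_mul
        (Complex.I * β * (waveNumber L n : ℂ) ^ 2)
    simpa [mul_comm] using h3.cexp
  have e2 : ∀ s (w : H1 L), fc (free L β (-s) w).val n
      = Complex.exp (Complex.I * β * waveNumber L n ^ 2 * (s : ℂ)) * fc w.val n := fun s w => by
    rw [fc_free]
    congr 2
    push_cast
    ring
  simp only [e2]
  refine (h2.mul h1).congr_deriv ?_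
  rw [nonlin, H1.val_smul, fc_smul]
  ring

theorem inner_dx_ofSmooth_conj {φ : AddCircle L → ℂ} (hφ : IsSmooth φ) (w : L2 L) :
    inner ℂ (H1.ofSmooth _ (isSmooth_conj hφ)).dx w = ∫ x, w x * circleDeriv φ x := by
  rw [integral_mul_eq_inner _ hφ.continuous_circleDeriv]
  congr 1
  refine MemLp.toLp_congr (memLp_of_continuous (isSmooth_conj hφ).continuous_circleDeriv) _
    (Eventually.of_forall fun x => circleDeriv_conj φ x)

theorem inner_val_ofSmooth_conj {φ : AddCircle L → ℂ} (hφ : IsSmooth φ) (w : L2 L) :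
    inner ℂ (H1.ofSmooth _ (isSmooth_conj hφ)).val w = ∫ x, w x * φ x := by
  rw [integral_mul_eq_inner _ hφ.continuous]
  rfl

/-- This is `hasDerivAt_inner_free` with the first argument frozen at the conjugate of the test
function. -/
theorem IsMild.isNLSSolution {β lam : ℝ} {u : ℝ → H1 L} (h : IsMild L β lam u) :
    IsNLSSolution L β lam u := by
  refine ⟨h.continuous, fun φ hφ t => ?_⟩
  have h1 := hasDerivAt_inner_free
    (q := fun _ => H1.ofSmooth _ (isSmooth_conj hφ)) (β := β) continuousAt_const (h t)
  simp only [free_free_neg] at h1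
  have h2 := h1.add_const (inner ℂ (H1.ofSmooth _ (isSmooth_conj hφ)).val (u t).val)
  refine (h2.congr_of_eventuallyEq (Eventually.of_forall fun s => ?_)).congr_deriv ?_
  · simp only [← inner_val_ofSmooth_conj hφ, H1.val_sub, inner_sub_right]
    ring
  · rw [integral_cubic, ← inner_val_ofSmooth_conj hφ, ← inner_dx_ofSmooth_conj hφ, nonlin,
      H1.val_smul, inner_smul_right]
    ring

theorem isNLSSolution_iff_isMild {β lam : ℝ} {u : ℝ → H1 L} :
    IsNLSSolution L β lam u ↔ IsMild L β lam u := ⟨IsNLSSolution.isMild, IsMild.isNLSSolution⟩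

/-! ### Conservation laws -/

/-- The integral `∫ |u|⁴`. -/
def quartic (u : H1 L) : ℝ := ∫ x, ‖H1.toC u x‖ ^ 4

/-- The energy `β/2 ∫ |∂ₓu|² - λ/4 ∫ |u|⁴`. -/
def energy (β lam : ℝ) (u : H1 L) : ℝ := β / 2 * ‖u.dx‖ ^ 2 - lam / 4 * quartic u

theorem hasDerivAt_norm_sq {H : Type*} [NormedAddCommGroup H] [InnerProductSpace ℂ H]
    {f : ℝ → H} {f' : H} {t : ℝ} (hf : HasDerivAt f f' t) :
    HasDerivAt (fun s => ‖f s‖ ^ 2) (2 * (inner ℂ (f t) f').re) t := by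
  have h := Complex.reCLM.hasFDerivAt.comp_hasDerivAt t (hf.inner ℂ hf)
  refine (h.congr_of_eventuallyEq (Eventually.of_forall fun s => ?_)).congr_deriv ?_
  · exact (inner_self_eq_norm_sq (𝕜 := ℂ) (f s)).symm
  · rw [← inner_conj_symm f' (f t), Complex.reCLM_apply, Complex.add_re, Complex.conj_re]
    ring

theorem integrable_continuous {F : Type*} [NormedAddCommGroup F] {f : AddCircle L → F}
    (hf : Continuous f) : Integrable f :=
  hf.integrable_of_hasCompactSupport (HasCompactSupport.of_compactSpace f)

/-- Pointwise, |a|⁴ - |b|⁴ is (|a|² + |b|²) Re((a - b) conj(a + b)). The increment of the quartic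
integral along a curve thus takes the form treated by `hasDerivAt_inner_free`. -/
theorem quartic_sub (a b : H1 L) : quartic a - quartic b
    = (inner ℂ (H1.mul (H1.mul a (H1.cj a) + H1.mul b (H1.cj b)) (a + b)).val (a - b).val).re := by
  rw [quartic, quartic, ← integral_sub (integrable_continuous (by fun_prop))
    (integrable_continuous (by fun_prop)), H1.inner_val]
  have := integral_re (𝕜 := ℂ) (integrable_continuous (L := L)
    (f := fun x => H1.toC (a - b) x
      * conj (H1.toC (H1.mul (H1.mul a (H1.cj a) + H1.mul b (H1.cj b)) (a + b)) x))
    ((map_continuous _).mul (Complex.continuous_conj.comp (map_continuous _))))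
  refine Eq.trans ?_ this
  congr 1
  ext1 x
  simp only [H1.toC_mul_apply, H1.toC_add_apply, H1.toC_sub_apply, H1.toC_cj]
  generalize H1.toC a x = z
  generalize H1.toC b x = w
  rw [show ‖z‖ ^ 4 = (‖z‖ ^ 2) ^ 2 by ring, show ‖w‖ ^ 4 = (‖w‖ ^ 2) ^ 2 by ring,
    ← Complex.normSq_eq_norm_sq, ← Complex.normSq_eq_norm_sq, Complex.normSq_apply,
    Complex.normSq_apply]
  simp only [map_mul, Complex.conj_conj, RCLike.re_to_complex, Complex.mul_re, Complex.mul_im,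
    Complex.add_re, Complex.add_im, Complex.sub_re, Complex.sub_im, Complex.conj_re,
    Complex.conj_im, map_add]
  ring

theorem inner_cubic (u : H1 L) : inner ℂ u.val (H1.cubic u).val = (quartic u : ℂ) := by
  rw [H1.inner_val, quartic, ← integral_complex_ofReal]
  congr 1
  ext1 x
  rw [H1.toC_cubic, mul_assoc, Complex.mul_conj, Complex.normSq_eq_norm_sq]
  push_cast
  ring

theorem norm_val_free (β t : ℝ) (u : H1 L) : ‖(free L β t u).val‖ = ‖u.val‖ :=
  (multiplier L _).norm_map _

theorem norm_dx_free (β t : ℝ) (u : H1 L) : ‖(free L β t u).dx‖ = ‖u.dx‖ :=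
  (multiplier L _).norm_map _

theorem inner_val_free (β t : ℝ) (u v : H1 L) :
    inner ℂ (free L β t u).val (free L β t v).val = inner ℂ u.val v.val :=
  (multiplier L _).inner_map_map _ _

theorem inner_dx_free (β t : ℝ) (u v : H1 L) :
    inner ℂ (free L β t u).dx (free L β t v).dx = inner ℂ u.dx v.dx :=
  (multiplier L _).inner_map_map _ _

/-- The free group is unitary and ⟨u, iλ|u|²u⟩ = iλ∫|u|⁴ is imaginary. The equation is assumed at
the single time `t`, so the result also serves for solutions known only on an interval. -/
theorem hasDerivAt_mass {β lam t : ℝ} {u : ℝ → H1 L}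
    (h : HasDerivAt (fun s => free L β (-s) (u s)) (free L β (-t) (nonlin lam (u t))) t) :
    HasDerivAt (fun s => ‖(u s).val‖ ^ 2) 0 t := by
  have h1 := ((H1.valL (L := L)).restrictScalars ℝ).hasFDerivAt.comp_hasDerivAt t h
  have h2 := hasDerivAt_norm_sq h1
  refine (h2.congr_of_eventuallyEq (Eventually.of_forall fun s => ?_)).congr_deriv ?_
  · exact congrArg (fun r => r ^ 2) (norm_val_free β (-s) (u s)).symm
  · change 2 * (inner ℂ (free L β (-t) (u t)).val
      (free L β (-t) (nonlin lam (u t))).val).re = 0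
    rw [inner_val_free, nonlin, H1.val_smul, inner_smul_right, inner_cubic]
    simp

/-- Writing z = ⟨∂ₓu, ∂ₓ(|u|²u)⟩, the kinetic part has derivative β Re(iλz), and λ/4 times the
quartic integral has derivative λ Re(-iβ z̄); these are the same number. -/
theorem hasDerivAt_energy {β lam t : ℝ} {u : ℝ → H1 L}
    (h : HasDerivAt (fun s => free L β (-s) (u s)) (free L β (-t) (nonlin lam (u t))) t) :
    HasDerivAt (fun s => energy β lam (u s)) 0 t := by
  have hu : ContinuousAt u t := by
    have h1 := (continuous_free (L := L) β).continuousAt.comp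
      (f := fun s : ℝ => (s, free L β (-s) (u s))) (x := t)
      (continuousAt_id.prodMk h.continuousAt)
    refine h1.congr (Eventually.of_forall fun s => ?_)
    exact free_free_neg β s (u s)
  have h1 := ((H1.dxL (L := L)).restrictScalars ℝ).hasFDerivAt.comp_hasDerivAt t h
  have h2 := hasDerivAt_norm_sq h1
  have h3 : HasDerivAt (fun s => ‖(u s).dx‖ ^ 2)
      (2 * (inner ℂ (u t).dx (nonlin lam (u t)).dx).re) t := by
    refine (h2.congr_of_eventuallyEq (Eventually.of_forall fun s => ?_)).congr_deriv ?_
    · exact congrArg (fun r => r ^ 2) (norm_dx_free β (-s) (u s)).symm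
    · rw [← inner_dx_free β (-t)]
      rfl
  have hq : ContinuousAt (fun s => H1.mul (H1.mul (u s) (H1.cj (u s))
      + H1.mul (u t) (H1.cj (u t))) (u s + u t)) t := by
    have hcont : Continuous fun w : H1 L =>
        H1.mul (H1.mul w (H1.cj w) + H1.mul (u t) (H1.cj (u t))) (w + u t) :=
      H1.continuous_mul ((H1.continuous_mul continuous_id H1.cj.continuous).add continuous_const)
        (continuous_id.add continuous_const)
    exact hcont.continuousAt.comp hu
  have h4 := Complex.reCLM.hasFDerivAt.comp_hasDerivAt t
    ((hasDerivAt_inner_free (β := β) hq h).add_const 0)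
  have h5 : HasDerivAt (fun s => quartic (u s))
      (4 * (-(Complex.I * β) * inner ℂ (H1.cubic (u t)).dx (u t).dx).re) t := by
    refine ((h4.add_const (quartic (u t))).congr_of_eventuallyEq
      (Eventually.of_forall fun s => ?_)).congr_deriv ?_
    · simp only [Function.comp_apply, free_free_neg, Complex.reCLM_apply, add_zero]
      rw [← quartic_sub, sub_add_cancel]
    · have e : H1.mul (H1.mul (u t) (H1.cj (u t)) + H1.mul (u t) (H1.cj (u t))) (u t + u t)
          = (4 : ℂ) • H1.cubic (u t) := by
        refine H1.ext_toC fun x => ?_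
        rw [H1.toC_smul_apply, H1.toC_cubic]
        simp only [H1.toC_mul_apply, H1.toC_add_apply, H1.toC_cj]
        rw [Complex.mul_conj, Complex.normSq_eq_norm_sq]
        ring
      rw [e]
      simp only [free_free_neg, Complex.reCLM_apply, H1.dx_smul, H1.val_smul, inner_smul_left]
      rw [nonlin, H1.val_smul, inner_smul_right, inner_self_eq_norm_sq_to_K, Complex.add_re]
      have e4 : conj (4 : ℂ) = ((4 : ℝ) : ℂ) := by
        rw [show (4 : ℂ) = ((4 : ℝ) : ℂ) by norm_num, Complex.conj_ofReal]
      rw [e4]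
      -- The contribution of the nonlinearity to the derivative of the quartic integral is a real
      -- multiple of i‖|u|²u‖², so its real part vanishes.
      have e5 : ∀ r : ℝ, (((4 : ℝ) : ℂ) * (Complex.I * lam * (r : ℂ) ^ 2)).re = 0 := fun r => by
        rw [show ((4 : ℝ) : ℂ) * (Complex.I * lam * (r : ℂ) ^ 2)
          = ((4 * lam * r ^ 2 : ℝ) : ℂ) * Complex.I by push_cast; ring]
        rw [Complex.re_ofReal_mul, Complex.I_re, mul_zero]
      have e6 := e5 ‖(H1.cubic (u t)).val‖
      simp only [Complex.coe_algebraMap]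
      rw [e6, add_zero, mul_left_comm, Complex.re_ofReal_mul]
  have h6 := (h3.const_mul (β / 2)).sub (h5.const_mul (lam / 4))
  refine h6.congr_deriv ?_
  rw [nonlin, H1.dx_smul, inner_smul_right, ← inner_conj_symm (H1.cubic (u t)).dx]
  generalize inner ℂ (u t).dx (H1.cubic (u t)).dx = z
  simp
  ring

/-! ### Global well-posedness -/

theorem integral_norm_sq (u : H1 L) : ∫ x, ‖H1.toC u x‖ ^ 2 = ‖u.val‖ ^ 2 := by
  have h := H1.inner_val u u
  rw [inner_self_eq_norm_sq_to_K] at h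
  have h2 : ∫ x, H1.toC u x * conj (H1.toC u x) = ((∫ x, ‖H1.toC u x‖ ^ 2 : ℝ) : ℂ) := by
    rw [← integral_complex_ofReal]
    congr 1
    ext1 x
    rw [Complex.mul_conj, Complex.normSq_eq_norm_sq]
  rw [h2] at h
  simp only [Complex.coe_algebraMap] at h
  exact_mod_cast h.symm

theorem quartic_nonneg (u : H1 L) : 0 ≤ quartic u := integral_nonneg fun x => by positivity

theorem quartic_le (u : H1 L) : quartic u ≤ ‖H1.toC u‖ ^ 2 * ‖u.val‖ ^ 2 := by
  rw [← integral_norm_sq, ← integral_const_mul]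
  refine integral_mono (integrable_continuous (by fun_prop)) (integrable_continuous (by fun_prop))
    fun x => ?_
  have := (H1.toC u).norm_coe_le_norm x
  calc ‖H1.toC u x‖ ^ 4 = ‖H1.toC u x‖ ^ 2 * ‖H1.toC u x‖ ^ 2 := by ring
    _ ≤ ‖H1.toC u‖ ^ 2 * ‖H1.toC u x‖ ^ 2 := by gcongr

/-- Mass and energy control the `H¹` norm. -/
theorem exists_bound_of_energy_eq {β : ℝ} (hβ : 0 < β) (lam r : ℝ) :
    ∃ R : ℝ, ∀ u w : H1 L, ‖u‖ ≤ r → ‖w.val‖ ^ 2 = ‖u.val‖ ^ 2 →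
      energy β lam w = energy β lam u → ‖w‖ ≤ R := by
  have hL := period_pos L
  have htend : Tendsto (fun A => |lam| * r ^ 2 * (embConst L A / L)) atTop (𝓝 0) := by
    simpa using ((tendsto_embConst (L := L)).div_const L).const_mul (|lam| * r ^ 2)
  -- With this `A` the quartic term of the energy absorbs at most half of the kinetic term. The
  -- resulting bound on ‖∂ₓw‖² is (2A² + 3)r², and the mass adds one more r².
  obtain ⟨A, hA, hA0⟩ := ((htend.eventually (ge_mem_nhds hβ)).and (eventually_gt_atTop 0)).exists
  refine ⟨Real.sqrt ((2 * A ^ 2 + 4) * r ^ 2), fun u w hu hm he => Real.le_sqrt_of_sq_le ?_⟩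
  have hr : 0 ≤ r := (norm_nonneg u).trans hu
  have hmu : ‖u.val‖ ^ 2 ≤ r ^ 2 :=
    pow_le_pow_left₀ (norm_nonneg _) ((H1.norm_val_le u).trans hu) 2
  have hdu : ‖u.dx‖ ^ 2 ≤ r ^ 2 :=
    pow_le_pow_left₀ (norm_nonneg _) ((H1.norm_dx_le u).trans hu) 2
  have hQ : ∀ z : H1 L, ‖z.val‖ ^ 2 ≤ r ^ 2 →
      |lam| * quartic z ≤ β * (A ^ 2 * r ^ 2 + ‖z.dx‖ ^ 2) := by
    intro z hz
    have hc := embConst_nonneg (L := L) A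
    have h1 : quartic z
        ≤ (embConst L A / L * (A ^ 2 * r ^ 2 + ‖z.dx‖ ^ 2)) * r ^ 2 :=
      (quartic_le z).trans (mul_le_mul ((H1.norm_toC_sq_le z hA0).trans (by gcongr)) hz
        (by positivity) (by positivity))
    calc |lam| * quartic z
        ≤ |lam| * ((embConst L A / L * (A ^ 2 * r ^ 2 + ‖z.dx‖ ^ 2)) * r ^ 2) := by gcongr
      _ = (|lam| * r ^ 2 * (embConst L A / L)) * (A ^ 2 * r ^ 2 + ‖z.dx‖ ^ 2) := by ring
      _ ≤ _ := by gcongr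
  have h1 := hQ u hmu
  have h2 := hQ w (hm.trans_le hmu)
  have h3 : lam * quartic w ≤ |lam| * quartic w :=
    mul_le_mul_of_nonneg_right (le_abs_self _) (quartic_nonneg w)
  have h4 : -lam * quartic u ≤ |lam| * quartic u :=
    mul_le_mul_of_nonneg_right (neg_le_abs _) (quartic_nonneg u)
  rw [H1.norm_sq, hm]
  rw [energy, energy] at he
  have h5 : β * ‖w.dx‖ ^ 2 ≤ β * ((2 * A ^ 2 + 3) * r ^ 2) := by
    have h6 := mul_le_mul_of_nonneg_left hdu hβ.le
    nlinarith
  have h7 := le_of_mul_le_mul_left h5 hβ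
  linarith

/-- The vector field of the equation in the interaction picture. -/
def field (L : ℝ) [Fact (0 < L)] (β lam t : ℝ) (v : H1 L) : H1 L :=
  free L β (-t) (nonlin lam (free L β t v))

theorem isMild_of_field {β lam : ℝ} {v : ℝ → H1 L}
    (h : ∀ t, HasDerivAt v (field L β lam t (v t)) t) :
    IsMild L β lam fun t => free L β t (v t) := by
  intro t
  simp only [free_neg_free]
  exact h t

theorem IsMild.hasDerivAt_field {β lam : ℝ} {u : ℝ → H1 L} (h : IsMild L β lam u) (t : ℝ) :
    HasDerivAt (fun s => free L β (-s) (u s)) (field L β lam t (free L β (-t) (u t))) t := by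
  rw [field, free_free_neg]
  exact h t

theorem eq_of_hasDerivAt_zero {f : ℝ → ℝ} {t : ℝ}
    (h : ∀ s ∈ Set.uIcc 0 t, HasDerivAt f 0 s) : f t = f 0 := by
  have := intervalIntegral.integral_eq_sub_of_hasDerivAt h intervalIntegrable_const
  rw [intervalIntegral.integral_zero] at this
  linarith

theorem mass_energy_of_field {β lam t : ℝ} {v : ℝ → H1 L}
    (h : ∀ s ∈ Set.uIcc 0 t, HasDerivAt v (field L β lam s (v s)) s) :
    ‖(free L β t (v t)).val‖ ^ 2 = ‖(v 0).val‖ ^ 2 ∧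
      energy β lam (free L β t (v t)) = energy β lam (v 0) := by
  have h' : ∀ s ∈ Set.uIcc 0 t, HasDerivAt (fun τ => free L β (-τ) (free L β τ (v τ)))
      (free L β (-s) (nonlin lam (free L β s (v s)))) s := fun s hs => by
    simp only [free_neg_free]
    exact h s hs
  have h1 := eq_of_hasDerivAt_zero fun s hs => hasDerivAt_mass (h' s hs)
  have h2 := eq_of_hasDerivAt_zero fun s hs => hasDerivAt_energy (h' s hs)
  rw [free_zero] at h1 h2
  exact ⟨h1, h2⟩

theorem IsMild.mass_energy {β lam : ℝ} {u : ℝ → H1 L} (h : IsMild L β lam u) (t : ℝ) :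
    ‖(u t).val‖ ^ 2 = ‖(u 0).val‖ ^ 2 ∧ energy β lam (u t) = energy β lam (u 0) := by
  have := mass_energy_of_field (t := t) fun s _ => h.hasDerivAt_field s
  simpa only [free_free_neg, neg_zero, free_zero] using this

theorem field_lipschitz (β lam R : ℝ) : ∃ K : NNReal, ∀ (t : ℝ) (x y : H1 L), ‖x‖ ≤ R → ‖y‖ ≤ R →
    ‖field L β lam t x - field L β lam t y‖ ≤ K * ‖x - y‖ := by
  obtain ⟨K, hK⟩ := H1.exists_cubic_lipschitz (L := L) R
  refine ⟨⟨|lam| * K, by positivity⟩, fun t x y hx hy => ?_⟩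
  change _ ≤ |lam| * K * ‖x - y‖
  have h := hK (free L β t x) (free L β t y) (by rwa [LinearIsometry.norm_map])
    (by rwa [LinearIsometry.norm_map])
  rw [← map_sub, LinearIsometry.norm_map] at h
  rw [field, field, ← map_sub, LinearIsometry.norm_map, nonlin, nonlin, ← smul_sub, norm_smul,
    norm_mul, Complex.norm_I, one_mul, Complex.norm_real, Real.norm_eq_abs, mul_assoc]
  gcongr

theorem continuous_field (β lam : ℝ) (x : H1 L) : Continuous fun t => field L β lam t x :=
  continuous_free_comp β continuous_neg
    ((continuous_nonlin lam).comp (continuous_free_apply β x))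

theorem field_zero (β lam t : ℝ) : field L β lam t 0 = 0 := by
  rw [field, map_zero, nonlin, H1.cubic, map_zero, smul_zero, map_zero]

theorem exists_isMild {β : ℝ} (hβ : 0 < β) (lam : ℝ) (u₀ : H1 L) :
    ∃ u : ℝ → H1 L, IsMild L β lam u ∧ u 0 = u₀ := by
  obtain ⟨R, hR⟩ := exists_bound_of_energy_eq (L := L) hβ lam ‖u₀‖
  obtain ⟨v, hv0, hv⟩ := GlobalODE.exists_global_of_bound (continuous_field (L := L) β lam)
    (field_zero β lam) (field_lipschitz β lam) (hR u₀ u₀ le_rfl rfl rfl) fun v t hv0 hv => by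
      obtain ⟨h1, h2⟩ := mass_energy_of_field hv
      rw [hv0] at h1 h2
      have := hR u₀ _ le_rfl h1 h2
      rwa [LinearIsometry.norm_map] at this
  exact ⟨_, isMild_of_field hv, by rw [free_zero, hv0]⟩

/-- Mild solutions depend on their data in a locally Lipschitz way. -/
theorem exists_dist_le {β : ℝ} (hβ : 0 < β) (lam r : ℝ) : ∃ K : NNReal, ∀ u w : ℝ → H1 L,
    IsMild L β lam u → IsMild L β lam w → ‖u 0‖ ≤ r → ‖w 0‖ ≤ r →
      ∀ t, dist (u t) (w t) ≤ dist (u 0) (w 0) * Real.exp (K * |t|) := by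
  obtain ⟨R, hR⟩ := exists_bound_of_energy_eq (L := L) hβ lam r
  obtain ⟨K, hK⟩ := field_lipschitz (L := L) β lam R
  have hb : ∀ u : ℝ → H1 L, IsMild L β lam u → ‖u 0‖ ≤ r → ∀ t, ‖free L β (-t) (u t)‖ ≤ R :=
    fun u hu h t => by
      rw [LinearIsometry.norm_map]
      exact hR _ _ h (hu.mass_energy t).1 (hu.mass_energy t).2
  refine ⟨K, fun u w hu hw hur hwr t => ?_⟩
  have := GlobalODE.dist_le_of_global (F := field L β lam) (K := K) (s := Metric.closedBall 0 R)
    (fun t => LipschitzOnWith.of_dist_le_mul fun x hx y hy => by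
      rw [dist_eq_norm, dist_eq_norm]
      exact hK t x y (by simpa using hx) (by simpa using hy))
    hu.hasDerivAt_field hw.hasDerivAt_field (fun t => by simpa using hb u hu hur t)
    (fun t => by simpa using hb w hw hwr t) t
  simpa only [LinearIsometry.dist_map, neg_zero, free_zero] using this

theorem IsMild.unique {β lam : ℝ} (hβ : 0 < β) {u w : ℝ → H1 L} (hu : IsMild L β lam u)
    (hw : IsMild L β lam w) (h : u 0 = w 0) : u = w := by
  obtain ⟨K, hK⟩ := exists_dist_le (L := L) hβ lam ‖u 0‖
  ext1 t
  have := hK u w hu hw le_rfl (by rw [h]) t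
  rw [h, dist_self, zero_mul] at this
  exact dist_le_zero.1 this

/-! ### Symmetries of the equation and the flow -/

theorem IsMild.comp_add {β lam : ℝ} {u : ℝ → H1 L} (hu : IsMild L β lam u) (τ : ℝ) :
    IsMild L β lam fun t => u (t + τ) := by
  intro t
  have h := ((free L β τ).toContinuousLinearMap.restrictScalars ℝ).hasFDerivAt.comp_hasDerivAt t
    ((hu (t + τ)).comp_add_const t τ)
  refine (h.congr_of_eventuallyEq (Eventually.of_forall fun s => ?_)).congr_deriv ?_
  · change _ = free L β τ (free L β (-(s + τ)) (u (s + τ)))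
    rw [free_free]
    congr 2
    ring
  · change free L β τ (free L β (-(t + τ)) _) = _
    rw [free_free]
    congr 2
    ring

theorem nonlin_vadd (lam : ℝ) (g : ℝ × ℝ) (u : H1 L) : nonlin lam (g +ᵥ u) = g +ᵥ nonlin lam u := by
  rw [nonlin, H1.cubic_vadd, nonlin, H1.vadd_smul]

theorem nonlin_boost (lam : ℝ) (m : ℤ) (u : H1 L) :
    nonlin lam (H1.boost L m u) = H1.boost L m (nonlin lam u) := by
  rw [nonlin, H1.cubic_boost, nonlin, map_smul]

theorem IsMild.vadd {β lam : ℝ} {u : ℝ → H1 L} (hu : IsMild L β lam u) (g : ℝ × ℝ) :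
    IsMild L β lam fun t => g +ᵥ u t := by
  intro t
  have h := ((H1.diag L fun n => g.2 - waveNumber L n * g.1).toContinuousLinearMap.restrictScalars
    ℝ).hasFDerivAt.comp_hasDerivAt t (hu t)
  refine (h.congr_of_eventuallyEq (Eventually.of_forall fun s => ?_)).congr_deriv ?_
  · rw [free_vadd, H1.vadd_eq_diag]
    rfl
  · rw [nonlin_vadd, free_vadd, H1.vadd_eq_diag]
    rfl

/-- The motion, in the group `G`, of a solution boosted by `e^{2πimx/L}`. -/
def boostMotion (L β : ℝ) (m : ℤ) (t : ℝ) : ℝ × ℝ :=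
  (2 * β * waveNumber L m * t, β * waveNumber L m ^ 2 * t)

/-- Completing the square: β(kₙ - kₘ)² = βkₙ² - 2βkₘkₙ + βkₘ². The cross term, linear in kₙ, is a
translation and the last term is a phase. -/
theorem free_boost (β t : ℝ) (m : ℤ) (u : H1 L) : free L β (-t) (boostMotion L β m t +ᵥ
    H1.boost L m u) = H1.boost L m (free L β (-t) u) := by
  refine H1.ext_fc fun n => ?_
  rw [fc_free, H1.fc_boost, H1.fc_vadd, H1.fc_boost, fc_free, ← mul_assoc, ← Complex.exp_add,
    ← mul_add, ← Complex.ofReal_add, waveNumber_sub]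
  congr 4
  rw [boostMotion]
  ring

/-- Galilean invariance. -/
theorem IsMild.boost {β lam : ℝ} {u : ℝ → H1 L} (hu : IsMild L β lam u) (m : ℤ) :
    IsMild L β lam fun t => boostMotion L β m t +ᵥ H1.boost L m (u t) := by
  intro t
  have h := ((H1.boost L m).restrictScalars ℝ).hasFDerivAt.comp_hasDerivAt t (hu t)
  refine (h.congr_of_eventuallyEq (Eventually.of_forall fun s => ?_)).congr_deriv ?_
  · exact free_boost β s m (u s)
  · rw [nonlin_vadd, nonlin_boost, free_boost]
    rfl

theorem dist_vadd (g : ℝ × ℝ) (u v : H1 L) : dist (g +ᵥ u) (g +ᵥ v) = dist u v := by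
  rw [H1.vadd_eq_diag, H1.vadd_eq_diag, LinearIsometry.dist_map]

/-- `Φ` is the flow of the nonlinear Schrödinger equation, in mild form. -/
structure IsMildFlow (L : ℝ) [Fact (0 < L)] (β lam : ℝ) (Φ : ℝ → H1 L → H1 L) : Prop where
  isMild : ∀ u, IsMild L β lam fun t => Φ t u
  zero : ∀ u, Φ 0 u = u

theorem exists_isMildFlow {β : ℝ} (hβ : 0 < β) (lam : ℝ) :
    ∃ Φ : ℝ → H1 L → H1 L, IsMildFlow L β lam Φ := by
  choose U hU hU0 using exists_isMild (L := L) hβ lam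
  exact ⟨fun t u => U u t, hU, hU0⟩

namespace IsMildFlow

variable {β lam : ℝ} {Φ : ℝ → H1 L → H1 L}

theorem eq_of_isMild (h : IsMildFlow L β lam Φ) (hβ : 0 < β) {u : ℝ → H1 L}
    (hu : IsMild L β lam u) (t : ℝ) : Φ t (u 0) = u t :=
  congrFun ((h.isMild (u 0)).unique hβ hu (h.zero _)) t

theorem isSolutionFlow (h : IsMildFlow L β lam Φ) (hβ : 0 < β) :
    DynSys.IsSolutionFlow (IsNLSSolution L β lam) Φ := by
  intro u₀ u
  rw [isNLSSolution_iff_isMild]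
  constructor
  · rintro ⟨hu, rfl⟩
    ext1 t
    exact (h.eq_of_isMild hβ hu t).symm
  · rintro rfl
    exact ⟨h.isMild u₀, h.zero u₀⟩

theorem isDynamicalSystem (h : IsMildFlow L β lam Φ) (hβ : 0 < β) :
    DynSys.IsDynamicalSystem Φ where
  continuous_time u := (h.isMild u).continuous
  continuous_space t := by
    refine continuous_iff_continuousAt.2 fun u => ?_
    obtain ⟨K, hK⟩ := exists_dist_le (L := L) hβ lam (‖u‖ + 1)
    refine continuousAt_of_locally_lipschitz one_pos (Real.exp (K * |t|)) fun v hv => ?_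
    have hv' : ‖v‖ ≤ ‖u‖ + 1 := by
      rw [dist_eq_norm] at hv
      linarith [norm_le_norm_add_norm_sub' v u]
    have := hK _ _ (h.isMild v) (h.isMild u) (by rw [h.zero]; exact hv')
      (by rw [h.zero]; linarith) t
    rwa [h.zero, h.zero, mul_comm] at this
  zero := h.zero
  comp t s u := by
    have := h.eq_of_isMild hβ ((h.isMild u).comp_add s) t
    rwa [zero_add] at this

theorem isInvarianceGroup (h : IsMildFlow L β lam Φ) (hβ : 0 < β) :
    DynSys.IsInvarianceGroup (ℝ × ℝ) Φ := by
  intro g t u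
  have := h.eq_of_isMild hβ ((h.isMild u).vadd g) t
  rw [h.zero] at this
  exact this.symm

/-- The group motion is invisible at the level of orbits, so this identity carries relative
equilibria and stability from constants to plane waves. -/
theorem apply_boost (h : IsMildFlow L β lam Φ) (hβ : 0 < β) (m : ℤ) (t : ℝ) (u : H1 L) :
    Φ t (H1.boost L m u) = boostMotion L β m t +ᵥ H1.boost L m (Φ t u) := by
  have h1 := h.eq_of_isMild hβ ((h.isMild u).boost m) t
  have h0 : boostMotion L β m 0 = 0 := by
    ext <;> simp [boostMotion]
  rwa [h0, h.zero, zero_vadd] at h1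

end IsMildFlow

/-! ### Functions with small derivative -/

namespace H1

/-- The mean value of a function. -/
def mean (u : H1 L) : ℂ := (L : ℂ)⁻¹ * fc u.val 0

/-- The part of a function with vanishing mean. -/
def fluct (u : H1 L) : H1 L := u - mean u • expo L 0

theorem dx_expo_zero : (expo L 0).dx = 0 := by
  rw [dx_expo, waveNumber]
  simp

theorem dx_fluct (u : H1 L) : (fluct u).dx = u.dx := by
  rw [fluct, dx_sub, dx_smul, dx_expo_zero, smul_zero, sub_zero]

theorem fc_fluct_zero (u : H1 L) : fc (fluct u).val 0 = 0 := by
  have hL : (L : ℂ) ≠ 0 := by exact_mod_cast (period_pos L).ne'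
  rw [← fcL_apply, fluct, val_sub, map_sub, val_smul, map_smul, fcL_apply, fcL_apply, val_expo,
    fc_wave, if_pos rfl, mean, smul_eq_mul]
  field_simp
  ring

theorem fluct_add_mean (u : H1 L) : u = fluct u + mean u • expo L 0 := by
  rw [fluct, sub_add_cancel]

theorem norm_sq_wave (n : ℤ) : ‖wave L n‖ ^ 2 = L := by
  have h := inner_wave (L := L) n n
  rw [if_pos rfl, inner_self_eq_norm_sq_to_K] at h
  simp only [Complex.coe_algebraMap] at h
  exact_mod_cast h

theorem norm_sq_val_add_const (w : H1 L) (hw : fc w.val 0 = 0) (c : ℂ) :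
    ‖(w + c • expo L 0).val‖ ^ 2 = ‖w.val‖ ^ 2 + L * ‖c‖ ^ 2 := by
  have h0 : inner ℂ w.val (c • wave L 0) = 0 := by
    rw [inner_smul_right, ← inner_conj_symm, ← fc_eq_inner, hw, map_zero, mul_zero]
  have h := norm_add_sq (𝕜 := ℂ) w.val (c • wave L 0)
  rw [h0] at h
  rw [val_add, val_smul, val_expo, h, norm_smul, mul_pow, norm_sq_wave]
  simp only [map_zero]
  ring

theorem norm_sq_val_eq (u : H1 L) :
    ‖u.val‖ ^ 2 = ‖(fluct u).val‖ ^ 2 + L * ‖mean u‖ ^ 2 := by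
  rw [← norm_sq_val_add_const _ (fc_fluct_zero u), ← fluct_add_mean]

/-- The Poincaré–Wirtinger inequality with its sharp constant. -/
theorem wirtinger (u : H1 L) :
    (2 * Real.pi / L) ^ 2 * ‖(fluct u).val‖ ^ 2 ≤ ‖u.dx‖ ^ 2 := by
  have hL := period_pos L
  have h1 := (hasSum_sq_fc (fluct u).val).mul_left ((2 * Real.pi / L) ^ 2)
  have h2 := hasSum_sq_fc (fluct u).dx
  have h3 : (2 * Real.pi / L) ^ 2 * (L * ‖(fluct u).val‖ ^ 2) ≤ L * ‖(fluct u).dx‖ ^ 2 := by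
    refine hasSum_le (fun n => ?_) h1 h2
    rw [fc_dx, norm_mul, norm_mul, Complex.norm_I, one_mul, Complex.norm_real, Real.norm_eq_abs,
      mul_pow, sq_abs, waveNumber, mul_pow]
    rcases eq_or_ne n 0 with rfl | hn
    · rw [fc_fluct_zero]
      simp
    · have : (1 : ℝ) ≤ (n : ℝ) ^ 2 := by
        have h : (1 : ℤ) ≤ n ^ 2 := Int.one_le_abs hn |>.trans (by
          rw [← sq_abs]; nlinarith [Int.one_le_abs hn])
        exact_mod_cast h
      refine mul_le_mul_of_nonneg_right ?_ (by positivity)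
      exact le_mul_of_one_le_right (by positivity) this
  rw [dx_fluct, mul_left_comm] at h3
  exact le_of_mul_le_mul_left h3 hL

theorem toC_expo_zero (x : AddCircle L) : toC (expo L 0) x = 1 := by
  rw [toC_expo, fourier_zero]

theorem exists_norm_toC_fluct_le (L : ℝ) [Fact (0 < L)] :
    ∃ C : ℝ, 0 ≤ C ∧ ∀ u : H1 L, ‖toC (fluct u)‖ ≤ C * ‖u.dx‖ := by
  have hL := period_pos L
  have hc := embConst_nonneg (L := L) 1
  refine ⟨Real.sqrt (embConst L 1 / L * (((2 * Real.pi / L) ^ 2)⁻¹ + 1)), Real.sqrt_nonneg _,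
    fun u => ?_⟩
  refine le_of_sq_le_sq ?_ (by positivity)
  rw [mul_pow, Real.sq_sqrt (by positivity)]
  refine (norm_toC_sq_le (fluct u) one_pos).trans ?_
  rw [dx_fluct, mul_assoc]
  have h1 : ‖(fluct u).val‖ ^ 2 ≤ ((2 * Real.pi / L) ^ 2)⁻¹ * ‖u.dx‖ ^ 2 := by
    rw [← div_eq_inv_mul, le_div_iff₀' (by positivity)]
    exact wirtinger u
  gcongr
  linarith

end H1

/-- The quantity `∫ (|u|² - m)²`, where `m` is the mean of `|u|²`. -/
def modulusVariance (u : H1 L) : ℝ := quartic u - (‖u.val‖ ^ 2) ^ 2 / L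

/-- The second moment of |u|² about `a` is its variance plus a square. Taking `a` equal to the mean
shows that the variance is nonnegative; other values of `a` bound it from above. -/
theorem integral_sq_modulus_sub (u : H1 L) (a : ℝ) : ∫ x, (‖H1.toC u x‖ ^ 2 - a) ^ 2
    = modulusVariance u + L * (‖u.val‖ ^ 2 / L - a) ^ 2 := by
  have hL := period_pos L
  have e : ∀ x, (‖H1.toC u x‖ ^ 2 - a) ^ 2
      = (‖H1.toC u x‖ ^ 4 - 2 * a * ‖H1.toC u x‖ ^ 2) + a ^ 2 := fun x => by ring
  simp only [e]
  rw [integral_add (integrable_continuous (by fun_prop)) (integrable_const _),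
    integral_sub (integrable_continuous (by fun_prop)) (integrable_continuous (by fun_prop)),
    integral_const_mul, integral_norm_sq, integral_const, measureReal_def,
    AddCircle.measure_univ, ENNReal.toReal_ofReal hL.le, modulusVariance, quartic]
  rw [smul_eq_mul]
  field_simp
  ring

theorem modulusVariance_nonneg (u : H1 L) : 0 ≤ modulusVariance u := by
  have h := integral_sq_modulus_sub u (‖u.val‖ ^ 2 / L)
  rw [sub_self, zero_pow two_ne_zero, mul_zero, add_zero] at h
  rw [← h]
  exact integral_nonneg fun x => sq_nonneg _

/-- Replacing the mean of |u|² by |c|², where c is the mean of u, can only increase the integral.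
With w = u - c, the factors of |u|² - |c|² are at most 2|c| + |w| and |w|. -/
theorem modulusVariance_le (u : H1 L) : modulusVariance u
    ≤ (2 * ‖H1.mean u‖ + ‖H1.toC (H1.fluct u)‖) ^ 2 * ‖(H1.fluct u).val‖ ^ 2 := by
  have hL := period_pos L
  have h := integral_sq_modulus_sub u (‖H1.mean u‖ ^ 2)
  have h1 : modulusVariance u ≤ ∫ x, (‖H1.toC u x‖ ^ 2 - ‖H1.mean u‖ ^ 2) ^ 2 := by
    rw [h]
    have : 0 ≤ L * (‖u.val‖ ^ 2 / L - ‖H1.mean u‖ ^ 2) ^ 2 := by positivity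
    linarith
  refine h1.trans ?_
  rw [← integral_norm_sq, ← integral_const_mul]
  refine integral_mono (integrable_continuous (by fun_prop)) (integrable_continuous (by fun_prop))
    fun x => ?_
  have e : H1.toC u x = H1.toC (H1.fluct u) x + H1.mean u := by
    conv_lhs => rw [H1.fluct_add_mean u]
    rw [H1.toC_add_apply, H1.toC_smul_apply, H1.toC_expo_zero, mul_one]
  have hw := (H1.toC (H1.fluct u)).norm_coe_le_norm x
  simp only
  rw [e, sq_sub_sq, mul_pow]
  generalize H1.toC (H1.fluct u) x = w at *
  generalize H1.mean u = c at *
  have h2 : ‖w + c‖ + ‖c‖ ≤ 2 * ‖c‖ + ‖H1.toC (H1.fluct u)‖ := by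
    linarith [norm_add_le w c]
  have h3 : |‖w + c‖ - ‖c‖| ≤ ‖w‖ := by
    simpa using abs_norm_sub_norm_le (w + c) c
  rw [← sq_abs (‖w + c‖ - ‖c‖)]
  gcongr

/-- The conserved quantity `β/2 ∫ |∂ₓu|² - λ/4 ∫ (|u|² - m)²`. -/
def relEnergy (β lam : ℝ) (u : H1 L) : ℝ :=
  β / 2 * ‖u.dx‖ ^ 2 - lam / 4 * modulusVariance u

/-- The difference from the energy depends on the mass alone, hence conservation. -/
theorem relEnergy_eq (β lam : ℝ) (u : H1 L) :
    relEnergy β lam u = energy β lam u + lam / 4 * ((‖u.val‖ ^ 2) ^ 2 / L) := by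
  rw [relEnergy, energy, modulusVariance]
  ring

/-- Near the constants of modulus `|α|`, the conserved quantity is equivalent to `∫ |∂ₓu|²`. -/
theorem exists_relEnergy_bounds {β lam α : ℝ} (hβ : 0 < β)
    (hα : 0 < β * (2 * Real.pi / L) ^ 2 - 2 * lam * |α| ^ 2) :
    ∃ ρ μ C : ℝ, 0 < ρ ∧ 0 < μ ∧ 0 ≤ C ∧ ∀ u : H1 L,
      ‖u.val‖ ^ 2 ≤ L * (|α| + ρ) ^ 2 → ‖u.dx‖ ≤ ρ →
        μ * ‖u.dx‖ ^ 2 ≤ relEnergy β lam u ∧ relEnergy β lam u ≤ C * ‖u.dx‖ ^ 2 := by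
  have hL := period_pos L
  obtain ⟨C, hC0, hC⟩ := H1.exists_norm_toC_fluct_le L
  set κ := (2 * Real.pi / L) ^ 2 with hκ
  have hκ0 : 0 < κ := by positivity
  -- `h t` is the coercivity constant available when |mean u| ≤ |α| + t and ‖∂ₓu‖ ≤ t. At t = 0 it
  -- is (βκ - 2λ⁺α²)/(2κ), positive by the condition on α, and continuity provides ρ. Only the
  -- positive part of λ matters, as a defocusing term has the good sign.
  set h : ℝ → ℝ := fun t =>
    β / 2 - max lam 0 / 4 * (κ⁻¹ * (2 * (|α| + t) + C * t) ^ 2) with hh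
  have hcont : Continuous h := by
    rw [hh]
    fun_prop
  have h0 : 0 < h 0 := by
    have e : h 0 = κ⁻¹ / 2 * (β * κ - 2 * max lam 0 * |α| ^ 2) := by
      rw [hh]
      field_simp
      ring
    rw [e]
    refine mul_pos (by positivity) ?_
    rcases le_total lam 0 with hl | hl
    · rw [max_eq_right hl]
      simpa using mul_pos hβ hκ0
    · rwa [max_eq_left hl]
  obtain ⟨ρ, hρ, hρ0⟩ := (((hcont.tendsto 0).eventually (lt_mem_nhds h0)).filter_mono
    nhdsWithin_le_nhds |>.and (self_mem_nhdsWithin (s := Set.Ioi (0 : ℝ)))).exists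
  have hρ0 : 0 < ρ := hρ0
  set S := κ⁻¹ * (2 * (|α| + ρ) + C * ρ) ^ 2 with hS
  have hS0 : 0 ≤ S := by positivity
  refine ⟨ρ, h ρ, β / 2 + |lam| / 4 * S, hρ0, hρ, by positivity, fun u hu hdu => ?_⟩
  have hmean : ‖H1.mean u‖ ≤ |α| + ρ := by
    refine le_of_sq_le_sq ?_ (by positivity)
    refine le_of_mul_le_mul_left ?_ hL
    have := H1.norm_sq_val_eq u
    nlinarith [sq_nonneg ‖(H1.fluct u).val‖]
  have hV : modulusVariance u ≤ S * ‖u.dx‖ ^ 2 := by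
    have h1 : ‖(H1.fluct u).val‖ ^ 2 ≤ κ⁻¹ * ‖u.dx‖ ^ 2 := by
      rw [← div_eq_inv_mul, le_div_iff₀' hκ0]
      exact H1.wirtinger u
    have h2 : 2 * ‖H1.mean u‖ + ‖H1.toC (H1.fluct u)‖ ≤ 2 * (|α| + ρ) + C * ρ := by
      have := (hC u).trans (mul_le_mul_of_nonneg_left hdu hC0)
      linarith
    calc modulusVariance u
        ≤ (2 * ‖H1.mean u‖ + ‖H1.toC (H1.fluct u)‖) ^ 2 * ‖(H1.fluct u).val‖ ^ 2 :=
          modulusVariance_le u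
      _ ≤ (2 * (|α| + ρ) + C * ρ) ^ 2 * (κ⁻¹ * ‖u.dx‖ ^ 2) := by gcongr
      _ = S * ‖u.dx‖ ^ 2 := by rw [hS]; ring
  have hV0 := modulusVariance_nonneg u
  constructor
  · have h1 : lam * modulusVariance u ≤ max lam 0 * (S * ‖u.dx‖ ^ 2) :=
      (mul_le_mul_of_nonneg_right (le_max_left lam 0) hV0).trans
        (mul_le_mul_of_nonneg_left hV (le_max_right _ _))
    have e : h ρ = β / 2 - max lam 0 / 4 * S := by rw [hh]
    rw [relEnergy, e]
    linarith
  · have h1 : -lam * modulusVariance u ≤ |lam| * (S * ‖u.dx‖ ^ 2) :=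
      (mul_le_mul_of_nonneg_right (neg_le_abs lam) hV0).trans
        (mul_le_mul_of_nonneg_left hV (abs_nonneg _))
    rw [relEnergy]
    linarith

theorem planeWave_zero (α : ℝ) : planeWave L α 0 = (α : ℂ) • H1.expo L 0 := by
  refine H1.ext_toC fun x => ?_
  rw [planeWave, H1.toC_ofSmooth, H1.toC_smul_apply, H1.toC_expo, neg_zero]

theorem vadd_planeWave_zero (α γ : ℝ) : ((0, γ) : ℝ × ℝ) +ᵥ planeWave L α 0
    = (α * Complex.exp (Complex.I * γ)) • H1.expo L 0 := by
  refine H1.ext_toC fun x => ?_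
  rw [H1.toC_vadd, planeWave_zero, H1.toC_smul_apply, H1.toC_smul_apply, H1.toC_expo_zero,
    H1.toC_expo_zero]
  ring

theorem exists_phase (α : ℝ) (c : ℂ) :
    ∃ γ : ℝ, ‖c - α * Complex.exp (Complex.I * γ)‖ = |‖c‖ - (|α|)| := by
  have e : ∃ γ : ℝ, (α : ℂ) * Complex.exp (Complex.I * γ)
      = (|α| : ℝ) * Complex.exp (Complex.I * c.arg) := by
    rcases le_total 0 α with h | h
    · exact ⟨c.arg, by rw [abs_of_nonneg h]⟩
    -- For negative `α` the phase is turned by π.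
    · refine ⟨c.arg + Real.pi, ?_⟩
      rw [abs_of_nonpos h]
      push_cast
      rw [mul_add, Complex.exp_add, mul_comm Complex.I (Real.pi : ℂ), Complex.exp_pi_mul_I]
      ring
  obtain ⟨γ, hγ⟩ := e
  refine ⟨γ, ?_⟩
  rw [hγ]
  have hc : c = (‖c‖ : ℝ) * Complex.exp (Complex.I * c.arg) := by
    rw [mul_comm Complex.I]
    exact (Complex.norm_mul_exp_arg_mul_I c).symm
  have h : c - (|α| : ℝ) * Complex.exp (Complex.I * c.arg)
      = ((‖c‖ - |α| : ℝ) : ℂ) * Complex.exp (Complex.I * c.arg) := by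
    rw [Complex.ofReal_sub, sub_mul]
    exact congrArg (fun z => z - (|α| : ℝ) * Complex.exp (Complex.I * c.arg)) hc
  rw [h, norm_mul, mul_comm Complex.I, Complex.norm_exp_ofReal_mul_I, mul_one, Complex.norm_real,
    Real.norm_eq_abs]

/-- The phase of the mean is matched exactly, and its modulus is fixed by the mass up to the
fluctuation. The squared fluctuation is thus counted twice, once in the norm and once in the mass
defect, which explains the factor 2 in front of Wirtinger's constant. -/
theorem exists_dist_planeWave_zero_le (α : ℝ) (u : H1 L) : ∃ γ : ℝ,
    dist u (((0, γ) : ℝ × ℝ) +ᵥ planeWave L α 0) ^ 2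
      ≤ (2 * ((2 * Real.pi / L) ^ 2)⁻¹ + 1) * ‖u.dx‖ ^ 2 + |‖u.val‖ ^ 2 - L * |α| ^ 2| := by
  have hL := period_pos L
  obtain ⟨γ, hγ⟩ := exists_phase α (H1.mean u)
  refine ⟨γ, ?_⟩
  have e : u - (α * Complex.exp (Complex.I * γ)) • H1.expo L 0
      = H1.fluct u + (H1.mean u - α * Complex.exp (Complex.I * γ)) • H1.expo L 0 := by
    rw [H1.fluct, sub_smul]
    abel
  rw [dist_eq_norm, vadd_planeWave_zero, e, H1.norm_sq,
    H1.norm_sq_val_add_const _ (H1.fc_fluct_zero u), hγ, sq_abs, H1.dx_add, H1.dx_smul,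
    H1.dx_expo_zero, smul_zero, add_zero, H1.dx_fluct]
  have h1 : ‖(H1.fluct u).val‖ ^ 2 ≤ ((2 * Real.pi / L) ^ 2)⁻¹ * ‖u.dx‖ ^ 2 := by
    rw [← div_eq_inv_mul, le_div_iff₀' (by positivity)]
    exact H1.wirtinger u
  have h2 := H1.norm_sq_val_eq u
  -- For nonnegative x and y, |x - y| ≤ x + y, hence (x - y)² ≤ |x² - y²|; this covers α = 0 as
  -- well.
  have h3 : (‖H1.mean u‖ - |α|) ^ 2 ≤ |‖H1.mean u‖ ^ 2 - |α| ^ 2| := by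
    rw [sq_sub_sq, abs_mul, ← sq_abs, sq]
    refine mul_le_mul_of_nonneg_right ?_ (abs_nonneg _)
    rw [abs_le, abs_of_nonneg (by positivity : 0 ≤ ‖H1.mean u‖ + |α|)]
    constructor <;> linarith [norm_nonneg (H1.mean u), abs_nonneg α]
  have h4 : L * |‖H1.mean u‖ ^ 2 - |α| ^ 2|
      ≤ |‖u.val‖ ^ 2 - L * |α| ^ 2| + ‖(H1.fluct u).val‖ ^ 2 := by
    have h6 : L * |‖H1.mean u‖ ^ 2 - |α| ^ 2| = |L * (‖H1.mean u‖ ^ 2 - |α| ^ 2)| := by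
      rw [abs_mul, abs_of_pos hL]
    rw [h6]
    calc |L * (‖H1.mean u‖ ^ 2 - |α| ^ 2)|
        = |(‖u.val‖ ^ 2 - L * |α| ^ 2) - ‖(H1.fluct u).val‖ ^ 2| := by
          rw [h2]; congr 1; ring
      _ ≤ |‖u.val‖ ^ 2 - L * |α| ^ 2| + |‖(H1.fluct u).val‖ ^ 2| := abs_sub _ _
      _ = _ := by rw [abs_of_nonneg (sq_nonneg ‖(H1.fluct u).val‖)]
  have h5 := mul_le_mul_of_nonneg_left h3 hL.le
  linarith

/-! ### Orbital stability -/

/-- Trajectories starting near `p` stay near the group orbit of `p`. -/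
def StaysNearOrbit (Φ : ℝ → H1 L → H1 L) (p : H1 L) : Prop :=
  ∀ ε : ℝ, 0 < ε → ∃ δ : ℝ, 0 < δ ∧ ∀ v : H1 L, dist v p ≤ δ →
    ∀ t : ℝ, ∃ g : ℝ × ℝ, dist (Φ t v) (g +ᵥ p) ≤ ε

theorem StaysNearOrbit.isOrbitallyStable {Φ : ℝ → H1 L → H1 L} {p : H1 L}
    (h : StaysNearOrbit Φ p) (h0 : Φ 0 p = p) : DynSys.IsOrbitallyStable (ℝ × ℝ) Φ p := by
  intro ε hε
  obtain ⟨δ, hδ, H⟩ := h ε hε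
  refine ⟨δ, hδ, fun v hv t => ?_⟩
  obtain ⟨g, hg⟩ := H v hv t
  -- The time t' = 0 suffices, since the estimate is already relative to the group orbit of `p`
  -- itself.
  refine (ciInf_le ⟨0, ?_⟩ 0).trans ?_
  · rintro _ ⟨t', rfl⟩
    exact Metric.infDist_nonneg
  · rw [h0]
    exact (Metric.infDist_le_dist_of_mem (AddAction.mem_orbit p g)).trans hg

/-- The group acts by isometries commuting with the flow, and it is commutative, so `g` can be moved
past the element that realizes the distance. -/
theorem StaysNearOrbit.vadd {Φ : ℝ → H1 L → H1 L} {p : H1 L} (h : StaysNearOrbit Φ p)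
    (hG : DynSys.IsInvarianceGroup (ℝ × ℝ) Φ) (g : ℝ × ℝ) : StaysNearOrbit Φ (g +ᵥ p) := by
  intro ε hε
  obtain ⟨δ, hδ, H⟩ := h ε hε
  refine ⟨δ, hδ, fun v hv t => ?_⟩
  obtain ⟨k, hk⟩ := H (-g +ᵥ v) (by rwa [← dist_vadd g, vadd_neg_vadd]) t
  refine ⟨k, ?_⟩
  rw [← hG, ← dist_vadd g, vadd_neg_vadd, vadd_vadd] at hk
  rwa [vadd_vadd, add_comm]

theorem exists_dist_boost_le (m : ℤ) :
    ∃ C : ℝ, 0 < C ∧ ∀ u v : H1 L, dist (H1.boost L m u) (H1.boost L m v) ≤ C * dist u v := by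
  refine ⟨‖H1.boost L m‖ + 1, by positivity, fun u v => ?_⟩
  rw [dist_eq_norm, dist_eq_norm, ← map_sub]
  refine ((H1.boost L m).le_opNorm _).trans ?_
  gcongr
  linarith

theorem boost_neg_boost (m : ℤ) (u : H1 L) : H1.boost L (-m) (H1.boost L m u) = u := by
  rw [H1.boost_boost, neg_add_cancel, H1.boost_zero]

theorem boost_boost_neg (m : ℤ) (u : H1 L) : H1.boost L m (H1.boost L (-m) u) = u := by
  rw [H1.boost_boost, add_neg_cancel, H1.boost_zero]

/-- A boost and its inverse are Lipschitz in H¹, so conjugation by it costs only constants in δ and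
ε. The motion `k` is arbitrary: it is the Galilean one for the original equation and zero for the
modulated one. -/
theorem StaysNearOrbit.boost {Φ Ψ : ℝ → H1 L → H1 L} {p : H1 L} (h : StaysNearOrbit Φ p) (m : ℤ)
    {k : ℝ → ℝ × ℝ} (hΨ : ∀ t v, Ψ t (H1.boost L m v) = k t +ᵥ H1.boost L m (Φ t v)) :
    StaysNearOrbit Ψ (H1.boost L m p) := by
  intro ε hε
  obtain ⟨C, hC, hCb⟩ := exists_dist_boost_le (L := L) m
  obtain ⟨C', hC', hCb'⟩ := exists_dist_boost_le (L := L) (-m)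
  obtain ⟨δ, hδ, H⟩ := h (ε / C) (by positivity)
  refine ⟨δ / C', by positivity, fun v hv t => ?_⟩
  obtain ⟨g, hg⟩ := H (H1.boost L (-m) v) (by
    have := hCb' v (H1.boost L m p)
    rw [boost_neg_boost] at this
    refine this.trans ?_
    rwa [le_div_iff₀' hC'] at hv) t
  refine ⟨k t + (g.1, g.2 + waveNumber L m * g.1), ?_⟩
  have h1 := hΨ t (H1.boost L (-m) v)
  rw [boost_boost_neg] at h1
  rw [h1, add_vadd, ← H1.boost_vadd, dist_vadd]
  refine (hCb _ _).trans ?_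
  rwa [le_div_iff₀' hC] at hg

theorem isRelativeEquilibrium_vadd {Φ : ℝ → H1 L → H1 L} {p : H1 L}
    (h : DynSys.IsRelativeEquilibrium (ℝ × ℝ) Φ p) (hG : DynSys.IsInvarianceGroup (ℝ × ℝ) Φ)
    (g : ℝ × ℝ) : DynSys.IsRelativeEquilibrium (ℝ × ℝ) Φ (g +ᵥ p) := by
  intro t
  obtain ⟨k, hk⟩ := h t
  refine ⟨k, ?_⟩
  simp only at hk ⊢
  rw [← hG, ← hk, vadd_vadd, vadd_vadd, add_comm]

theorem isRelativeEquilibrium_boost {Φ Ψ : ℝ → H1 L → H1 L} {p : H1 L}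
    (h : DynSys.IsRelativeEquilibrium (ℝ × ℝ) Φ p) (m : ℤ)
    {k : ℝ → ℝ × ℝ} (hΨ : ∀ t v, Ψ t (H1.boost L m v) = k t +ᵥ H1.boost L m (Φ t v)) :
    DynSys.IsRelativeEquilibrium (ℝ × ℝ) Ψ (H1.boost L m p) := by
  intro t
  obtain ⟨g, hg⟩ := h t
  refine ⟨k t + (g.1, g.2 + waveNumber L m * g.1), ?_⟩
  simp only at hg ⊢
  rw [hΨ, ← hg, add_vadd, H1.boost_vadd]

theorem orbit_of_planeWave {Φ : ℝ → H1 L → H1 L} (hG : DynSys.IsInvarianceGroup (ℝ × ℝ) Φ)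
    (h0 : ∀ u, Φ 0 u = u) {p : H1 L} (hrel : DynSys.IsRelativeEquilibrium (ℝ × ℝ) Φ p)
    (hstab : StaysNearOrbit Φ p) : ∀ u ∈ AddAction.orbit (ℝ × ℝ) p,
      DynSys.IsRelativeEquilibrium (ℝ × ℝ) Φ u ∧ DynSys.IsOrbitallyStable (ℝ × ℝ) Φ u := by
  rintro _ ⟨g, rfl⟩
  exact ⟨isRelativeEquilibrium_vadd hrel hG g, (hstab.vadd hG g).isOrbitallyStable (h0 _)⟩

/-- The free group fixes constants, and |α|²α = α²α turns the equation into a pure rotation at speed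
λα². -/
theorem isMild_planeWave_zero (β lam α : ℝ) :
    IsMild L β lam fun t => ((0, lam * α ^ 2 * t) : ℝ × ℝ) +ᵥ planeWave L α 0 := by
  have e : ∀ s c : ℝ, ∀ z : ℂ, free L β (-s) (z • planeWave L c 0) = z • planeWave L c 0 := by
    intro s c z
    rw [map_smul, planeWave_zero, map_smul, free_expo, waveNumber]
    simp
  have e2 : ∀ t : ℝ, ((0, lam * α ^ 2 * t) : ℝ × ℝ) +ᵥ planeWave L α 0
      = Complex.exp (Complex.I * (lam * α ^ 2) * t) • planeWave L α 0 := by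
    intro t
    rw [vadd_planeWave_zero, planeWave_zero, smul_smul]
    congr 1
    push_cast
    ring_nf
  have e3 : H1.cubic (planeWave L α 0) = ((α : ℂ) ^ 2) • planeWave L α 0 := by
    refine H1.ext_toC fun x => ?_
    rw [H1.toC_cubic, H1.toC_smul_apply, planeWave_zero, H1.toC_smul_apply, H1.toC_expo_zero,
      mul_one, Complex.norm_real, Real.norm_eq_abs, sq_abs, Complex.ofReal_pow]
  intro t
  rw [nonlin_vadd, nonlin, e3, H1.vadd_smul, H1.vadd_smul]
  simp only [e2, smul_smul, e]
  have h1 : HasDerivAt (fun s : ℝ => Complex.I * (lam * α ^ 2) * (s : ℂ))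
      (Complex.I * (lam * α ^ 2)) t := by
    simpa using (Complex.ofRealCLM.hasDerivAt (x := t)).const_mul (Complex.I * (lam * (α : ℂ) ^ 2))
  refine (h1.cexp.smul_const (planeWave L α 0)).congr_deriv ?_
  congr 1
  ring

namespace IsMildFlow

variable {β lam : ℝ} {Φ : ℝ → H1 L → H1 L}

theorem isRelativeEquilibrium_planeWave_zero (h : IsMildFlow L β lam Φ) (hβ : 0 < β) (α : ℝ) :
    DynSys.IsRelativeEquilibrium (ℝ × ℝ) Φ (planeWave L α 0) := by
  intro t
  have h1 := h.eq_of_isMild hβ (isMild_planeWave_zero (L := L) β lam α) t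
  rw [mul_zero, show ((0, 0) : ℝ × ℝ) = 0 from rfl, zero_vadd] at h1
  exact ⟨_, h1.symm⟩

/-- Constants are stable, by a Lyapunov argument based on mass and energy. -/
theorem staysNearOrbit_planeWave_zero (h : IsMildFlow L β lam Φ) (hβ : 0 < β) {α : ℝ}
    (hα : 0 < β * (2 * Real.pi / L) ^ 2 - 2 * lam * |α| ^ 2) :
    StaysNearOrbit Φ (planeWave L α 0) := by
  have hL := period_pos L
  obtain ⟨ρ, μ, C, hρ, hμ, hC, hE⟩ := exists_relEnergy_bounds (L := L) hβ hα
  intro ε hε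
  set D := 2 * ((2 * Real.pi / L) ^ 2)⁻¹ + 1 with hD
  have hD0 : 0 < D := by positivity
  have hs : 0 < Real.sqrt L := Real.sqrt_pos.2 hL
  -- `η` will bound the derivative along the trajectory: η < ρ leaves room for the continuity
  -- argument, and Dη² uses half of the allowed squared distance.
  obtain ⟨η, hη0, hηρ, hηε⟩ : ∃ η : ℝ, 0 < η ∧ η < ρ ∧ D * η ^ 2 ≤ ε ^ 2 / 2 := by
    have h1 : Tendsto (fun η : ℝ => D * η ^ 2) (𝓝[>] 0) (𝓝 0) := by
      have : Continuous fun η : ℝ => D * η ^ 2 := by fun_prop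
      simpa using (this.tendsto 0).mono_left nhdsWithin_le_nhds
    have h2 : 0 < ε ^ 2 / 2 := by positivity
    obtain ⟨η, ⟨h3, h4⟩, h5⟩ := ((h1.eventually (ge_mem_nhds h2)).and
      ((gt_mem_nhds hρ).filter_mono nhdsWithin_le_nhds) |>.and self_mem_nhdsWithin).exists
    exact ⟨η, h5, h4, h3⟩
  -- The conditions on δ serve, in order, the initial derivative, the mass bound required for
  -- coercivity, the initial value of the conserved quantity, and the mass defect, which uses the
  -- other half of ε².
  obtain ⟨δ, hδ0, hδη, hδρ, hδC, hδε⟩ : ∃ δ : ℝ, 0 < δ ∧ δ ≤ η ∧ δ ≤ Real.sqrt L * ρ ∧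
      C * δ ^ 2 ≤ μ * η ^ 2 ∧ δ * (2 * (Real.sqrt L * |α|) + δ) ≤ ε ^ 2 / 2 := by
    have h1 : Tendsto (fun δ : ℝ => C * δ ^ 2) (𝓝[>] 0) (𝓝 0) := by
      have : Continuous fun δ : ℝ => C * δ ^ 2 := by fun_prop
      simpa using (this.tendsto 0).mono_left nhdsWithin_le_nhds
    have h2 : Tendsto (fun δ : ℝ => δ * (2 * (Real.sqrt L * |α|) + δ)) (𝓝[>] 0) (𝓝 0) := by
      have : Continuous fun δ : ℝ => δ * (2 * (Real.sqrt L * |α|) + δ) := by fun_prop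
      simpa using (this.tendsto 0).mono_left nhdsWithin_le_nhds
    have h3 : 0 < μ * η ^ 2 := by positivity
    have h4 : 0 < ε ^ 2 / 2 := by positivity
    have h5 : 0 < Real.sqrt L * ρ := by positivity
    obtain ⟨δ, ⟨⟨⟨⟨a, b⟩, c⟩, d⟩, e⟩⟩ := ((h1.eventually (ge_mem_nhds h3)).and
      (h2.eventually (ge_mem_nhds h4)) |>.and ((ge_mem_nhds hη0).filter_mono nhdsWithin_le_nhds)
      |>.and ((ge_mem_nhds h5).filter_mono nhdsWithin_le_nhds) |>.and self_mem_nhdsWithin).exists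
    exact ⟨δ, e, c, d, a, b⟩
  refine ⟨δ, hδ0, fun v hv t => ?_⟩
  have hp : ‖(planeWave L α 0).val‖ = Real.sqrt L * |α| := by
    have hw := congrArg Real.sqrt (H1.norm_sq_wave (L := L) 0)
    rw [Real.sqrt_sq (norm_nonneg _)] at hw
    rw [planeWave_zero, H1.val_smul, H1.val_expo, norm_smul, Complex.norm_real, Real.norm_eq_abs,
      hw, mul_comm]
  rw [dist_eq_norm] at hv
  have hdv : ‖v.dx‖ ≤ δ := by
    have h1 := (H1.norm_dx_le (v - planeWave L α 0)).trans hv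
    rwa [H1.dx_sub, planeWave_zero, H1.dx_smul, H1.dx_expo_zero, smul_zero, sub_zero] at h1
  have hmv : |‖v.val‖ - Real.sqrt L * (|α|)| ≤ δ := by
    rw [← hp]
    refine (abs_norm_sub_norm_le _ _).trans ?_
    exact (H1.norm_val_le (v - planeWave L α 0)).trans hv
  have hmass : ∀ τ, ‖(Φ τ v).val‖ ^ 2 = ‖v.val‖ ^ 2 := fun τ => by
    have := ((h.isMild v).mass_energy τ).1
    rwa [h.zero] at this
  have hrel : ∀ τ, relEnergy β lam (Φ τ v) = relEnergy β lam v := fun τ => by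
    have := ((h.isMild v).mass_energy τ).2
    rw [h.zero] at this
    rw [relEnergy_eq, relEnergy_eq, hmass, this]
  have hub : ‖v.val‖ ≤ Real.sqrt L * |α| + δ := by linarith [(abs_le.1 hmv).2]
  have hvub : ‖v.val‖ ^ 2 ≤ L * (|α| + ρ) ^ 2 := by
    have e : L * (|α| + ρ) ^ 2 = (Real.sqrt L * (|α| + ρ)) ^ 2 := by
      rw [mul_pow, Real.sq_sqrt hL.le]
    rw [e]
    refine pow_le_pow_left₀ (norm_nonneg _) (hub.trans ?_) 2
    linarith
  have hEv : relEnergy β lam v ≤ μ * η ^ 2 :=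
    (hE v hvub (hdv.trans (hδη.trans hηρ.le))).2.trans
      ((mul_le_mul_of_nonneg_left (pow_le_pow_left₀ (norm_nonneg _) hdv 2) hC).trans hδC)
  -- While ‖∂ₓu‖ ≤ ρ, coercivity and conservation give μ‖∂ₓu‖² ≤ μη², which is strictly better than
  -- ρ; hence the bound η never fails.
  have hsmall := GlobalODE.le_of_bootstrap (g := fun τ => ‖(Φ τ v).dx‖)
    (H1.continuous_dx.comp (h.isMild v).continuous).norm hηρ
    (by rw [h.zero]; exact hdv.trans hδη) (fun τ hτ => by
      have h1 := (hE (Φ τ v) ((hmass τ).trans_le hvub) (hτ τ Set.right_mem_uIcc)).1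
      rw [hrel] at h1
      exact le_of_sq_le_sq (le_of_mul_le_mul_left (h1.trans hEv) hμ) hη0.le) t
  obtain ⟨γ, hγ⟩ := exists_dist_planeWave_zero_le α (Φ t v)
  refine ⟨(0, γ), le_of_sq_le_sq (hγ.trans ?_) hε.le⟩
  rw [hmass, ← hD]
  have h1 : D * ‖(Φ t v).dx‖ ^ 2 ≤ D * η ^ 2 := by gcongr
  have h2 : |‖v.val‖ ^ 2 - L * |α| ^ 2| ≤ δ * (2 * (Real.sqrt L * |α|) + δ) := by
    have e : ‖v.val‖ ^ 2 - L * |α| ^ 2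
        = (‖v.val‖ - Real.sqrt L * |α|) * (‖v.val‖ + Real.sqrt L * |α|) := by
      have := Real.sq_sqrt hL.le
      linear_combination (|α| ^ 2) * this
    rw [e, abs_mul, abs_of_nonneg (a := ‖v.val‖ + Real.sqrt L * |α|) (by positivity)]
    exact mul_le_mul hmv (by linarith) (by positivity) hδ0.le
  linarith

end IsMildFlow

/-! ### The modulated equation -/

theorem isSmooth_fourier_mul {φ : AddCircle L → ℂ} (hφ : IsSmooth φ) (n : ℤ) :
    IsSmooth fun x => fourier n x * φ x :=
  ContDiff.mul (𝕜 := ℝ) (isSmooth_fourier n) hφ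

theorem circleDeriv_fourier_mul {φ : AddCircle L → ℂ} (hφ : IsSmooth φ) (n : ℤ)
    (x : AddCircle L) : circleDeriv (fun y => fourier n y * φ y) x
      = fourier n x * (circleDeriv φ x + Complex.I * waveNumber L n * φ x) := by
  induction x using QuotientAddGroup.induction_on with
  | H x =>
    have h1 : HasDerivAt (fun y : ℝ => fourier n (y : AddCircle L))
        (circleDeriv (fourier n) (x : AddCircle L)) x := by
      rw [circleDeriv_coe]
      exact ((ContDiff.differentiable (𝕜 := ℝ) (isSmooth_fourier n) (by simp)) x).hasDerivAt
    have h2 : HasDerivAt (fun y : ℝ => φ (y : AddCircle L))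
        (circleDeriv φ (x : AddCircle L)) x := by
      rw [circleDeriv_coe]
      exact ((ContDiff.differentiable (𝕜 := ℝ) hφ (by simp)) x).hasDerivAt
    change circleDeriv (fun y => fourier n y * φ y) (x : AddCircle L)
      = fourier n (x : AddCircle L) * (circleDeriv φ (x : AddCircle L) +
        Complex.I * waveNumber L n * φ (x : AddCircle L))
    rw [circleDeriv_coe]
    refine (h1.mul h2).deriv.trans ?_
    rw [circleDeriv_fourier]
    ring

theorem dx_boost (n : ℤ) (u : H1 L) : (H1.boost L n u).dx
    = cmul (fourier n) (u.dx + (Complex.I * waveNumber L n) • u.val) := by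
  refine fc_injective fun j => ?_
  rw [H1.fc_dx, H1.fc_boost, fc_cmul_fourier, fc_add, fc_smul, H1.fc_dx, waveNumber_sub]
  push_cast
  ring

theorem integral_cmul (f : C(AddCircle L, ℂ)) (w : L2 L) (φ : AddCircle L → ℂ) :
    ∫ x, cmul f w x * φ x = ∫ x, w x * (f x * φ x) := by
  refine integral_congr_ae ?_
  filter_upwards [coeFn_cmul f w] with x hx
  rw [hx]
  ring

theorem integral_val_boost (n : ℤ) (u : H1 L) (φ : AddCircle L → ℂ) :
    ∫ x, (H1.boost L n u).val x * φ x = ∫ x, u.val x * (fourier n x * φ x) := by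
  rw [H1.val_boost, integral_cmul]

theorem integral_dx_boost (n : ℤ) (u : H1 L) {φ : AddCircle L → ℂ} (hφ : Continuous φ) :
    ∫ x, (H1.boost L n u).dx x * φ x = (∫ x, u.dx x * (fourier n x * φ x))
      + Complex.I * waveNumber L n * ∫ x, u.val x * (fourier n x * φ x) := by
  have hc : Continuous fun x : AddCircle L => fourier n x * φ x := by fun_prop
  rw [dx_boost, integral_cmul, ← integral_const_mul, ← integral_add (integrable_mul _ hc)
    ((integrable_mul _ hc).const_mul _)]
  refine integral_congr_ae ?_
  filter_upwards [Lp.coeFn_add u.dx ((Complex.I * waveNumber L n) • u.val),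
    Lp.coeFn_smul (Complex.I * (waveNumber L n : ℂ)) u.val] with x h1 h2
  rw [h1, Pi.add_apply, h2, Pi.smul_apply, smul_eq_mul]
  ring

/-- Conjugating ∂ₓ² by e^{ikx} yields ∂ₓ² - 2ik∂ₓ - k². In weak form the exponential passes to the
test function, and one integration by parts, `e2`, matches the first-order terms. -/
theorem modulated_rhs_eq (β lam : ℝ) (n : ℤ) (u : H1 L) {φ : AddCircle L → ℂ} (hφ : IsSmooth φ) :
    Complex.I * (- β * (∫ x, (H1.boost L n u).dx x * circleDeriv φ x)
        - 2 * Complex.I * β * waveNumber L n * (∫ x, (H1.boost L n u).dx x * φ x)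
        + lam * (∫ x, (‖(H1.boost L n u).val x‖ ^ 2 : ℝ) * (H1.boost L n u).val x * φ x)
        - β * waveNumber L n ^ 2 * ∫ x, (H1.boost L n u).val x * φ x)
      = Complex.I * (- β * (∫ x, u.dx x * circleDeriv (fun y => fourier n y * φ y) x)
        + lam * ∫ x, (‖u.val x‖ ^ 2 : ℝ) * u.val x * (fourier n x * φ x)) := by
  set k := waveNumber L n with hk
  have hc := hφ.continuous
  have hd := hφ.continuous_circleDeriv
  have hc' : Continuous fun x : AddCircle L => fourier n x * φ x := by fun_prop
  have hd' : Continuous fun x : AddCircle L => fourier n x * circleDeriv φ x := by fun_prop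
  have e1 : ∀ w : L2 L, ∫ x, w x * circleDeriv (fun y => fourier n y * φ y) x
      = (∫ x, w x * (fourier n x * circleDeriv φ x))
        + Complex.I * k * ∫ x, w x * (fourier n x * φ x) := by
    intro w
    rw [← integral_const_mul, ← integral_add (integrable_mul _ hd')
      ((integrable_mul _ hc').const_mul _)]
    refine integral_congr_ae (Eventually.of_forall fun x => ?_)
    simp only [circleDeriv_fourier_mul hφ]
    ring
  have e2 := u.hasWeakDeriv _ (isSmooth_fourier_mul hφ n)
  rw [e1] at e2
  change (∫ x, u.val x * (fourier n x * circleDeriv φ x))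
    + Complex.I * k * (∫ x, u.val x * (fourier n x * φ x))
      = -∫ x, u.dx x * (fourier n x * φ x) at e2
  rw [integral_cubic, H1.cubic_boost, integral_val_boost, integral_val_boost, integral_cubic,
    integral_dx_boost n u hd, integral_dx_boost n u hc, e1, ← hk]
  linear_combination (-(Complex.I * β * Complex.I * k)) * e2
    - (Complex.I * β * k ^ 2 * ∫ x, u.val x * (fourier n x * φ x)) * Complex.I_sq

theorem isModulatedNLSSolution_boost {β lam : ℝ} {n : ℤ} {u : ℝ → H1 L} :
    IsModulatedNLSSolution L β lam (waveNumber L n) (fun t => H1.boost L n (u t))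
      ↔ IsNLSSolution L β lam u := by
  constructor
  · rintro ⟨hc, hd⟩
    constructor
    · have := (H1.boost L (-n)).continuous.comp hc
      simpa only [Function.comp_def, boost_neg_boost] using this
    · intro φ hφ t
      have h := hd _ (isSmooth_fourier_mul hφ (-n)) t
      rw [modulated_rhs_eq _ _ _ _ (isSmooth_fourier_mul hφ (-n))] at h
      have e : ∀ x : AddCircle L, fourier n x * (fourier (-n) x * φ x) = φ x := fun x => by
        rw [← mul_assoc, ← fourier_add, add_neg_cancel, fourier_zero, one_mul]
      simp only [integral_val_boost, e] at h
      exact h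
  · rintro ⟨hc, hd⟩
    refine ⟨(H1.boost L n).continuous.comp hc, fun φ hφ t => ?_⟩
    rw [modulated_rhs_eq _ _ _ _ hφ]
    simp only [integral_val_boost]
    exact hd _ (isSmooth_fourier_mul hφ n) t

/-- The flow of the modulated equation. -/
def modulatedFlow (n : ℤ) (Φ : ℝ → H1 L → H1 L) (t : ℝ) (U : H1 L) : H1 L :=
  H1.boost L n (Φ t (H1.boost L (-n) U))

theorem modulatedFlow_isSolutionFlow {β lam : ℝ} {Φ : ℝ → H1 L → H1 L}
    (h : DynSys.IsSolutionFlow (IsNLSSolution L β lam) Φ) (n : ℤ) :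
    DynSys.IsSolutionFlow (IsModulatedNLSSolution L β lam (waveNumber L n))
      (modulatedFlow n Φ) := by
  intro U₀ U
  have h1 := h (H1.boost L (-n) U₀) fun t => H1.boost L (-n) (U t)
  rw [← isModulatedNLSSolution_boost (n := n)] at h1
  simp only [boost_boost_neg] at h1
  have e : H1.boost L (-n) (U 0) = H1.boost L (-n) U₀ ↔ U 0 = U₀ := by
    refine ⟨fun he => ?_, fun he => by rw [he]⟩
    rw [← boost_boost_neg n (U 0), he, boost_boost_neg]
  rw [e] at h1
  rw [h1]
  constructor
  · intro he
    ext1 t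
    rw [modulatedFlow, ← congrFun he t, boost_boost_neg]
  · rintro rfl
    ext1 t
    exact boost_neg_boost n _

theorem modulatedFlow_isDynamicalSystem {Φ : ℝ → H1 L → H1 L} (h : DynSys.IsDynamicalSystem Φ)
    (n : ℤ) : DynSys.IsDynamicalSystem (modulatedFlow n Φ) where
  continuous_time U := (H1.boost L n).continuous.comp (h.continuous_time _)
  continuous_space t :=
    (H1.boost L n).continuous.comp ((h.continuous_space t).comp (H1.boost L (-n)).continuous)
  zero U := by rw [modulatedFlow, h.zero, boost_boost_neg]
  comp t s U := by simp only [modulatedFlow, boost_neg_boost, h.comp]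

/-- The phases ±ka produced by moving a translation across the two opposite boosts cancel. -/
theorem modulatedFlow_isInvarianceGroup {Φ : ℝ → H1 L → H1 L}
    (h : DynSys.IsInvarianceGroup (ℝ × ℝ) Φ) (n : ℤ) :
    DynSys.IsInvarianceGroup (ℝ × ℝ) (modulatedFlow n Φ) := by
  intro g t U
  rw [modulatedFlow, modulatedFlow, H1.boost_vadd, ← h, H1.boost_vadd, waveNumber_neg]
  congr 1
  ext <;> simp

end Torus
end

/-! ### Conclusion: transport from constants to plane waves and back -/

theorem mainTheorem1 (L β lam : ℝ) [Fact (0 < L)] (hβ : 0 < β) :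
    (∃ Φ : ℝ → Torus.H1 L → Torus.H1 L,
      DynSys.IsSolutionFlow (Torus.IsNLSSolution L β lam) Φ ∧
      DynSys.IsDynamicalSystem Φ ∧
      DynSys.IsInvarianceGroup (ℝ × ℝ) Φ ∧
      ∀ (α : ℝ) (n : ℤ), 0 < β * (2 * Real.pi / L) ^ 2 - 2 * lam * |α| ^ 2 →
        ∀ u ∈ AddAction.orbit (ℝ × ℝ) (Torus.planeWave L α n),
          DynSys.IsRelativeEquilibrium (ℝ × ℝ) Φ u ∧
          DynSys.IsOrbitallyStable (ℝ × ℝ) Φ u) ∧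
    (∀ n : ℤ, ∃ Ψ : ℝ → Torus.H1 L → Torus.H1 L,
      DynSys.IsSolutionFlow
        (Torus.IsModulatedNLSSolution L β lam (2 * Real.pi / L * n)) Ψ ∧
      DynSys.IsDynamicalSystem Ψ ∧
      DynSys.IsInvarianceGroup (ℝ × ℝ) Ψ ∧
      ∀ α : ℝ, 0 < β * (2 * Real.pi / L) ^ 2 - 2 * lam * |α| ^ 2 →
        ∀ U ∈ AddAction.orbit (ℝ × ℝ) (Torus.planeWave L α 0),
          DynSys.IsRelativeEquilibrium (ℝ × ℝ) Ψ U ∧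
          DynSys.IsOrbitallyStable (ℝ × ℝ) Ψ U) := by
  obtain ⟨Φ, hΦ⟩ := Torus.exists_isMildFlow (L := L) hβ lam
  have hsol := hΦ.isSolutionFlow hβ
  have hdyn := hΦ.isDynamicalSystem hβ
  have hinv := hΦ.isInvarianceGroup hβ
  -- The wave αe^{-ikx} with k = 2πn/L is the boost by `-n` of the constant α.
  have hrel : ∀ (α : ℝ) (n : ℤ),
      DynSys.IsRelativeEquilibrium (ℝ × ℝ) Φ (Torus.planeWave L α n) := fun α n => by
    have := Torus.isRelativeEquilibrium_boost
      (hΦ.isRelativeEquilibrium_planeWave_zero hβ α) (-n) (hΦ.apply_boost hβ (-n))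
    rwa [Torus.H1.boost_planeWave, sub_neg_eq_add, zero_add] at this
  have hstab : ∀ (α : ℝ) (n : ℤ), 0 < β * (2 * Real.pi / L) ^ 2 - 2 * lam * |α| ^ 2 →
      Torus.StaysNearOrbit Φ (Torus.planeWave L α n) := fun α n hα => by
    have := (hΦ.staysNearOrbit_planeWave_zero hβ hα).boost (-n) (hΦ.apply_boost hβ (-n))
    rwa [Torus.H1.boost_planeWave, sub_neg_eq_add, zero_add] at this
  refine ⟨⟨Φ, hsol, hdyn, hinv, fun α n hα =>
    Torus.orbit_of_planeWave hinv hdyn.zero (hrel α n) (hstab α n hα)⟩, fun n => ?_⟩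
  -- The boost conjugates the two flows exactly, so the accompanying group motion is trivial; it
  -- sends αe^{-ikx} back to the constant α.
  have hconj : ∀ t v, Torus.modulatedFlow n Φ t (Torus.H1.boost L n v)
      = (fun _ => (0 : ℝ × ℝ)) t +ᵥ Torus.H1.boost L n (Φ t v) := fun t v => by
    rw [Torus.modulatedFlow, Torus.boost_neg_boost, zero_vadd]
  refine ⟨Torus.modulatedFlow n Φ, Torus.modulatedFlow_isSolutionFlow hsol n,
    Torus.modulatedFlow_isDynamicalSystem hdyn n, Torus.modulatedFlow_isInvarianceGroup hinv n,
    fun α hα => Torus.orbit_of_planeWave (Torus.modulatedFlow_isInvarianceGroup hinv n)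
      (Torus.modulatedFlow_isDynamicalSystem hdyn n).zero ?_ ?_⟩
  · have := Torus.isRelativeEquilibrium_boost (hrel α n) n hconj
    rwa [Torus.H1.boost_planeWave, sub_self] at this
  · have := (hstab α n hα).boost n hconj
    rwa [Torus.H1.boost_planeWave, sub_self] at this
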